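/- Definitions. Let $x_1,\dots,x_n\in\mathbb R^d$ (repetitions allowed). For $w:\mathbb R^d\to[0,1]$ with $\sum_i w(x_i)>0$ and $\mu\in\mathbb R^d$ put $\mu_w=\frac{\sum_i w(x_i)x_i}{\sum_i w(x_i)}$ and $\overline{\Sigma}_w=\frac{\sum_i w(x_i)(x_i-\mu)(x_i-\mu)^T}{\sum_i w(x_i)}$. The points are called $(\epsilon',\delta)$-stable with respect to $\mu$ if for every $w:\mathbb R^d\to[0,1]$ with $\frac1n\sum_i w(x_i)\ge 1-\epsilon'$ one has $\|\mu_w-\mu\|_2\le\delta$ and $\|\overline{\Sigma}_w-I_d\|_2\le\delta^2/\epsilon'$ (spectral norm). A collection $S$ of $n$ points is an $\epsilon$-corrupted version of $S_0=\{x_1,\dots,x_n\}$ if it arises from $S_0$ by replacing at most $\epsilon n$ of the points by arbitrary points (strong contamination). Theorem. There are absolute constants $C\ge1$, $\epsilon_0>0$ (with $C\epsilon_0\le 1/2$), $A$, $K$ and $k\in\mathbb N$, and a single randomized algorithm (a program on a real RAM with exact real arithmetic, unit-cost operations and fair coin tosses) such that the following holds for all integers $d,n\ge1$ and all reals $0<\tau<1$,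 $0<\epsilon<\epsilon_0$, $\delta\ge\epsilon$. (i) On input $\epsilon,\delta,\tau$ and any $n$ points $S$ in $\mathbb R^d$, for every outcome of its coin tosses, the algorithm halts after at most $$A\,nd\,\bigl(1+\log d+\log n+\log(1/\epsilon)+\log(1/\tau)\bigr)^{k}$$ steps, i.e. in time $nd\cdot\mathrm{polylog}(d,n,1/\epsilon,1/\tau)$, and outputs a vector $\widehat\mu\in\mathbb R^d$. (ii) If $S$ is an $\epsilon$-corrupted version of a collection $S_0$ of $n$ points that is $(C\epsilon,\delta)$-stable with respect to a vector $\mu\in\mathbb R^d$ (unknown to the algorithm), then with probability at least $1-\tau$ over the coin tosses, $\|\widehat\mu-\mu\|_2\le K\delta$. -/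

import Mathlib

/-! ### Stability and strong contamination -/

namespace RobustMean

/-- `ℝ^d` with the Euclidean norm. -/
abbrev Vec (d : ℕ) : Type := EuclideanSpace ℝ (Fin d)

/-- `E[w(X)]` for `X` uniform on the points `x 0, …, x (n-1)` (counted with multiplicity). -/
noncomputable def weightMass {n d : ℕ} (x : Fin n → Vec d) (w : Vec d → ℝ) : ℝ :=
  (n : ℝ)⁻¹ * ∑ i, w (x i)

/-- The mean of the uniform distribution on the points `x i`, re-weighted by `w`. -/
noncomputable def weightedMean {n d : ℕ} (x : Fin n → Vec d) (w : Vec d → ℝ) : Vec d :=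
  (∑ i, w (x i))⁻¹ • ∑ i, w (x i) • x i

/-- The second moment matrix, centered at `μ`, of the uniform distribution on the points `x i`,
re-weighted by `w`. -/
noncomputable def weightedSecondMoment {n d : ℕ} (x : Fin n → Vec d) (w : Vec d → ℝ)
    (μ : Vec d) : Matrix (Fin d) (Fin d) ℝ :=
  (∑ i, w (x i))⁻¹ •
    ∑ i, w (x i) • Matrix.of (fun a b : Fin d => (x i - μ) a * (x i - μ) b)

/-- The spectral norm of a real square matrix. -/
noncomputable def spectralNorm {d : ℕ} (M : Matrix (Fin d) (Fin d) ℝ) : ℝ :=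
  ‖Matrix.toEuclideanCLM (n := Fin d) (𝕜 := ℝ) M‖

/-- The points `x 0, …, x (n-1)` are `(ε, δ)`-stable with respect to `μ`. -/
def IsStable {n d : ℕ} (x : Fin n → Vec d) (ε δ : ℝ) (μ : Vec d) : Prop :=
  ∀ w : Vec d → ℝ, (∀ y, 0 ≤ w y ∧ w y ≤ 1) → 1 - ε ≤ weightMass x w →
    ‖weightedMean x w - μ‖ ≤ δ ∧
    spectralNorm (weightedSecondMoment x w μ - 1) ≤ δ ^ 2 / ε

/-- `S` arises from `S₀` by replacing at most `ε n` of the `n` points by arbitrary ones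
(and listing the result in an arbitrary order). -/
def IsCorruptedVersion {n d : ℕ} (ε : ℝ) (S₀ S : Fin n → Vec d) : Prop :=
  ∃ σ : Equiv.Perm (Fin n), (Set.ncard {i | S i ≠ S₀ (σ i)} : ℝ) ≤ ε * n

end RobustMean

/-! ### A randomized real RAM

Programs of a small imperative language.  The memory has registers for natural numbers, which
serve as counters and indices, and two-dimensional arrays of real numbers.  Real arithmetic and
comparisons are exact, there is no rounding of reals to integers, real literals are rational, and
the only source of randomness is a fair coin. -/

namespace RealRAM

/-- The memory; `used` is the number of coins tossed so far. -/
structure Memory where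
  reg : ℕ → ℕ
  arr : ℕ → ℕ → ℕ → ℝ
  used : ℕ

/-- Expressions for natural numbers; `sub` is truncated subtraction. -/
inductive NatExpr where
  | lit (k : ℕ)
  | reg (v : ℕ)
  | add (e₁ e₂ : NatExpr)
  | sub (e₁ e₂ : NatExpr)

/-- Expressions for real numbers; `get a i j` is the entry `(i, j)` of the array `a`. -/
inductive RealExpr where
  | lit (q : ℚ)
  | ofNat (e : NatExpr)
  | get (a : ℕ) (i j : NatExpr)
  | add (e₁ e₂ : RealExpr)
  | sub (e₁ e₂ : RealExpr)
  | mul (e₁ e₂ : RealExpr)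
  | div (e₁ e₂ : RealExpr)

/-- Tests. -/
inductive Test where
  | natLt (e₁ e₂ : NatExpr)
  | realLt (e₁ e₂ : RealExpr)
  | not (c : Test)
  | and (c₁ c₂ : Test)

/-- Programs; `toss v` puts the outcome (`0` or `1`) of a fresh fair coin into register `v`. -/
inductive Program where
  | skip
  | setReg (v : ℕ) (e : NatExpr)
  | setArr (a : ℕ) (i j : NatExpr) (e : RealExpr)
  | toss (v : ℕ)
  | seq (p₁ p₂ : Program)
  | cond (c : Test) (p₁ p₂ : Program)
  | loop (c : Test) (p : Program)

def NatExpr.eval (s : Memory) : NatExpr → ℕ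
  | .lit k => k
  | .reg v => s.reg v
  | .add e₁ e₂ => e₁.eval s + e₂.eval s
  | .sub e₁ e₂ => e₁.eval s - e₂.eval s

noncomputable def RealExpr.eval (s : Memory) : RealExpr → ℝ
  | .lit q => (q : ℝ)
  | .ofNat e => (e.eval s : ℝ)
  | .get a i j => s.arr a (i.eval s) (j.eval s)
  | .add e₁ e₂ => e₁.eval s + e₂.eval s
  | .sub e₁ e₂ => e₁.eval s - e₂.eval s
  | .mul e₁ e₂ => e₁.eval s * e₂.eval s
  | .div e₁ e₂ => e₁.eval s / e₂.eval s

def Test.Holds (s : Memory) : Test → Prop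
  | .natLt e₁ e₂ => e₁.eval s < e₂.eval s
  | .realLt e₁ e₂ => e₁.eval s < e₂.eval s
  | .not c => ¬ c.Holds s
  | .and c₁ c₂ => c₁.Holds s ∧ c₂.Holds s

/-! The cost of an expression or a test is the number of its operations, memory accesses
and literals. -/

def NatExpr.cost : NatExpr → ℕ
  | .lit _ => 1
  | .reg _ => 1
  | .add e₁ e₂ => e₁.cost + e₂.cost + 1
  | .sub e₁ e₂ => e₁.cost + e₂.cost + 1

def RealExpr.cost : RealExpr → ℕ
  | .lit _ => 1
  | .ofNat e => e.cost + 1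
  | .get _ i j => i.cost + j.cost + 1
  | .add e₁ e₂ => e₁.cost + e₂.cost + 1
  | .sub e₁ e₂ => e₁.cost + e₂.cost + 1
  | .mul e₁ e₂ => e₁.cost + e₂.cost + 1
  | .div e₁ e₂ => e₁.cost + e₂.cost + 1

def Test.cost : Test → ℕ
  | .natLt e₁ e₂ => e₁.cost + e₂.cost + 1
  | .realLt e₁ e₂ => e₁.cost + e₂.cost + 1
  | .not c => c.cost + 1
  | .and c₁ c₂ => c₁.cost + c₂.cost + 1

def Memory.setReg (s : Memory) (v k : ℕ) : Memory :=
  { s with reg := fun v' => if v' = v then k else s.reg v' }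

noncomputable def Memory.setArr (s : Memory) (a i j : ℕ) (r : ℝ) : Memory :=
  { s with arr := fun a' i' j' => if a' = a ∧ i' = i ∧ j' = j then r else s.arr a' i' j' }

/-- `Exec ω p s t s'`: with the coin outcomes `ω`, the program `p` started in the memory `s`
halts after `t` steps in the memory `s'`. -/
inductive Exec (ω : ℕ → Bool) : Program → Memory → ℕ → Memory → Prop where
  | skip (s : Memory) : Exec ω .skip s 1 s
  | setReg (s : Memory) (v : ℕ) (e : NatExpr) :
      Exec ω (.setReg v e) s (e.cost + 1) (s.setReg v (e.eval s))
  | setArr (s : Memory) (a : ℕ) (i j : NatExpr) (e : RealExpr) :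
      Exec ω (.setArr a i j e) s (i.cost + j.cost + e.cost + 1)
        (s.setArr a (i.eval s) (j.eval s) (e.eval s))
  | toss (s : Memory) (v : ℕ) :
      Exec ω (.toss v) s 1
        { s.setReg v (if ω s.used = true then 1 else 0) with used := s.used + 1 }
  | seq {p₁ p₂ : Program} {s s₁ s₂ : Memory} {t₁ t₂ : ℕ} :
      Exec ω p₁ s t₁ s₁ → Exec ω p₂ s₁ t₂ s₂ → Exec ω (.seq p₁ p₂) s (t₁ + t₂) s₂
  | condTrue {c : Test} {p₁ p₂ : Program} {s s' : Memory} {t : ℕ} :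
      c.Holds s → Exec ω p₁ s t s' → Exec ω (.cond c p₁ p₂) s (c.cost + t + 1) s'
  | condFalse {c : Test} {p₁ p₂ : Program} {s s' : Memory} {t : ℕ} :
      ¬ c.Holds s → Exec ω p₂ s t s' → Exec ω (.cond c p₁ p₂) s (c.cost + t + 1) s'
  | loopTrue {c : Test} {p : Program} {s s₁ s₂ : Memory} {t₁ t₂ : ℕ} :
      c.Holds s → Exec ω p s t₁ s₁ → Exec ω (.loop c p) s₁ t₂ s₂ →
      Exec ω (.loop c p) s (c.cost + t₁ + t₂ + 1) s₂
  | loopFalse {c : Test} {p : Program} {s : Memory} :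
      ¬ c.Holds s → Exec ω (.loop c p) s (c.cost + 1) s

/-- For given coin outcomes, the step count and the final memory are unique. -/
theorem Exec.deterministic {ω : ℕ → Bool} {p : Program} {s s₁ s₂ : Memory} {t₁ t₂ : ℕ}
    (h₁ : Exec ω p s t₁ s₁) (h₂ : Exec ω p s t₂ s₂) : t₁ = t₂ ∧ s₁ = s₂ := by
  induction h₁ generalizing t₂ s₂ with
  | skip | setReg | setArr | toss => cases h₂; exact ⟨rfl, rfl⟩
  | seq _ _ ih₁ ih₂ =>
    cases h₂ with
    | seq a b =>
      obtain ⟨rfl, rfl⟩ := ih₁ a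
      obtain ⟨rfl, rfl⟩ := ih₂ b
      exact ⟨rfl, rfl⟩
  | condTrue hc _ ih =>
    cases h₂ with
    | condTrue _ a => obtain ⟨rfl, rfl⟩ := ih a; exact ⟨rfl, rfl⟩
    | condFalse hn _ => exact absurd hc hn
  | condFalse hn _ ih =>
    cases h₂ with
    | condTrue hc _ => exact absurd hc hn
    | condFalse _ a => obtain ⟨rfl, rfl⟩ := ih a; exact ⟨rfl, rfl⟩
  | loopTrue hc _ _ ih₁ ih₂ =>
    cases h₂ with
    | loopTrue _ a b =>
      obtain ⟨rfl, rfl⟩ := ih₁ a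
      obtain ⟨rfl, rfl⟩ := ih₂ b
      exact ⟨rfl, rfl⟩
    | loopFalse hn => exact absurd hc hn
  | loopFalse hn =>
    cases h₂ with
    | loopTrue hc _ _ => exact absurd hc hn
    | loopFalse _ => exact ⟨rfl, rfl⟩

/-- The law of a sequence of independent fair coins. -/
noncomputable def coins : MeasureTheory.Measure (ℕ → Bool) :=
  MeasureTheory.Measure.infinitePi fun _ => (PMF.uniformOfFintype Bool).toMeasure

end RealRAM

namespace RobustMean

/-- The initial memory: registers `0` and `1` hold `n` and `d`, array `0` holds the points
(one per row), the first row of array `1` holds `ε, δ, τ`; all else is `0`. -/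
noncomputable def inputMemory {n d : ℕ} (S : Fin n → Vec d) (ε δ τ : ℝ) : RealRAM.Memory where
  reg v := if v = 0 then n else if v = 1 then d else 0
  arr a i j :=
    if a = 0 then
      if h : i < n ∧ j < d then S ⟨i, h.1⟩ ⟨j, h.2⟩ else 0
    else if a = 1 ∧ i = 0 then
      if j = 0 then ε else if j = 1 then δ else if j = 2 then τ else 0
    else 0
  used := 0

/-- The output vector is read off from the first `d` entries of the first row of array `2`. -/
noncomputable def outputVec (d : ℕ) (s : RealRAM.Memory) : Vec d :=
  WithLp.toLp 2 fun j : Fin d => s.arr 2 0 j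

end RobustMean

/-! Call an index good if the sample agrees there with the stable one (up to a permutation); at most
εn indices are bad. Put lam = δ²/ε. The algorithm keeps weights in [0, 1], initially 1, and only
lowers them, removing at least as much weight from the bad points as from the good ones
(`Balanced`). The good points therefore keep mass (1 - 2ε)n, so stability with C = 2 applies to them
throughout: their weighted mean is within √(ε lam) = δ of μ and their covariance is at least 1 -
O(lam). If the weighted covariance is also at most 1 + O(lam), the bad points have second moment
O(lam n). As their mass is at most εn, Cauchy-Schwarz shows that they shift the mean by O(√(ε lam))
= O(δ); this is `Setup.weightedMean_close`.

It remains to shrink the covariance in polylogarithmically many rounds of nearly linear time. Let B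
be `covMat`, the weighted covariance shifted by 1 - 5 lam so that it is positive semidefinite. The
potential is tr B^(2J+1), with J logarithmic. A round draws a random sign vector z, computes v = B^J
z by matrix-free products, and filters along v until the bad points have second moment O(lam n |v|²)
in this direction (`filterWeights_spec`).

Why the potential falls: the new matrix satisfies B' ≼ B, so tr B'^(2J+1) ≤ tr (B' B^(2J)) by
`trace_pow_succ_le`. Up to O(lam) tr B^(2J), the right side is the average of w'ᵢ|aᵢ|² over the bad
points, aᵢ = B^J(Xᵢ - g), with g the good mean. By a fourth moment bound, (aᵢ·z)² ≥ |aᵢ|²/4 with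
probability at least 25/121, and on that event the filter controls w'ᵢ|aᵢ|². Hence the expected
potential drops by the factor 9/10, up to an additive d·(O(lam))^(2J+1)
(`Setup.sum_potential_step_le`). After J² rounds only a multiple of this term is left, and Markov's
inequality bounds the norm of B by O(lam) outside an event of probability at most τ.

The initial potential has to be bounded. A deterministic tournament, a metric form of majority
voting, finds a crude center; points far from it are replaced by the center. The radius is so crude
that it is only at most 2^(3L)·√lam with L logarithmic, but it enters through its logarithm. The
remaining part verifies a concrete program by a small Hoare logic with time bounds and frame
conditions. -/

namespace RobustMean

open Matrix Finset

/-! ### Trace inequalities for positive semidefinite matrices -/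

section Trace

variable {d : ℕ}

/-- Simultaneous spectral expansion of the traces `tr (A ^ s * B ^ r)`. -/
theorem trace_pow_mul_pow {A B : Matrix (Fin d) (Fin d) ℝ} (hA : A.IsHermitian)
    (hB : B.IsHermitian) : ∃ P : Fin d → Fin d → ℝ, (∀ i j, 0 ≤ P i j) ∧
      ∀ s r : ℕ, (A ^ s * B ^ r).trace =
        ∑ i, ∑ j, hA.eigenvalues i ^ s * hB.eigenvalues j ^ r * P i j := by
  set U : Matrix (Fin d) (Fin d) ℝ := hA.eigenvectorUnitary.1 with hU
  set V : Matrix (Fin d) (Fin d) ℝ := hB.eigenvectorUnitary.1 with hV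
  have hUU : star U * U = 1 := by simp [hU]
  have hVV : star V * V = 1 := by simp [hV]
  have hAe : A = U * diagonal hA.eigenvalues * star U := by
    have := hA.spectral_theorem
    simpa [Unitary.conjStarAlgAut_apply] using this
  have hBe : B = V * diagonal hB.eigenvalues * star V := by
    have := hB.spectral_theorem
    simpa [Unitary.conjStarAlgAut_apply] using this
  have key : ∀ (U D : Matrix (Fin d) (Fin d) ℝ), star U * U = 1 → ∀ s : ℕ,
      (U * D * star U) ^ s = U * D ^ s * star U := by
    intro U D h s
    induction s with
    | zero => simp [mul_eq_one_comm.mp h]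
    | succ s ih =>
      calc (U * D * star U) ^ (s + 1) = U * D ^ s * (star U * U) * D * star U := by
            rw [pow_succ, ih]; simp only [Matrix.mul_assoc]
        _ = _ := by rw [h, pow_succ]; simp only [Matrix.mul_assoc, Matrix.one_mul]
  -- The weights are the squared inner products of the two eigenbases; they serve all `s` and `r` at
  -- once.
  refine ⟨fun i j => (star U * V) i j ^ 2, fun i j => sq_nonneg _, fun s r => ?_⟩
  have e1 := key U (diagonal hA.eigenvalues) hUU s
  have e2 := key V (diagonal hB.eigenvalues) hVV r
  rw [← hAe] at e1
  rw [← hBe] at e2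
  simp only [e1, e2]
  have : (U * diagonal hA.eigenvalues ^ s * star U * (V * diagonal hB.eigenvalues ^ r * star V)).trace
      = (diagonal hA.eigenvalues ^ s * (star U * V) * diagonal hB.eigenvalues ^ r *
          star (star U * V)).trace := by
    rw [star_mul, star_star, Matrix.mul_assoc, Matrix.mul_assoc, trace_mul_comm]
    simp only [Matrix.mul_assoc]
  rw [this, trace]
  refine Finset.sum_congr rfl fun i _ => ?_
  rw [diag_apply, Matrix.mul_apply]
  refine Finset.sum_congr rfl fun j _ => ?_
  rw [diagonal_pow, diagonal_pow, mul_diagonal, diagonal_mul, star_apply]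
  simp
  ring

theorem trace_pow_eq_sum_eigenvalues {A : Matrix (Fin d) (Fin d) ℝ} (hA : A.IsHermitian) (s : ℕ) :
    (A ^ s).trace = ∑ i, hA.eigenvalues i ^ s := by
  have e : A ^ s = hA.eigenvectorUnitary.1 * diagonal hA.eigenvalues ^ s *
      star hA.eigenvectorUnitary.1 := by
    have h := hA.spectral_theorem
    conv_lhs => rw [h, ← map_pow]
    simp [Unitary.conjStarAlgAut_apply]
  rw [e, trace_mul_cycle]
  simp [trace, diagonal_pow]

theorem trace_mul_nonneg {A D : Matrix (Fin d) (Fin d) ℝ} (hA : A.PosSemidef)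
    (hD : D.PosSemidef) : 0 ≤ (A * D).trace := by
  obtain ⟨P, hP, h⟩ := trace_pow_mul_pow hA.1 hD.1
  have := h 1 1
  simp only [pow_one] at this
  rw [this]
  exact sum_nonneg fun i _ => sum_nonneg fun j _ => mul_nonneg
    (mul_nonneg (hA.eigenvalues_nonneg i) (hD.eigenvalues_nonneg j)) (hP i j)

/-- A log-convex nonnegative sequence with `c 0 ≤ c 1` never falls below `c 0`. -/
theorem le_of_logConvex {c : ℕ → ℝ} {m : ℕ} (h0 : ∀ r, 0 ≤ c r) (h01 : c 0 ≤ c 1)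
    (h : ∀ r, r + 2 ≤ m → c (r + 1) ^ 2 ≤ c r * c (r + 2)) {r : ℕ} (hr : r ≤ m) : c 0 ≤ c r := by
  rcases (h0 0).eq_or_lt with h00 | h00
  · rw [← h00]; exact h0 r
  -- Log-convexity makes the ratios of consecutive terms nondecreasing, and the first ratio is at
  -- least 1. The induction carries the monotonicity along, since it supplies the positivity of `c
  -- r`.
  suffices H : ∀ r, r + 1 ≤ m → c 0 ≤ c r ∧ c r ≤ c (r + 1) by
    cases r with
    | zero => exact le_rfl
    | succ r => exact (H r hr).1.trans (H r hr).2
  intro r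
  induction r with
  | zero => exact fun _ => ⟨le_rfl, h01⟩
  | succ r ih =>
    intro hr
    obtain ⟨h1, h2⟩ := ih (by omega)
    refine ⟨h1.trans h2, ?_⟩
    have h3 := h r hr
    have hp : 0 < c r := h00.trans_le h1
    by_contra! hlt
    have : c r * c (r + 2) < c (r + 1) ^ 2 := by nlinarith [h0 (r + 2)]
    linarith

/-- If `0 ≼ A ≼ B` then `tr (A ^ m) ≤ tr (A * B ^ (m - 1))`. -/
theorem trace_pow_succ_le {A B : Matrix (Fin d) (Fin d) ℝ} (hA : A.PosSemidef)
    (hB : B.PosSemidef) (hAB : (B - A).PosSemidef) (m : ℕ) :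
    (A ^ (m + 1)).trace ≤ (A * B ^ m).trace := by
  obtain ⟨P, hP, h⟩ := trace_pow_mul_pow hA.1 hB.1
  have ha := hA.eigenvalues_nonneg
  have hb := hB.eigenvalues_nonneg
  set a := hA.1.eigenvalues
  set b := hB.1.eigenvalues
  rcases Nat.eq_zero_or_pos m with rfl | hm
  · simp
  -- Powers are not operator monotone, so the traces are interpolated: `c 0` and `c m` are the two
  -- sides of the claim. The inequality `c 0 ≤ c 1` is tr (A^m (B - A)) ≥ 0, and log-convexity is
  -- Cauchy-Schwarz for the joint spectral weights `P`.
  let c : ℕ → ℝ := fun r => (A ^ (m + 1 - r) * B ^ r).trace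
  have hc : ∀ r, c r = ∑ i, ∑ j, a i ^ (m + 1 - r) * b j ^ r * P i j := fun r => h _ _
  have h01 : c 0 ≤ c 1 := by
    have : 0 ≤ (A ^ m * (B - A)).trace := trace_mul_nonneg (hA.pow m) hAB
    rw [Matrix.mul_sub, trace_sub, ← pow_succ] at this
    simp only [c, Nat.sub_zero, pow_zero, Matrix.mul_one, Nat.add_sub_cancel, pow_one]
    linarith
  have key := le_of_logConvex (c := c) (m := m + 1) (r := m) ?_ h01 ?_ (by omega)
  · simpa [c] using key
  · intro r
    rw [hc]
    exact sum_nonneg fun i _ => sum_nonneg fun j _ => mul_nonneg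
      (mul_nonneg (pow_nonneg (ha i) _) (pow_nonneg (hb j) _)) (hP i j)
  · intro r hr
    obtain ⟨k, hk⟩ := Nat.exists_eq_add_of_le hr
    rw [hc, hc, hc, show m + 1 - (r + 1) = k + 1 by omega, show m + 1 - r = k + 2 by omega,
      show m + 1 - (r + 2) = k by omega]
    simp only [← Fintype.sum_prod_type']
    have := Finset.sum_sq_le_sum_mul_sum_of_sq_le_mul (univ : Finset (Fin d × Fin d))
      (r := fun x => a x.1 ^ (k + 1) * b x.2 ^ (r + 1) * P x.1 x.2)
      (f := fun x => a x.1 ^ (k + 2) * b x.2 ^ r * P x.1 x.2)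
      (g := fun x => a x.1 ^ k * b x.2 ^ (r + 2) * P x.1 x.2) ?_ ?_ ?_
    · exact this
    · exact fun x _ => mul_nonneg (mul_nonneg (pow_nonneg (ha _) _) (pow_nonneg (hb _) _)) (hP _ _)
    · exact fun x _ => mul_nonneg (mul_nonneg (pow_nonneg (ha _) _) (pow_nonneg (hb _) _)) (hP _ _)
    · intro x _; exact le_of_eq (by ring)

/-- Lower powers of a positive semidefinite matrix are controlled by a higher one. -/
theorem mul_trace_pow_le {B : Matrix (Fin d) (Fin d) ℝ} (hB : B.PosSemidef) {c η : ℝ}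
    (hc : 0 ≤ c) (hη : 0 < η) (k : ℕ) :
    c * (B ^ k).trace ≤ η * (B ^ (k + 1)).trace + d * (c * (c / η) ^ k) := by
  rw [trace_pow_eq_sum_eigenvalues hB.1, trace_pow_eq_sum_eigenvalues hB.1, mul_sum, mul_sum]
  have : (d : ℝ) * (c * (c / η) ^ k) = ∑ _i : Fin d, c * (c / η) ^ k := by simp
  rw [this, ← sum_add_distrib]
  refine sum_le_sum fun i _ => ?_
  have hb := hB.eigenvalues_nonneg i
  set b := hB.1.eigenvalues i
  have hcη : 0 ≤ c / η := by positivity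
  -- Eigenvalues above c/η are paid for by the higher power, those below by the constant.
  rcases le_total (c / η) b with h | h
  · have h1 : c ≤ η * b := by rwa [div_le_iff₀' hη] at h
    have h2 : 0 ≤ b ^ k := by positivity
    have h3 : 0 ≤ c * (c / η) ^ k := by positivity
    rw [pow_succ]
    nlinarith
  · have h1 : b ^ k ≤ (c / η) ^ k := pow_le_pow_left₀ hb h k
    have h2 : 0 ≤ η * b ^ (k + 1) := by positivity
    nlinarith

theorem eigenvalues_eq_dotProduct {B : Matrix (Fin d) (Fin d) ℝ} (hB : B.IsHermitian) (i : Fin d) :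
    ∃ u : Fin d → ℝ, u ⬝ᵥ u = 1 ∧ hB.eigenvalues i = u ⬝ᵥ (B *ᵥ u) := by
  refine ⟨hB.eigenvectorBasis i, ?_, ?_⟩
  · have := hB.eigenvectorBasis.orthonormal.1 i
    rw [EuclideanSpace.norm_eq, Real.sqrt_eq_one] at this
    simpa [dotProduct, sq] using this
  · have := hB.eigenvalues_eq i
    simpa using this

theorem trace_pow_le {B : Matrix (Fin d) (Fin d) ℝ} (hB : B.PosSemidef) {β : ℝ}
    (h : ∀ u : Fin d → ℝ, u ⬝ᵥ (B *ᵥ u) ≤ β * (u ⬝ᵥ u)) (k : ℕ) :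
    (B ^ k).trace ≤ d * β ^ k := by
  rw [trace_pow_eq_sum_eigenvalues hB.1]
  have : (d : ℝ) * β ^ k = ∑ _i : Fin d, β ^ k := by simp
  rw [this]
  refine sum_le_sum fun i _ => pow_le_pow_left₀ (hB.eigenvalues_nonneg i) ?_ k
  obtain ⟨u, hu, he⟩ := eigenvalues_eq_dotProduct hB.1 i
  rw [he]
  simpa [hu] using h u

/-- A bound on a trace power bounds the quadratic form. -/
theorem dotProduct_mulVec_le_of_trace_pow {B : Matrix (Fin d) (Fin d) ℝ} (hB : B.PosSemidef)
    {β : ℝ} (hβ : 0 ≤ β) {k : ℕ} (hk : k ≠ 0) (h : (B ^ k).trace ≤ β ^ k) (u : Fin d → ℝ) :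
    u ⬝ᵥ (B *ᵥ u) ≤ β * (u ⬝ᵥ u) := by
  rw [trace_pow_eq_sum_eigenvalues hB.1] at h
  have hi : ∀ i, hB.1.eigenvalues i ≤ β := fun i => by
    refine le_of_pow_le_pow_left₀ hk hβ (le_trans ?_ h)
    exact single_le_sum (f := fun i => hB.1.eigenvalues i ^ k)
      (fun j _ => pow_nonneg (hB.eigenvalues_nonneg j) k) (mem_univ i)
  have hp : (β • (1 : Matrix (Fin d) (Fin d) ℝ) - B).PosSemidef := by
    have e : β • (1 : Matrix (Fin d) (Fin d) ℝ) - B = hB.1.eigenvectorUnitary.1 *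
        diagonal (fun i => β - hB.1.eigenvalues i) * (hB.1.eigenvectorUnitary.1)ᴴ := by
      have hs := hB.1.spectral_theorem
      simp only [Unitary.conjStarAlgAut_apply] at hs
      conv_lhs => rw [hs]
      have : diagonal (fun i => β - hB.1.eigenvalues i) =
          β • (1 : Matrix (Fin d) (Fin d) ℝ) - diagonal hB.1.eigenvalues := by
        ext i j; by_cases hij : i = j <;> simp [diagonal, hij]
      rw [this, Matrix.mul_sub, Matrix.sub_mul]
      simp
      have h2 : hB.1.eigenvectorUnitary.1 * (hB.1.eigenvectorUnitary.1)ᴴ = 1 := by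
        have := Unitary.coe_mul_star_self hB.1.eigenvectorUnitary
        simpa [star_eq_conjTranspose] using this
      simp only [conjTranspose_eq_transpose_of_trivial] at h2
      simp [star_eq_conjTranspose, h2]
    rw [e]
    exact (PosSemidef.diagonal fun i => sub_nonneg.mpr (hi i)).mul_mul_conjTranspose_same _
  have := hp.dotProduct_mulVec_nonneg u
  simp only [star_trivial, sub_mulVec, smul_mulVec, one_mulVec, dotProduct_sub,
    dotProduct_smul, smul_eq_mul] at this
  linarith

end Trace

end RobustMean

namespace RobustMean

open Matrix Finset

variable {n d : ℕ}

/-! ### The one-dimensional filter -/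

/-- The number of indices with the property `p`, as a real number. -/
noncomputable def count (p : Fin n → Prop) [DecidablePred p] : ℝ := ∑ i, if p i then 1 else 0

/-- One step of the search for a median of `π` in the interval `[q.1, q.2]`. -/
noncomputable def bisectStep (π : Fin n → ℝ) (q : ℝ × ℝ) : ℝ × ℝ :=
  if 2 * count (fun i => π i < (q.1 + q.2) / 2) < n then ((q.1 + q.2) / 2, q.2)
  else (q.1, (q.1 + q.2) / 2)

/-- An approximate median of `π`. -/
noncomputable def center (π : Fin n → ℝ) (H : ℝ) (J : ℕ) : ℝ := ((bisectStep π)^[J] (-H, H)).1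

/-- Double the threshold `θ` if more than `b` of the scores exceed it. -/
noncomputable def thresholdStep (f : Fin n → ℝ) (b θ : ℝ) : ℝ :=
  if b < count (fun i => θ < f i) then 2 * θ else θ

/-- The scores above the threshold. -/
noncomputable def tail (f : Fin n → ℝ) (θ : ℝ) (i : Fin n) : ℝ := if θ < f i then f i else 0

/-- The total score after the weights have been divided by `1 + t * τ i`. -/
noncomputable def softMass (w τ : Fin n → ℝ) (t : ℝ) : ℝ := ∑ i, w i * τ i / (1 + t * τ i)

/-- Increase `t` if the total score is still larger than `4 * T₀`. -/
noncomputable def rateStep (w τ : Fin n → ℝ) (t₀ T₀ t : ℝ) : ℝ :=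
  if 4 * T₀ < softMass w τ t then 2 * t + t₀ else t

/-- Downweight the points whose projections to `v` are far from the bulk. -/
noncomputable def filterWeights (X : Fin n → Fin d → ℝ) (ε lam ρ : ℝ) (J : ℕ) (w : Fin n → ℝ)
    (v : Fin d → ℝ) : Fin n → ℝ :=
  let H := ρ * ∑ j, |v j|
  let m := center (fun i => X i ⬝ᵥ v) H J
  let f := fun i => (X i ⬝ᵥ v - m) ^ 2
  let θ := (thresholdStep f (2 * ε * n))^[J] ((1 + lam) * (v ⬝ᵥ v))
  let τ := tail f θ
  let t := (rateStep w τ (1 / (4 * H ^ 2)) (200 * lam * n * (v ⬝ᵥ v)))^[J] 0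
  fun i => w i / (1 + t * τ i)

/-- What the analysis uses about the points `X`: all but a few of them, those in `G`, inherit
the consequences of stability with respect to `μ`. -/
structure Regular (X : Fin n → Fin d → ℝ) (G : Finset (Fin n)) (μ : Fin d → ℝ) (ε lam : ℝ) :
    Prop where
  card_compl_le : ((Gᶜ).card : ℝ) ≤ ε * n
  upper : ∀ v : Fin d → ℝ, ∑ i ∈ G, ((X i - μ) ⬝ᵥ v) ^ 2 ≤ n * (1 + lam) * (v ⬝ᵥ v)
  lower : ∀ w : Fin n → ℝ, (∀ i, 0 ≤ w i ∧ w i ≤ 1) → (1 - 2 * ε) * n ≤ ∑ i ∈ G, w i →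
    ∀ v : Fin d → ℝ, (∑ i ∈ G, w i) * (1 - lam / 2) * (v ⬝ᵥ v) ≤
      ∑ i ∈ G, w i * ((X i - μ) ⬝ᵥ v) ^ 2
  mean : ∀ w : Fin n → ℝ, (∀ i, 0 ≤ w i ∧ w i ≤ 1) → (1 - 2 * ε) * n ≤ ∑ i ∈ G, w i →
    ∀ v : Fin d → ℝ, (∑ i ∈ G, w i * ((X i - μ) ⬝ᵥ v)) ^ 2 ≤
      (∑ i ∈ G, w i) ^ 2 * (ε * lam) * (v ⬝ᵥ v)
  small : ∀ b : Fin n → ℝ, (∀ i, 0 ≤ b i ∧ b i ≤ 1) → ∑ i ∈ G, b i ≤ 2 * ε * n →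
    ∀ v : Fin d → ℝ, ∑ i ∈ G, b i * ((X i - μ) ⬝ᵥ v) ^ 2 ≤ 3 * lam * n * (v ⬝ᵥ v)

theorem count_eq_card (p : Fin n → Prop) [DecidablePred p] :
    count p = ((univ.filter p).card : ℝ) := by
  simp [count]

theorem count_le_count {p q : Fin n → Prop} [DecidablePred p] [DecidablePred q]
    (h : ∀ i, p i → q i) : count p ≤ count q := by
  rw [count_eq_card, count_eq_card]
  exact_mod_cast card_le_card (monotone_filter_right _ fun i _ => h i)

theorem count_add_count_not (p : Fin n → Prop) [DecidablePred p] :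
    count p + count (fun i => ¬ p i) = n := by
  rw [count_eq_card, count_eq_card]
  exact_mod_cast (card_filter_add_card_filter_not p).trans (by simp)

/-- The interval never loses contact with [a - r, a + r], which holds more than half of the values:
if the left end moved beyond a + r, more than half of the values would lie below the midpoint,
against the test; similarly on the right. -/
theorem bisect_spec {π : Fin n → ℝ} {a r H : ℝ} (hmaj : n < 2 * count (fun i => |π i - a| ≤ r))
    (ha : |a| ≤ H) (hr : 0 ≤ r) (k : ℕ) :
    let q := (bisectStep π)^[k] (-H, H)
    q.1 ≤ a + r ∧ a - r ≤ q.2 ∧ q.2 - q.1 = 2 * H / 2 ^ k ∧ -H ≤ q.1 ∧ q.2 ≤ H := by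
  obtain ⟨ha1, ha2⟩ := abs_le.mp ha
  induction k with
  | zero => simp only [Function.iterate_zero, id, pow_zero]; refine ⟨?_, ?_, ?_, ?_, ?_⟩ <;> linarith
  | succ k ih =>
    rw [Function.iterate_succ_apply']
    set q := (bisectStep π)^[k] (-H, H)
    obtain ⟨h1, h2, h3, h4, h5⟩ := ih
    have hH : 0 ≤ 2 * H / 2 ^ k := div_nonneg (by linarith [abs_nonneg a]) (by positivity)
    have hh : 2 * H / 2 ^ (k + 1) = (q.2 - q.1) / 2 := by rw [h3, pow_succ]; field_simp
    rw [hh]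
    unfold bisectStep
    split_ifs with hc
    · refine ⟨?_, h2, ?_, ?_, h5⟩ <;> dsimp only
      · by_contra! hlt
        have := count_le_count (p := fun i => |π i - a| ≤ r)
          (q := fun i => π i < (q.1 + q.2) / 2) fun i hi => by linarith [(abs_le.mp hi).2]
        linarith
      · ring
      · linarith
    · refine ⟨h1, ?_, ?_, h4, ?_⟩ <;> dsimp only
      · by_contra! hlt
        have := count_le_count (p := fun i => |π i - a| ≤ r)
          (q := fun i => ¬ π i < (q.1 + q.2) / 2) fun i hi => by linarith [(abs_le.mp hi).1]
        have := count_add_count_not (fun i => π i < (q.1 + q.2) / 2)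
        linarith
      · ring
      · linarith

theorem center_spec {π : Fin n → ℝ} {a r H : ℝ} {J : ℕ}
    (hmaj : n < 2 * count (fun i => |π i - a| ≤ r)) (ha : |a| ≤ H) (hr : 0 ≤ r)
    (hJ : 2 * H ≤ 2 ^ J * r) : |center π H J| ≤ H ∧ |center π H J - a| ≤ 2 * r := by
  obtain ⟨h1, h2, h3, h4, h5⟩ := bisect_spec hmaj ha hr J
  have hp : (0 : ℝ) < 2 ^ J := by positivity
  have h6 : 2 * H / 2 ^ J ≤ r := by rwa [div_le_iff₀' hp]
  have h7 : 0 ≤ 2 * H / 2 ^ J := div_nonneg (by linarith [abs_nonneg a]) hp.le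
  unfold center
  constructor <;> rw [abs_le] <;> constructor <;> linarith

/-- The first alternative remembers the last successful test: θ is at most twice a level exceeded by
many scores. The second says that the search has settled or has doubled in every step; in the
application the latter pushes θ above all scores. -/
theorem threshold_spec {f : Fin n → ℝ} {b θ₀ : ℝ} (k : ℕ) :
    let θ := (thresholdStep f b)^[k] θ₀
    (θ = θ₀ ∨ b < count (fun i => θ / 2 < f i)) ∧
      (count (fun i => θ < f i) ≤ b ∨ θ = 2 ^ k * θ₀) := by
  induction k with
  | zero => simp
  | succ k ih =>
    rw [Function.iterate_succ_apply']
    set θ := (thresholdStep f b)^[k] θ₀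
    obtain ⟨h1, h2⟩ := ih
    unfold thresholdStep
    split_ifs with hc
    · refine ⟨Or.inr (by simpa using hc), ?_⟩
      rcases h2 with h2 | h2
      · linarith
      · right; rw [h2]; ring
    · exact ⟨h1, Or.inl (not_lt.mp hc)⟩

/-- Each term is at most 1/t. This settles the case in which the search for the rate increases t in
every step. -/
theorem softMass_le_div {w τ : Fin n → ℝ} (hw : ∀ i, 0 ≤ w i ∧ w i ≤ 1) (hτ : ∀ i, 0 ≤ τ i)
    {t : ℝ} (ht : 0 < t) : softMass w τ t ≤ n / t := by
  have : (n : ℝ) / t = ∑ _i : Fin n, 1 / t := by simp [div_eq_mul_inv]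
  rw [this]
  refine sum_le_sum fun i _ => ?_
  have h1 : 0 ≤ t * τ i := mul_nonneg ht.le (hτ i)
  rw [div_le_div_iff₀ (by linarith) ht]
  nlinarith [hw i, hτ i, mul_le_mul_of_nonneg_right (hw i).2 h1]

/-- Since t₀τᵢ ≤ 1, passing from t to 2t + t₀ at most doubles each denominator and so at most halves
the total: a value above 4T₀ stays above 2T₀. The summand t₀ gets the doubling away from 0. -/
theorem rate_spec {w τ : Fin n → ℝ} {t₀ T₀ : ℝ} (hw : ∀ i, 0 ≤ w i) (hτ : ∀ i, 0 ≤ τ i)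
    (ht₀ : 0 ≤ t₀) (h1 : ∀ i, t₀ * τ i ≤ 1) (k : ℕ) :
    let t := (rateStep w τ t₀ T₀)^[k] 0
    0 ≤ t ∧ (t = 0 ∨ 2 * T₀ ≤ softMass w τ t) ∧
      (softMass w τ t ≤ 4 * T₀ ∨ t = (2 ^ k - 1) * t₀) := by
  induction k with
  | zero => simp
  | succ k ih =>
    rw [Function.iterate_succ_apply']
    set t := (rateStep w τ t₀ T₀)^[k] 0
    obtain ⟨h2, h3, h4⟩ := ih
    unfold rateStep
    split_ifs with hc
    · refine ⟨by linarith, Or.inr ?_, ?_⟩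
      · have : softMass w τ t / 2 ≤ softMass w τ (2 * t + t₀) := by
          unfold softMass
          rw [sum_div]
          refine sum_le_sum fun i _ => ?_
          have e1 : 0 ≤ t * τ i := mul_nonneg h2 (hτ i)
          have e2 : 0 ≤ t₀ * τ i := mul_nonneg ht₀ (hτ i)
          have e3 : 0 ≤ w i * τ i := mul_nonneg (hw i) (hτ i)
          rw [div_div]
          refine div_le_div_of_nonneg_left e3 (by nlinarith) ?_
          nlinarith [h1 i]
        linarith
      · rcases h4 with h4 | h4
        · linarith
        · right; rw [h4]; ring
    · exact ⟨h2, h3, Or.inl (not_lt.mp hc)⟩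

/-- Dividing the weights by `1 + t * τ i` removes more weight outside `G` than in `G`. -/
theorem removed_le_removed {w τ : Fin n → ℝ} {G : Finset (Fin n)} {t T₀ : ℝ}
    (hw : ∀ i, 0 ≤ w i) (hτ : ∀ i, 0 ≤ τ i) (ht : 0 ≤ t)
    (hG : ∑ i ∈ G, w i * τ i ≤ T₀) (h : t = 0 ∨ 2 * T₀ ≤ softMass w τ t) :
    ∑ i ∈ G, (w i - w i / (1 + t * τ i)) ≤ ∑ i ∈ Gᶜ, (w i - w i / (1 + t * τ i)) := by
  rcases h with rfl | h
  · simp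
  -- The weight removed at i is t times the i-th term of `softMass`; the good terms sum to at most
  -- T₀, half of the total.
  have e : ∀ i, w i - w i / (1 + t * τ i) = t * (w i * τ i / (1 + t * τ i)) := fun i => by
    have : 0 ≤ t * τ i := mul_nonneg ht (hτ i)
    field_simp
    ring
  simp only [e, ← mul_sum]
  refine mul_le_mul_of_nonneg_left ?_ ht
  have h2 : ∑ i ∈ G, w i * τ i / (1 + t * τ i) ≤ T₀ := by
    refine le_trans (sum_le_sum fun i _ => ?_) hG
    exact div_le_self (mul_nonneg (hw i) (hτ i)) (by linarith [mul_nonneg ht (hτ i)])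
  have h3 := sum_add_sum_compl G fun i => w i * τ i / (1 + t * τ i)
  unfold softMass at h
  linarith

/-! ### Analysis of a filtering step in a fixed direction -/

section Filter

variable {X : Fin n → Fin d → ℝ} {G : Finset (Fin n)} {μ : Fin d → ℝ} {ε lam : ℝ}

theorem Regular.dotProduct_sub (v : Fin d → ℝ) (i : Fin n) :
    (X i - μ) ⬝ᵥ v = X i ⬝ᵥ v - μ ⬝ᵥ v := sub_dotProduct _ _ _

/-- More than half of the points lie close to `μ` in the direction `v`. -/
theorem Regular.majority (h : Regular X G μ ε lam) (hn : 0 < n) (hε1 : ε ≤ 1 / 1000)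
    (hlam : 0 ≤ lam) (v : Fin d → ℝ) {r : ℝ} (hr : 0 ≤ r)
    (hr2 : r ^ 2 = 4 * (1 + lam) * (v ⬝ᵥ v)) :
    n < 2 * count (fun i => |X i ⬝ᵥ v - μ ⬝ᵥ v| ≤ r) := by
  have hn' : (0 : ℝ) < n := by exact_mod_cast hn
  set bad := G.filter fun i => ¬ |X i ⬝ᵥ v - μ ⬝ᵥ v| ≤ r with hbad
  -- Chebyshev: r² is four times the bound on the mean square. An exceptional index forces v ≠ 0,
  -- which permits the division.
  have hb : 4 * (bad.card : ℝ) ≤ n := by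
    have h1 : (bad.card : ℝ) * r ^ 2 ≤ ∑ i ∈ bad, ((X i - μ) ⬝ᵥ v) ^ 2 := by
      rw [← nsmul_eq_mul]
      refine card_nsmul_le_sum _ _ _ fun i hi => ?_
      rw [hbad, mem_filter, not_le] at hi
      rw [Regular.dotProduct_sub, ← sq_abs (X i ⬝ᵥ v - _)]
      exact pow_le_pow_left₀ hr hi.2.le 2
    have h2 : ∑ i ∈ bad, ((X i - μ) ⬝ᵥ v) ^ 2 ≤ ∑ i ∈ G, ((X i - μ) ⬝ᵥ v) ^ 2 :=
      sum_le_sum_of_subset_of_nonneg (filter_subset _ _) fun i _ _ => sq_nonneg _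
    have h3 := h.upper v
    rcases bad.eq_empty_or_nonempty with he | ⟨i, hi⟩
    · simp [he]
    · have hpos : 0 < ∑ i ∈ G, ((X i - μ) ⬝ᵥ v) ^ 2 := by
        refine lt_of_lt_of_le ?_ (single_le_sum (fun i _ => sq_nonneg _) (mem_filter.mp hi).1)
        have := (mem_filter.mp hi).2
        rw [Regular.dotProduct_sub]
        refine sq_pos_of_ne_zero fun h0 => this ?_
        rw [h0]; simpa using hr
      have hv : 0 < v ⬝ᵥ v := by
        by_contra! hv
        have : (n : ℝ) * (1 + lam) * (v ⬝ᵥ v) ≤ 0 :=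
          mul_nonpos_of_nonneg_of_nonpos (by positivity) hv
        linarith
      have h4 : (bad.card : ℝ) * (4 * (1 + lam) * (v ⬝ᵥ v)) ≤ n * (1 + lam) * (v ⬝ᵥ v) := by
        rw [← hr2]; linarith
      have h5 : 0 < (1 + lam) * (v ⬝ᵥ v) := by positivity
      refine le_of_mul_le_mul_right ?_ h5
      linarith
  have hc : count (fun i => ¬ |X i ⬝ᵥ v - μ ⬝ᵥ v| ≤ r) ≤ bad.card + (Gᶜ).card := by
    rw [count_eq_card]
    have : (univ.filter fun i => ¬ |X i ⬝ᵥ v - μ ⬝ᵥ v| ≤ r) ⊆ bad ∪ Gᶜ := fun i hi => by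
      by_cases hG : i ∈ G
      · exact mem_union_left _ (mem_filter.mpr ⟨hG, (mem_filter.mp hi).2⟩)
      · exact mem_union_right _ (mem_compl.mpr hG)
    exact_mod_cast (card_le_card this).trans (card_union_le _ _)
  have h1 := count_add_count_not (fun i => |X i ⬝ᵥ v - μ ⬝ᵥ v| ≤ r)
  have h2 := h.card_compl_le
  nlinarith

/-- The ℓ¹ norm replaces the Euclidean one, because the machine computes no square roots. The loss
of a factor d is harmless, as bounds on the range of the projections enter only through their
logarithm. -/
theorem abs_sum_sq_le (v : Fin d → ℝ) : v ⬝ᵥ v ≤ (∑ j, |v j|) ^ 2 ∧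
    (∑ j, |v j|) ^ 2 ≤ d * (v ⬝ᵥ v) := by
  constructor
  · have := Finset.sum_sq_le_sq_sum_of_nonneg (s := univ) (f := fun j => |v j|)
      (fun i _ => abs_nonneg _)
    simpa [dotProduct, sq] using this
  · have := sq_sum_le_card_mul_sum_sq (s := univ) (f := fun j => |v j|)
    simpa [dotProduct, sq] using this

theorem abs_dotProduct_le {x v : Fin d → ℝ} {ρ : ℝ} (hρ : 0 ≤ ρ) (hx : x ⬝ᵥ x ≤ ρ ^ 2) :
    |x ⬝ᵥ v| ≤ ρ * ∑ j, |v j| := by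
  refine abs_le_of_sq_le_sq ?_ (mul_nonneg hρ (sum_nonneg fun j _ => abs_nonneg _))
  have h := Finset.sum_mul_sq_le_sq_mul_sq univ x v
  have hv := (abs_sum_sq_le v).1
  have h0 : 0 ≤ v ⬝ᵥ v := sum_nonneg fun j _ => mul_self_nonneg _
  have e1 : x ⬝ᵥ x = ∑ i, x i ^ 2 := by simp [dotProduct, sq]
  have e2 : v ⬝ᵥ v = ∑ i, v i ^ 2 := by simp [dotProduct, sq]
  calc (x ⬝ᵥ v) ^ 2 ≤ (x ⬝ᵥ x) * (v ⬝ᵥ v) := by rw [e1, e2]; exact h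
    _ ≤ ρ ^ 2 * (∑ j, |v j|) ^ 2 := mul_le_mul hx hv h0 (sq_nonneg _)
    _ = _ := by ring

/-- The weights stay in `[0, 1]`, and at least as much weight is removed outside `G` as in `G`. -/
structure Balanced (G : Finset (Fin n)) (w : Fin n → ℝ) : Prop where
  mem : ∀ i, 0 ≤ w i ∧ w i ≤ 1
  le : ∑ i ∈ G, (1 - w i) ≤ ∑ i ∈ Gᶜ, (1 - w i)

/-- At most εn points are bad, and the good ones lose no more than the bad ones, hence at most
another εn. This is the source of the constant C = 2. -/
theorem Balanced.mass (hw : Balanced G w) (hc : ((Gᶜ).card : ℝ) ≤ ε * n) :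
    (1 - 2 * ε) * n ≤ ∑ i ∈ G, w i := by
  have h1 : ∑ i ∈ Gᶜ, (1 - w i) ≤ ∑ i ∈ Gᶜ, 1 := sum_le_sum fun i _ => by linarith [(hw.mem i).1]
  have h2 := hw.le
  simp only [sum_sub_distrib, sum_const, nsmul_eq_mul, mul_one] at h1 h2
  have h3 : ((G.card : ℝ)) + (Gᶜ).card = n := by
    exact_mod_cast (card_add_card_compl G).trans (by simp)
  linarith

theorem sq_sub_le (x y z : ℝ) : (x - y) ^ 2 ≤ 2 * (x - z) ^ 2 + 2 * (y - z) ^ 2 := by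
  nlinarith [sq_nonneg ((x - z) + (y - z))]

-- Scores of good points above the threshold add up to at most T₀, since they concern at most 2εn
-- points. So as long as the total exceeds 2T₀, most of the damped score is bad, and downweighting
-- is balanced; it ends once the total is at most 4T₀. The center γ is left free because the good
-- mean is inserted for it later.
set_option maxHeartbeats 1000000 in
theorem filterWeights_spec (h : Regular X G μ ε lam) (hn : 0 < n) (hε : 0 < ε)
    (hε1 : ε ≤ 1 / 1000) (hlam : ε ≤ lam) {ρ : ℝ} (hρ : 0 ≤ ρ) (hX : ∀ i, X i ⬝ᵥ X i ≤ ρ ^ 2)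
    (hμ : μ ⬝ᵥ μ ≤ ρ ^ 2) {J : ℕ} (hJ0 : 0 < J) (hJ : 64 * d * ρ ^ 2 ≤ 2 ^ J * lam)
    {w : Fin n → ℝ} (hw : Balanced G w) (v : Fin d → ℝ) :
    Balanced G (filterWeights X ε lam ρ J w v) ∧
    (∀ i, filterWeights X ε lam ρ J w v i ≤ w i) ∧
    ∀ γ : ℝ, (γ - μ ⬝ᵥ v) ^ 2 ≤ ε * lam * (v ⬝ᵥ v) →
      ∑ i ∈ Gᶜ, filterWeights X ε lam ρ J w v i * (X i ⬝ᵥ v - γ) ^ 2 ≤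
        2300 * lam * n * (v ⬝ᵥ v) := by
  have hn' : (0 : ℝ) < n := by exact_mod_cast hn
  have hlam0 : 0 < lam := hε.trans_le hlam
  have hN : 0 ≤ v ⬝ᵥ v := sum_nonneg fun j _ => mul_self_nonneg _
  set N := v ⬝ᵥ v with hNdef
  set a := μ ⬝ᵥ v with ha
  set H := ρ * ∑ j, |v j| with hHdef
  have hH0 : 0 ≤ H := mul_nonneg hρ (sum_nonneg fun j _ => abs_nonneg _)
  have hHle : 64 * H ^ 2 ≤ 2 ^ J * lam * N := by
    have := (abs_sum_sq_le v).2
    calc 64 * H ^ 2 = 64 * ρ ^ 2 * (∑ j, |v j|) ^ 2 := by rw [hHdef]; ring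
      _ ≤ 64 * ρ ^ 2 * (d * N) := mul_le_mul_of_nonneg_left this (by positivity)
      _ = 64 * d * ρ ^ 2 * N := by ring
      _ ≤ _ := mul_le_mul_of_nonneg_right hJ hN
  have haH : |a| ≤ H := abs_dotProduct_le hρ hμ
  have hπH : ∀ i, |X i ⬝ᵥ v| ≤ H := fun i => abs_dotProduct_le hρ (hX i)
  set r := Real.sqrt (4 * (1 + lam) * N) with hr
  have hr0 : 0 ≤ r := Real.sqrt_nonneg _
  have hr2 : r ^ 2 = 4 * (1 + lam) * N := Real.sq_sqrt (by positivity)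
  have h2J : (2 : ℝ) ≤ 2 ^ J := by
    calc (2 : ℝ) = 2 ^ 1 := by norm_num
      _ ≤ 2 ^ J := pow_le_pow_right₀ (by norm_num) hJ0
  have hmaj := h.majority hn hε1 hlam0.le v hr0 hr2
  set m := center (fun i => X i ⬝ᵥ v) H J with hm
  obtain ⟨hmH, hma⟩ := center_spec (J := J) hmaj haH hr0 (by
    refine abs_le_of_sq_le_sq' ?_ (by positivity) |>.2
    rw [mul_pow 2 H, mul_pow _ r, hr2]
    have : (2 : ℝ) ^ J * lam * N ≤ (2 ^ J) ^ 2 * (4 * (1 + lam) * N) := by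
      have e1 : (2 : ℝ) ^ J ≤ (2 ^ J) ^ 2 := le_self_pow₀ (by linarith) two_ne_zero
      calc (2 : ℝ) ^ J * lam * N ≤ (2 ^ J) ^ 2 * lam * N := by gcongr
        _ ≤ (2 ^ J) ^ 2 * (4 * (1 + lam)) * N := by gcongr; linarith
        _ = _ := by ring
    linarith [sq_nonneg H])
  have hma2 : (m - a) ^ 2 ≤ 16 * (1 + lam) * N := by
    rw [← sq_abs]
    calc |m - a| ^ 2 ≤ (2 * r) ^ 2 := pow_le_pow_left₀ (abs_nonneg _) hma 2
      _ = _ := by rw [mul_pow, hr2]; ring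
  set f : Fin n → ℝ := fun i => (X i ⬝ᵥ v - m) ^ 2 with hf
  have hf0 : ∀ i, 0 ≤ f i := fun i => sq_nonneg _
  have hfH : ∀ i, f i ≤ 4 * H ^ 2 := fun i => by
    have : |X i ⬝ᵥ v - m| ≤ 2 * H := (abs_sub _ _).trans (by linarith [hπH i])
    calc f i = |X i ⬝ᵥ v - m| ^ 2 := (sq_abs _).symm
      _ ≤ (2 * H) ^ 2 := pow_le_pow_left₀ (abs_nonneg _) this 2
      _ = _ := by ring
  have hfle : ∀ i, f i ≤ 2 * ((X i - μ) ⬝ᵥ v) ^ 2 + 32 * (1 + lam) * N := fun i => by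
    rw [Regular.dotProduct_sub]
    have := sq_sub_le (X i ⬝ᵥ v) m a
    simp only [hf]
    linarith
  have hel : ε * (1 + lam) ≤ 2 * lam := by
    linarith [mul_le_mul_of_nonneg_right hε1 hlam0.le]
  -- 134 = 2 · 3 + 64 · 2: twice the bound in `small`, and 32(1 + lam)N times the mass 2εn with ε(1
  -- + lam) ≤ 2 lam.
  have hsmall : ∀ b : Fin n → ℝ, (∀ i, 0 ≤ b i ∧ b i ≤ 1) → ∑ i ∈ G, b i ≤ 2 * ε * n →
      ∑ i ∈ G, b i * f i ≤ 134 * lam * n * N := by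
    intro b hb hs
    have h1 := h.small b hb hs v
    have h2 : ∑ i ∈ G, b i * f i ≤ ∑ i ∈ G, (2 * (b i * ((X i - μ) ⬝ᵥ v) ^ 2) +
        32 * (1 + lam) * N * b i) := sum_le_sum fun i _ => by
      linarith [mul_le_mul_of_nonneg_left (hfle i) (hb i).1]
    rw [sum_add_distrib, ← mul_sum, ← mul_sum] at h2
    have h3 : 32 * (1 + lam) * N * ∑ i ∈ G, b i ≤ 32 * (1 + lam) * N * (2 * ε * n) :=
      mul_le_mul_of_nonneg_left hs (by positivity)
    have h4 : 32 * (1 + lam) * N * (2 * ε * n) ≤ 64 * (2 * lam) * (n * N) := by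
      have := mul_le_mul_of_nonneg_right hel (by positivity : 0 ≤ 64 * (n * N))
      linarith
    linarith
  set θ := (thresholdStep f (2 * ε * n))^[J] ((1 + lam) * N) with hθ
  obtain ⟨hθ1, hθ2⟩ := threshold_spec (f := f) (b := 2 * ε * n) (θ₀ := (1 + lam) * N) J
  rw [← hθ] at hθ1 hθ2
  have hcount : count (fun i => θ < f i) ≤ 2 * ε * n := by
    -- A search that never settles ends at 2^J(1 + lam)N ≥ 4H², which no score exceeds.
    rcases hθ2 with h2 | h2
    · exact h2
    · have : count (fun i => θ < f i) = 0 := by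
        rw [count_eq_card]
        simp only [Nat.cast_eq_zero, card_eq_zero]
        refine filter_eq_empty_iff.mpr fun i _ => not_lt.mpr ?_
        refine (hfH i).trans ?_
        rw [h2]
        have : (2 : ℝ) ^ J * lam * N ≤ 2 ^ J * ((1 + lam) * N) := by
          have : (0 : ℝ) ≤ 2 ^ J * N := by positivity
          linarith
        linarith [sq_nonneg H]
      rw [this]; positivity
  have hsumG : ∀ p : Fin n → Prop, ∀ _ : DecidablePred p,
      ∑ i ∈ G, (if p i then (1 : ℝ) else 0) ≤ count p := fun p _ =>
    sum_le_sum_of_subset_of_nonneg (subset_univ _) fun i _ _ => by split_ifs <;> norm_num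
  have hεθ : ε * n * θ ≤ 268 * lam * n * N := by
    rcases hθ1 with h1 | h1
    · rw [h1]
      have := mul_le_mul_of_nonneg_right hel (by positivity : 0 ≤ n * N)
      have h0 : 0 ≤ lam * (n * N) := by positivity
      linarith
    -- More than 2εn scores exceed θ/2, so more than εn good ones do. The mass εn spread evenly over
    -- these contributes at least εnθ/2, which `hsmall` bounds by 134 lam n N.
    · set F := G.filter fun i => θ / 2 < f i with hF
      have hFc : ε * n < F.card := by
        have e : count (fun i => θ / 2 < f i) ≤ F.card + (Gᶜ).card := by
          rw [count_eq_card]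
          have : (univ.filter fun i => θ / 2 < f i) ⊆ F ∪ Gᶜ := fun i hi => by
            by_cases hG : i ∈ G
            · exact mem_union_left _ (mem_filter.mpr ⟨hG, (mem_filter.mp hi).2⟩)
            · exact mem_union_right _ (mem_compl.mpr hG)
          exact_mod_cast (card_le_card this).trans (card_union_le _ _)
        linarith [h.card_compl_le]
      have hFpos : (0 : ℝ) < F.card := lt_trans (by positivity) hFc
      set c := ε * n / F.card with hc
      have hc0 : 0 ≤ c := by positivity
      have hcF : c * F.card = ε * n := by rw [hc]; field_simp
      have hc1 : c ≤ 1 := by rw [hc, div_le_one hFpos]; exact hFc.le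
      have e1 := hsmall (fun i => if θ / 2 < f i then c else 0)
        (fun i => by split_ifs <;> constructor <;> linarith) (by
          rw [← sum_filter, sum_const, nsmul_eq_mul, mul_comm, hcF]; linarith [mul_pos hε hn'])
      have e2 : ∑ i ∈ F, c * (θ / 2) ≤
          ∑ i ∈ G, (if θ / 2 < f i then c else 0) * f i := by
        simp only [ite_mul, zero_mul]
        rw [← sum_filter]
        exact sum_le_sum fun i hi => mul_le_mul_of_nonneg_left (mem_filter.mp hi).2.le hc0
      rw [sum_const, nsmul_eq_mul] at e2
      have e3 : (F.card : ℝ) * (c * (θ / 2)) = ε * n * θ / 2 := by rw [← hcF]; ring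
      linarith
  set τ := tail f θ with hτ
  have hτ0 : ∀ i, 0 ≤ τ i := fun i => by
    simp only [hτ, tail]; split_ifs
    · exact hf0 i
    · exact le_rfl
  have hτf : ∀ i, τ i ≤ f i := fun i => by
    simp only [hτ, tail]; split_ifs
    · exact le_rfl
    · exact hf0 i
  set T₀ := 200 * lam * n * N with hT₀
  have hT₀0 : 0 ≤ T₀ := by positivity
  have hGτ : ∑ i ∈ G, w i * τ i ≤ T₀ := by
    have e1 := hsmall (fun i => if θ < f i then 1 else 0)
      (fun i => by split_ifs <;> norm_num) ((hsumG _ _).trans hcount)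
    have e2 : ∑ i ∈ G, w i * τ i ≤ ∑ i ∈ G, (if θ < f i then 1 else 0) * f i :=
      sum_le_sum fun i _ => by
        simp only [hτ, tail]
        split_ifs
        · exact mul_le_mul_of_nonneg_right (hw.mem i).2 (hf0 i)
        · simp
    have : 0 ≤ lam * n * N := by positivity
    linarith
  set t₀ := 1 / (4 * H ^ 2) with ht₀
  have ht₀0 : 0 ≤ t₀ := by positivity
  have ht₀τ : ∀ i, t₀ * τ i ≤ 1 := fun i => by
    rw [ht₀, one_div_mul_eq_div]
    exact div_le_one_of_le₀ ((hτf i).trans (hfH i)) (by positivity)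
  set t := (rateStep w τ t₀ T₀)^[J] 0 with ht
  obtain ⟨ht0, ht1, ht2⟩ := rate_spec (T₀ := T₀) (fun i => (hw.mem i).1) hτ0 ht₀0 ht₀τ J
  rw [← ht] at ht0 ht1 ht2
  have hsoft : softMass w τ t ≤ 4 * T₀ := by
    rcases ht2 with h2 | h2
    · exact h2
    -- For H = 0 the quotient t₀ = 1/0 is 0, but then all scores vanish. For H > 0, t is at least
    -- 2^J/2 · t₀, and 64H² ≤ 2^J lam N makes n/t small enough.
    · rcases hH0.eq_or_lt with hz | hz
      · have : softMass w τ t = 0 := sum_eq_zero fun i _ => by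
          have : τ i = 0 := le_antisymm (((hτf i).trans (hfH i)).trans (by rw [← hz]; simp)) (hτ0 i)
          simp [this]
        rw [this]; positivity
      · have ht₀p : 0 < t₀ := by positivity
        have htp : 0 < t := by rw [h2]; exact mul_pos (by linarith) ht₀p
        refine (softMass_le_div hw.mem hτ0 htp).trans ?_
        rw [div_le_iff₀ htp, h2, ht₀]
        have e : 4 * T₀ * ((2 ^ J - 1) * (1 / (4 * H ^ 2))) = T₀ * (2 ^ J - 1) / H ^ 2 := by
          field_simp
        rw [e, le_div_iff₀ (by positivity), hT₀]
        have e1 : (2 : ℝ) ^ J / 2 ≤ 2 ^ J - 1 := by linarith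
        have e2 := mul_le_mul_of_nonneg_left e1 (by positivity : 0 ≤ 200 * lam * n * N)
        have e3 := mul_le_mul_of_nonneg_left hHle hn'.le
        have e4 : 0 ≤ n * H ^ 2 := by positivity
        linarith
  have hfw : filterWeights X ε lam ρ J w v = fun i => w i / (1 + t * τ i) := rfl
  have hden : ∀ i, 1 ≤ 1 + t * τ i := fun i => by linarith [mul_nonneg ht0 (hτ0 i)]
  have hle : ∀ i, w i / (1 + t * τ i) ≤ w i := fun i => div_le_self (hw.mem i).1 (hden i)
  have hnn : ∀ i, 0 ≤ w i / (1 + t * τ i) := fun i =>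
    div_nonneg (hw.mem i).1 (by linarith [hden i])
  rw [hfw]
  refine ⟨⟨fun i => ⟨hnn i, (hle i).trans (hw.mem i).2⟩, ?_⟩, hle, ?_⟩
  · have e1 := removed_le_removed (G := G) (fun i => (hw.mem i).1) hτ0 ht0 hGτ ht1
    have e2 := hw.le
    simp only [sum_sub_distrib] at e1 e2 ⊢
    linarith
  · intro γ hγ
    have e1 : ∑ i ∈ Gᶜ, w i / (1 + t * τ i) * τ i ≤ 4 * T₀ := by
      refine le_trans ?_ hsoft
      unfold softMass
      refine le_trans (le_of_eq ?_) (sum_le_sum_of_subset_of_nonneg (subset_univ Gᶜ) fun i _ _ => ?_)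
      · exact sum_congr rfl fun i _ => by ring
      · exact div_nonneg (mul_nonneg (hw.mem i).1 (hτ0 i)) (by linarith [hden i])
    have hθ0 : 0 ≤ θ := by
      by_contra! hneg
      have : count (fun i => θ < f i) = n := by
        rw [count_eq_card, filter_true_of_mem fun i _ => hneg.trans_le (hf0 i)]; simp
      rw [this] at hcount
      linarith [mul_le_mul_of_nonneg_right hε1 hn'.le]
    have hmγ : (m - γ) ^ 2 ≤ 32 * (1 + lam) * N + 2 * (ε * lam * N) := by
      linarith [sq_sub_le m γ a]
    -- From (x - γ)² ≤ 2f + 2(m - γ)² and f ≤ τ + θ. The tails give 2 · 4 · 200 = 1600, and the εn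
    -- bad points times E give 2 · 268 + 64 · 2 + 4 = 668, in all less than 2300.
    set E := 2 * θ + 2 * (32 * (1 + lam) * N + 2 * (ε * lam * N)) with hE
    have hE0 : 0 ≤ E := by positivity
    have e2 : ∑ i ∈ Gᶜ, w i / (1 + t * τ i) * (X i ⬝ᵥ v - γ) ^ 2 ≤
        ∑ i ∈ Gᶜ, (2 * (w i / (1 + t * τ i) * τ i) + E) := by
      refine sum_le_sum fun i _ => ?_
      have g1 : (X i ⬝ᵥ v - γ) ^ 2 ≤ 2 * τ i + E := by
        have g2 : f i ≤ τ i + θ := by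
          simp only [hτ, tail]; split_ifs with hi
          · linarith
          · linarith [not_lt.mp hi]
        have g3 : (X i ⬝ᵥ v - γ) ^ 2 ≤ 2 * f i + 2 * (m - γ) ^ 2 := by
          have := sq_sub_le (X i ⬝ᵥ v) γ m
          rw [← neg_sub m γ, neg_sq] at this
          exact this
        linarith
      have g4 := mul_le_mul_of_nonneg_left g1 (hnn i)
      have g5 := mul_le_mul_of_nonneg_right ((hle i).trans (hw.mem i).2) hE0
      linarith
    rw [sum_add_distrib, ← mul_sum, sum_const, nsmul_eq_mul] at e2
    have e3 : ((Gᶜ).card : ℝ) * E ≤ ε * n * E := mul_le_mul_of_nonneg_right h.card_compl_le hE0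
    have e4 : ε * n * E = 2 * (ε * n * θ) + 64 * (ε * (1 + lam)) * (n * N) +
        4 * (ε * ε) * (lam * n * N) := by rw [hE]; ring
    have e5 := mul_le_mul_of_nonneg_right hel (by positivity : 0 ≤ n * N)
    have e6 : ε * ε ≤ 1 := mul_le_one₀ (by linarith) hε.le (by linarith)
    have e7 := mul_le_mul_of_nonneg_right e6 (by positivity : 0 ≤ lam * n * N)
    have e8 : 0 ≤ lam * n * N := by positivity
    rw [hT₀] at e1
    refine e2.trans ?_
    linarith

end Filter

end RobustMean

namespace RobustMean

open Matrix Finset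

variable {n d : ℕ}

/-! ### The weighted covariance -/

/-- `∑ i, ∑ j, w i * w j * (π i - π j) ^ 2 / 2`. -/
def pairForm (w π : Fin n → ℝ) : ℝ :=
  (∑ i, w i) * (∑ i, w i * π i ^ 2) - (∑ i, w i * π i) ^ 2

theorem two_mul_pairForm (w π : Fin n → ℝ) :
    2 * pairForm w π = ∑ i, ∑ j, w i * w j * (π i - π j) ^ 2 := by
  have e : ∀ i j, w i * w j * (π i - π j) ^ 2 =
      w j * (w i * π i ^ 2) + w i * (w j * π j ^ 2) - 2 * ((w i * π i) * (w j * π j)) := by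
    intros; ring
  simp only [e, sum_sub_distrib, sum_add_distrib, ← mul_sum, ← sum_mul]
  rw [pairForm]; ring

/-- Monotonicity in the weights is visible in the pairwise form and would fail after division by the
squared total weight. This is why `covMat` is normalized by n² instead. -/
theorem pairForm_mono {w w' : Fin n → ℝ} (h0 : ∀ i, 0 ≤ w' i) (h : ∀ i, w' i ≤ w i)
    (π : Fin n → ℝ) : pairForm w' π ≤ pairForm w π := by
  have : 2 * pairForm w' π ≤ 2 * pairForm w π := by
    rw [two_mul_pairForm, two_mul_pairForm]
    exact sum_le_sum fun i _ => sum_le_sum fun j _ => mul_le_mul_of_nonneg_right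
      (mul_le_mul (h i) (h j) (h0 j) ((h0 i).trans (h i))) (sq_nonneg _)
  linarith

theorem pairForm_sub_const (w π : Fin n → ℝ) (c : ℝ) :
    pairForm w (fun i => π i - c) = pairForm w π := by
  have : 2 * pairForm w (fun i => π i - c) = 2 * pairForm w π := by
    rw [two_mul_pairForm, two_mul_pairForm]
    simp
  linarith

theorem pairForm_le (w π : Fin n → ℝ) (c : ℝ) :
    pairForm w π ≤ (∑ i, w i) * ∑ i, w i * (π i - c) ^ 2 := by
  rw [← pairForm_sub_const w π c, pairForm]
  linarith [sq_nonneg (∑ i, w i * (π i - c))]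

/-- Center at the good mean γ, so that only bad indices contribute to the first moment. By
Cauchy-Schwarz its square is absorbed by the bad mass times the bad second moment; the product of
the bad mass and the good second moment is dropped. -/
theorem le_pairForm {w π : Fin n → ℝ} (hw : ∀ i, 0 ≤ w i) (G : Finset (Fin n)) {γ : ℝ}
    (hγ : ∑ i ∈ G, w i * (π i - γ) = 0) :
    (∑ i ∈ G, w i) * (∑ i ∈ G, w i * (π i - γ) ^ 2) +
      (∑ i ∈ G, w i) * (∑ i ∈ Gᶜ, w i * (π i - γ) ^ 2) ≤ pairForm w π := by
  rw [← pairForm_sub_const w π γ, pairForm, ← sum_add_sum_compl G w,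
    ← sum_add_sum_compl G fun i => w i * (π i - γ) ^ 2,
    ← sum_add_sum_compl G fun i => w i * (π i - γ), hγ, zero_add]
  have h1 : (∑ i ∈ Gᶜ, w i * (π i - γ)) ^ 2 ≤
      (∑ i ∈ Gᶜ, w i) * ∑ i ∈ Gᶜ, w i * (π i - γ) ^ 2 :=
    sum_sq_le_sum_mul_sum_of_sq_le_mul _ (fun i _ => hw i)
      (fun i _ => mul_nonneg (hw i) (sq_nonneg _)) fun i _ => le_of_eq (by ring)
  have h2 : 0 ≤ ∑ i ∈ Gᶜ, w i := sum_nonneg fun i _ => hw i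
  have h3 : 0 ≤ ∑ i ∈ G, w i * (π i - γ) ^ 2 :=
    sum_nonneg fun i _ => mul_nonneg (hw i) (sq_nonneg _)
  nlinarith [mul_nonneg h2 h3]

/-- The weighted covariance, scaled by the square of the total weight and shifted by `κ`. -/
noncomputable def covMat (X : Fin n → Fin d → ℝ) (κ : ℝ) (w : Fin n → ℝ) :
    Matrix (Fin d) (Fin d) ℝ :=
  Matrix.of fun j k => ((∑ i, w i) * (∑ i, w i * X i k * X i j) -
    (∑ i, w i * X i j) * ∑ i, w i * X i k) / n ^ 2 - κ * (1 : Matrix (Fin d) (Fin d) ℝ) j k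

/-- The product of `covMat` and a vector. -/
noncomputable def covMul (X : Fin n → Fin d → ℝ) (κ : ℝ) (w : Fin n → ℝ) (v : Fin d → ℝ) :
    Fin d → ℝ := fun j =>
  ((∑ i, w i) * (∑ i, w i * (X i ⬝ᵥ v) * X i j) -
    (∑ i, w i * X i j) * ∑ i, w i * (X i ⬝ᵥ v)) / n ^ 2 - κ * v j

theorem covMat_mulVec (X : Fin n → Fin d → ℝ) (κ : ℝ) (w : Fin n → ℝ) (v : Fin d → ℝ) :
    covMat X κ w *ᵥ v = covMul X κ w v := by
  ext j
  have e1 : ∀ i, w i * (X i ⬝ᵥ v) * X i j = ∑ k, w i * X i k * X i j * v k := fun i => by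
    simp only [dotProduct, mul_sum, sum_mul]
    exact sum_congr rfl fun k _ => by ring
  have e2 : ∀ i, w i * (X i ⬝ᵥ v) = ∑ k, w i * X i k * v k := fun i => by
    simp only [dotProduct, mul_sum]
    exact sum_congr rfl fun k _ => by ring
  have e3 : ∑ k, (∑ i, w i * X i k * X i j) * v k = ∑ i, w i * (X i ⬝ᵥ v) * X i j := by
    simp only [e1, sum_mul]; exact sum_comm
  have e4 : ∑ k, (∑ i, w i * X i k) * v k = ∑ i, w i * (X i ⬝ᵥ v) := by
    simp only [e2, sum_mul]; exact sum_comm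
  have : ∑ k, (1 : Matrix (Fin d) (Fin d) ℝ) j k * v k = v j := by
    have := congrFun (one_mulVec v) j
    simpa [mulVec, dotProduct] using this
  have e5 : ∀ k, covMat X κ w j k * v k = ((∑ i, w i) * ((∑ i, w i * X i k * X i j) * v k) -
      (∑ i, w i * X i j) * ((∑ i, w i * X i k) * v k)) / n ^ 2 -
      κ * ((1 : Matrix (Fin d) (Fin d) ℝ) j k * v k) := fun k => by
    rw [covMat, of_apply]; ring
  rw [mulVec, dotProduct]
  simp only [e5, sum_sub_distrib, ← sum_div, ← mul_sum, e3, e4, this, covMul]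

theorem covMat_isHermitian (X : Fin n → Fin d → ℝ) (κ : ℝ) (w : Fin n → ℝ) :
    (covMat X κ w).IsHermitian := by
  ext j k
  simp only [covMat, conjTranspose_apply, of_apply, star_trivial, Matrix.one_apply, eq_comm (a := j)]
  congr 2
  congr 1
  · congr 1; exact sum_congr rfl fun i _ => by ring
  · ring

theorem dotProduct_covMat_mulVec (X : Fin n → Fin d → ℝ) (κ : ℝ) (w : Fin n → ℝ)
    (v : Fin d → ℝ) : v ⬝ᵥ (covMat X κ w *ᵥ v) =
      pairForm w (fun i => X i ⬝ᵥ v) / n ^ 2 - κ * (v ⬝ᵥ v) := by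
  rw [covMat_mulVec, pairForm]
  have e1 : ∑ j, v j * ∑ i, w i * (X i ⬝ᵥ v) * X i j = ∑ i, w i * (X i ⬝ᵥ v) ^ 2 := by
    simp only [mul_sum]
    rw [sum_comm]
    refine sum_congr rfl fun i _ => ?_
    have : w i * (X i ⬝ᵥ v) ^ 2 = w i * (X i ⬝ᵥ v) * ∑ j, X i j * v j := by
      rw [sq, ← mul_assoc]; rfl
    rw [this, mul_sum]
    exact sum_congr rfl fun j _ => by ring
  have e2 : ∑ j, v j * ∑ i, w i * X i j = ∑ i, w i * (X i ⬝ᵥ v) := by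
    simp only [mul_sum]
    rw [sum_comm]
    refine sum_congr rfl fun i _ => ?_
    rw [dotProduct, mul_sum]
    exact sum_congr rfl fun j _ => by ring
  have e3 : ∀ j, v j * covMul X κ w v j =
      ((∑ i, w i) * (v j * ∑ i, w i * (X i ⬝ᵥ v) * X i j) -
        (v j * ∑ i, w i * X i j) * ∑ i, w i * (X i ⬝ᵥ v)) / n ^ 2 - κ * (v j * v j) := fun j => by
    rw [covMul]; ring
  rw [dotProduct]
  simp only [e3, sum_sub_distrib, ← sum_div, ← mul_sum, ← sum_mul, e1, e2]
  rw [dotProduct, sq (∑ i, w i * (X i ⬝ᵥ v))]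

/-! ### Comparison of the covariance with the contribution of the bad points -/

section Step

variable {X : Fin n → Fin d → ℝ} {G : Finset (Fin n)} {μ : Fin d → ℝ} {ε lam : ℝ}
  {w w' : Fin n → ℝ}

/-- The weighted mean of the points in `G`. -/
noncomputable def goodMean (X : Fin n → Fin d → ℝ) (G : Finset (Fin n)) (w : Fin n → ℝ) :
    Fin d → ℝ := (∑ i ∈ G, w i)⁻¹ • ∑ i ∈ G, w i • X i

theorem sum_mul_sub_goodMean (hW : ∑ i ∈ G, w i ≠ 0) (v : Fin d → ℝ) :
    ∑ i ∈ G, w i * (X i ⬝ᵥ v - goodMean X G w ⬝ᵥ v) = 0 := by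
  have e : goodMean X G w ⬝ᵥ v = (∑ i ∈ G, w i)⁻¹ * ∑ i ∈ G, w i * (X i ⬝ᵥ v) := by
    rw [goodMean, smul_dotProduct, sum_dotProduct, smul_eq_mul]
    simp only [smul_dotProduct, smul_eq_mul]
  simp only [mul_sub, sum_sub_distrib, ← sum_mul]
  rw [e]
  field_simp
  ring

theorem Regular.goodMean_sub_sq_le (h : Regular X G μ ε lam) (hn : 0 < n) (hε1 : ε ≤ 1 / 1000)
    (hw : Balanced G w) (v : Fin d → ℝ) :
    (goodMean X G w ⬝ᵥ v - μ ⬝ᵥ v) ^ 2 ≤ ε * lam * (v ⬝ᵥ v) := by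
  have hn' : (0 : ℝ) < n := by exact_mod_cast hn
  have hm := hw.mass h.card_compl_le
  have hW : 0 < ∑ i ∈ G, w i := lt_of_lt_of_le (by nlinarith) hm
  have h1 := sum_mul_sub_goodMean (X := X) hW.ne' v
  have h2 := h.mean w hw.mem hm v
  have e : ∑ i ∈ G, w i * ((X i - μ) ⬝ᵥ v) =
      (∑ i ∈ G, w i) * (goodMean X G w ⬝ᵥ v - μ ⬝ᵥ v) := by
    simp only [Regular.dotProduct_sub, mul_sub, sum_sub_distrib, ← sum_mul] at h1 ⊢
    linarith
  rw [e, mul_pow, mul_assoc, mul_assoc] at h2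
  have := le_of_mul_le_mul_left h2 (by positivity)
  linarith

/-- The bad points contribute at most the quadratic form of `covMat`. -/
theorem Regular.bad_le_covMat (h : Regular X G μ ε lam) (hn : 0 < n) (hε : 0 < ε)
    (hε1 : ε ≤ 1 / 1000) (hlam : ε ≤ lam) (hw : Balanced G w) (v : Fin d → ℝ) :
    (1 - 2 * ε) / n * ∑ i ∈ Gᶜ, w i * (X i ⬝ᵥ v - goodMean X G w ⬝ᵥ v) ^ 2 ≤
      v ⬝ᵥ (covMat X (1 - 5 * lam) w *ᵥ v) := by
  have hn' : (0 : ℝ) < n := by exact_mod_cast hn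
  have hlam0 : 0 < lam := hε.trans_le hlam
  have hN : 0 ≤ v ⬝ᵥ v := sum_nonneg fun j _ => mul_self_nonneg _
  have hm := hw.mass h.card_compl_le
  have hW : 0 < ∑ i ∈ G, w i := lt_of_lt_of_le (by nlinarith) hm
  set W := ∑ i ∈ G, w i with hWd
  set γ := goodMean X G w ⬝ᵥ v with hγ
  have h1 := sum_mul_sub_goodMean (X := X) hW.ne' v
  have h2 := le_pairForm (fun i => (hw.mem i).1) G h1
  have h3 := h.goodMean_sub_sq_le hn hε1 hw v
  have h4 := h.lower w hw.mem hm v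
  set a := μ ⬝ᵥ v
  set N := v ⬝ᵥ v
  have h5 : ∑ i ∈ G, w i * (X i ⬝ᵥ v - γ) ^ 2 =
      ∑ i ∈ G, w i * ((X i - μ) ⬝ᵥ v) ^ 2 - W * (γ - a) ^ 2 := by
    have e : ∀ i, w i * ((X i - μ) ⬝ᵥ v) ^ 2 = w i * (X i ⬝ᵥ v - γ) ^ 2 +
        2 * (γ - a) * (w i * (X i ⬝ᵥ v - γ)) + w i * (γ - a) ^ 2 := fun i => by
      rw [Regular.dotProduct_sub]; ring
    simp only [e, sum_add_distrib, ← mul_sum, ← sum_mul]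
    rw [h1, ← hWd]; ring
  set AG := ∑ i ∈ G, w i * (X i ⬝ᵥ v - γ) ^ 2 with hAG
  set AB := ∑ i ∈ Gᶜ, w i * (X i ⬝ᵥ v - γ) ^ 2 with hAB
  have hAG0 : 0 ≤ AG := sum_nonneg fun i _ => mul_nonneg (hw.mem i).1 (sq_nonneg _)
  have hAB0 : 0 ≤ AB := sum_nonneg fun i _ => mul_nonneg (hw.mem i).1 (sq_nonneg _)
  -- Stability about μ gives 1 - lam/2; recentering at γ costs at most ε lam ≤ lam/2.
  have h6 : W * (1 - lam) * N ≤ AG := by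
    have e1 : W * (γ - a) ^ 2 ≤ W * (1 / 2 * lam * N) := by
      refine mul_le_mul_of_nonneg_left (h3.trans ?_) hW.le
      gcongr; linarith
    rw [h5]; nlinarith
  -- This fixes the shift: the squared mass is at least (1 - 2ε)²n² ≥ (1 - 4 lam)n², and (1 - 4
  -- lam)(1 - lam) ≥ 1 - 5 lam. For lam ≥ 1 the left side is not positive.
  have h7 : (1 - 5 * lam) * N * n ^ 2 ≤ W * AG := by
    rcases le_total 1 lam with hl | hl
    · have : (1 - 5 * lam) * N * n ^ 2 ≤ 0 := by
        have : 0 ≤ N * (n : ℝ) ^ 2 := by positivity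
        nlinarith
      exact this.trans (mul_nonneg hW.le hAG0)
    · have e1 : ((1 - 2 * ε) * n) ^ 2 ≤ W ^ 2 :=
        pow_le_pow_left₀ (mul_nonneg (by linarith) hn'.le) hm 2
      have e2 : (1 - 4 * lam) * (n : ℝ) ^ 2 ≤ W ^ 2 := by
        refine le_trans ?_ e1
        rw [mul_pow]
        refine mul_le_mul_of_nonneg_right ?_ (sq_nonneg _)
        nlinarith
      have e3 : (1 - 5 * lam) ≤ (1 - 4 * lam) * (1 - lam) := by nlinarith
      calc (1 - 5 * lam) * N * n ^ 2 ≤ (1 - 4 * lam) * (1 - lam) * N * n ^ 2 := by gcongr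
        _ = (1 - 4 * lam) * n ^ 2 * ((1 - lam) * N) := by ring
        _ ≤ W ^ 2 * ((1 - lam) * N) :=
          mul_le_mul_of_nonneg_right e2 (mul_nonneg (by linarith) hN)
        _ = W * (W * (1 - lam) * N) := by ring
        _ ≤ W * AG := mul_le_mul_of_nonneg_left h6 hW.le
  rw [dotProduct_covMat_mulVec, le_sub_iff_add_le, le_div_iff₀ (by positivity)]
  have h8 : (1 - 2 * ε) * n * AB ≤ W * AB := mul_le_mul_of_nonneg_right hm hAB0
  have e : ((1 - 2 * ε) / n * AB + (1 - 5 * lam) * N) * n ^ 2 =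
      (1 - 2 * ε) * n * AB + (1 - 5 * lam) * N * n ^ 2 := by field_simp
  rw [e]
  linarith

/-- The purpose of the shift: the good points alone already outweigh it, so the trace inequalities
apply to all balanced weights. -/
theorem Regular.covMat_posSemidef (h : Regular X G μ ε lam) (hn : 0 < n) (hε : 0 < ε)
    (hε1 : ε ≤ 1 / 1000) (hlam : ε ≤ lam) (hw : Balanced G w) :
    (covMat X (1 - 5 * lam) w).PosSemidef := by
  refine .of_dotProduct_mulVec_nonneg (covMat_isHermitian _ _ _) fun v => ?_
  have hn' : (0 : ℝ) < n := by exact_mod_cast hn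
  refine le_trans ?_ (h.bad_le_covMat hn hε hε1 hlam hw v)
  exact mul_nonneg (div_nonneg (by linarith) hn'.le)
    (sum_nonneg fun i _ => mul_nonneg (hw.mem i).1 (sq_nonneg _))

theorem covMat_sub_posSemidef (h0 : ∀ i, 0 ≤ w' i) (h : ∀ i, w' i ≤ w i) (κ : ℝ) :
    (covMat X κ w - covMat X κ w').PosSemidef := by
  refine .of_dotProduct_mulVec_nonneg
    ((covMat_isHermitian _ _ _).sub (covMat_isHermitian _ _ _)) fun v => ?_
  rw [star_trivial, sub_mulVec, _root_.dotProduct_sub, dotProduct_covMat_mulVec,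
    dotProduct_covMat_mulVec]
  have := div_le_div_of_nonneg_right (pairForm_mono h0 h fun i => X i ⬝ᵥ v)
    (by positivity : (0 : ℝ) ≤ (n : ℝ) ^ 2)
  linarith

/-- The quadratic form is at most the second moment about any center. The good mean for the old
weights is chosen, so that the same center occurs before and after filtering and does not depend on
the coins of the round. Here 6 lam = (1 + lam) - (1 - 5 lam). -/
theorem Regular.covMat_le (h : Regular X G μ ε lam) (hn : 0 < n) (hε1 : ε ≤ 1 / 1000)
    (hw : Balanced G w) (h0 : ∀ i, 0 ≤ w' i) (hle : ∀ i, w' i ≤ w i)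
    (v : Fin d → ℝ) :
    v ⬝ᵥ (covMat X (1 - 5 * lam) w' *ᵥ v) ≤ 6 * lam * (v ⬝ᵥ v) +
      1 / n * ∑ i ∈ Gᶜ, w' i * (X i ⬝ᵥ v - goodMean X G w ⬝ᵥ v) ^ 2 := by
  have hn' : (0 : ℝ) < n := by exact_mod_cast hn
  have hm := hw.mass h.card_compl_le
  have hW : 0 < ∑ i ∈ G, w i := lt_of_lt_of_le (by nlinarith) hm
  rw [dotProduct_covMat_mulVec]
  set γ := goodMean X G w ⬝ᵥ v with hγ
  set a := μ ⬝ᵥ v with ha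
  have h1 := pairForm_le w' (fun i => X i ⬝ᵥ v) γ
  have h2 : ∑ i, w' i ≤ n := by
    calc ∑ i, w' i ≤ ∑ _i : Fin n, (1 : ℝ) :=
          sum_le_sum fun i _ => (hle i).trans (hw.mem i).2
      _ = n := by simp
  have h3 : ∑ i ∈ G, w' i * (X i ⬝ᵥ v - γ) ^ 2 ≤ n * (1 + lam) * (v ⬝ᵥ v) := by
    have e0 := sum_mul_sub_goodMean (X := X) hW.ne' v
    have e : ∀ i, w i * ((X i - μ) ⬝ᵥ v) ^ 2 = w i * (X i ⬝ᵥ v - γ) ^ 2 +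
        2 * (γ - a) * (w i * (X i ⬝ᵥ v - γ)) + w i * (γ - a) ^ 2 := fun i => by
      rw [Regular.dotProduct_sub]; ring
    have e1 : ∑ i ∈ G, w i * ((X i - μ) ⬝ᵥ v) ^ 2 =
        ∑ i ∈ G, w i * (X i ⬝ᵥ v - γ) ^ 2 + (∑ i ∈ G, w i) * (γ - a) ^ 2 := by
      simp only [e, sum_add_distrib, ← mul_sum, ← sum_mul]
      rw [e0]; ring
    have e2 : ∑ i ∈ G, w i * ((X i - μ) ⬝ᵥ v) ^ 2 ≤ ∑ i ∈ G, ((X i - μ) ⬝ᵥ v) ^ 2 :=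
      sum_le_sum fun i _ => mul_le_of_le_one_left (sq_nonneg _) (hw.mem i).2
    have e3 : ∑ i ∈ G, w' i * (X i ⬝ᵥ v - γ) ^ 2 ≤ ∑ i ∈ G, w i * (X i ⬝ᵥ v - γ) ^ 2 :=
      sum_le_sum fun i _ => mul_le_mul_of_nonneg_right (hle i) (sq_nonneg _)
    have e4 := mul_nonneg hW.le (sq_nonneg (γ - a))
    linarith [h.upper v]
  have h4 := sum_add_sum_compl G fun i => w' i * (X i ⬝ᵥ v - γ) ^ 2
  have h5 : 0 ≤ ∑ i, w' i * (X i ⬝ᵥ v - γ) ^ 2 :=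
    sum_nonneg fun i _ => mul_nonneg (h0 i) (sq_nonneg _)
  set AB := ∑ i ∈ Gᶜ, w' i * (X i ⬝ᵥ v - γ) ^ 2
  have h6 : pairForm w' (fun i => X i ⬝ᵥ v) / n ^ 2 ≤ (1 + lam) * (v ⬝ᵥ v) + 1 / n * AB := by
    rw [div_le_iff₀ (by positivity)]
    have e : ((1 + lam) * (v ⬝ᵥ v) + 1 / n * AB) * n ^ 2 =
      n * (n * (1 + lam) * (v ⬝ᵥ v) + AB) := by field_simp
    rw [e]
    refine h1.trans ((mul_le_mul_of_nonneg_right h2 h5).trans ?_)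
    refine mul_le_mul_of_nonneg_left ?_ hn'.le
    linarith
  linarith

end Step

end RobustMean

namespace RobustMean

open Matrix Finset

variable {n d : ℕ}

/-! ### Random signs -/

/-- The signs encoded by coins. -/
noncomputable def signs (z : Fin d → Bool) : Fin d → ℝ := fun j => if z j then 1 else -1

theorem dotProduct_signs_cons (a : Fin (d + 1) → ℝ) (b : Bool) (z : Fin d → Bool) :
    a ⬝ᵥ signs (Fin.cons b z : Fin (d + 1) → Bool) =
      a 0 * (if b then 1 else -1) + (fun j => a j.succ) ⬝ᵥ signs z := by
  simp [dotProduct, Fin.sum_univ_succ, signs]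

theorem sum_cons_bool (F : (Fin (d + 1) → Bool) → ℝ) :
    ∑ z, F z = ∑ z : Fin d → Bool, (F (Fin.cons true z) + F (Fin.cons false z)) := by
  rw [← (Fin.consEquiv fun _ => Bool).sum_comp, Fintype.sum_prod_type]
  simp [Fin.consEquiv, sum_add_distrib]

theorem sum_signs_sq (a : Fin d → ℝ) :
    ∑ z : Fin d → Bool, (a ⬝ᵥ signs z) ^ 2 = 2 ^ d * (a ⬝ᵥ a) := by
  induction d with
  | zero => simp [dotProduct]
  | succ d ih =>
    rw [sum_cons_bool]
    have e : ∀ z : Fin d → Bool, (a ⬝ᵥ signs (Fin.cons true z : Fin (d + 1) → Bool)) ^ 2 +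
        (a ⬝ᵥ signs (Fin.cons false z : Fin (d + 1) → Bool)) ^ 2 =
        2 * ((fun j => a j.succ) ⬝ᵥ signs z) ^ 2 + 2 * a 0 ^ 2 := fun z => by
      rw [dotProduct_signs_cons, dotProduct_signs_cons]; simp; ring
    simp only [e, sum_add_distrib, ← mul_sum, ih]
    simp [dotProduct, Fin.sum_univ_succ]
    ring

/-- Khinchine's inequality for the fourth moment: after splitting off one sign, the odd powers
cancel. -/
theorem sum_signs_pow_four_le (a : Fin d → ℝ) :
    ∑ z : Fin d → Bool, (a ⬝ᵥ signs z) ^ 4 ≤ 3 * 2 ^ d * (a ⬝ᵥ a) ^ 2 := by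
  induction d with
  | zero => simp [dotProduct]
  | succ d ih =>
    rw [sum_cons_bool]
    set a' : Fin d → ℝ := fun j => a j.succ with ha'
    have e : ∀ z : Fin d → Bool, (a ⬝ᵥ signs (Fin.cons true z : Fin (d + 1) → Bool)) ^ 4 +
        (a ⬝ᵥ signs (Fin.cons false z : Fin (d + 1) → Bool)) ^ 4 =
        2 * (a' ⬝ᵥ signs z) ^ 4 + 12 * a 0 ^ 2 * (a' ⬝ᵥ signs z) ^ 2 + 2 * a 0 ^ 4 := fun z => by
      rw [dotProduct_signs_cons, dotProduct_signs_cons]; simp; ring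
    have h1 := ih a'
    have e2 : a ⬝ᵥ a = a 0 ^ 2 + a' ⬝ᵥ a' := by
      simp [dotProduct, Fin.sum_univ_succ, ha']; ring
    simp only [e, sum_add_distrib, ← mul_sum, sum_signs_sq a', e2]
    simp only [sum_const, card_univ, Fintype.card_pi, Fintype.card_bool, prod_const,
      Fintype.card_fin, nsmul_eq_mul, Nat.cast_pow, Nat.cast_ofNat]
    have h2 : (0 : ℝ) ≤ 2 ^ d * a 0 ^ 4 := by positivity
    rw [pow_succ (2 : ℝ) d]
    nlinarith

/-- With constant probability, the square of a random signed sum is not much smaller than its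
expectation. -/
theorem sum_signs_small_le (a : Fin d → ℝ) :
    ∑ z : Fin d → Bool, (if (a ⬝ᵥ signs z) ^ 2 < (a ⬝ᵥ a) / 4 then a ⬝ᵥ a else 0) ≤
      2 ^ d * (96 / 121 * (a ⬝ᵥ a)) := by
  have h0 : 0 ≤ a ⬝ᵥ a := sum_nonneg fun j _ => mul_self_nonneg _
  set q := a ⬝ᵥ a with hq
  rcases h0.eq_or_lt with h | h
  · simp [← h]
  refine le_of_mul_le_mul_right ?_ h
  rw [sum_mul]
  -- Chebyshev for s about 3q rather than about its mean q: s < q/4 forces (s - 3q)² ≥ 121q²/16,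
  -- while the mean of (s - 3q)² is at most 3q² - 6q² + 9q² = 6q². This gives 6 · 16/121 = 96/121.
  have h1 : ∀ z : Fin d → Bool, (if (a ⬝ᵥ signs z) ^ 2 < q / 4 then q else 0) * q ≤
      16 / 121 * ((a ⬝ᵥ signs z) ^ 4 - 6 * q * (a ⬝ᵥ signs z) ^ 2 + 9 * q ^ 2) := fun z => by
    set s := (a ⬝ᵥ signs z) ^ 2 with hs
    have : (a ⬝ᵥ signs z) ^ 4 = s ^ 2 := by rw [hs]; ring
    rw [this]
    split_ifs with hc
    · nlinarith
    · nlinarith [sq_nonneg (s - 3 * q)]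
  refine (sum_le_sum fun z _ => h1 z).trans ?_
  simp only [← mul_sum, sum_add_distrib, sum_sub_distrib, sum_signs_sq a]
  simp only [sum_const, card_univ, Fintype.card_pi, Fintype.card_bool, prod_const,
    Fintype.card_fin, nsmul_eq_mul, Nat.cast_pow, Nat.cast_ofNat, ← hq]
  have h2 := sum_signs_pow_four_le a
  rw [← hq] at h2
  nlinarith

/-! ### The potential -/

/-- With M = B^J this turns the trace into a sum of quadratic forms at the columns of M, to which
the bounds for single directions apply. -/
theorem trace_mul_pow_two_mul {A M : Matrix (Fin d) (Fin d) ℝ} (hM : Mᵀ = M) :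
    (A * (M * M)).trace = ∑ k, Mᵀ k ⬝ᵥ (A *ᵥ Mᵀ k) := by
  rw [← Matrix.mul_assoc, trace_mul_comm, ← Matrix.mul_assoc]
  nth_rewrite 1 [← hM]
  rw [Matrix.mul_assoc]
  rfl

theorem trace_mul_self {M : Matrix (Fin d) (Fin d) ℝ} (hM : Mᵀ = M) :
    (M * M).trace = ∑ k, Mᵀ k ⬝ᵥ Mᵀ k := by
  have := trace_mul_pow_two_mul (A := 1) hM
  simpa using this

/-- One round of the algorithm: filter in a random direction obtained by power iteration. -/
noncomputable def step (X : Fin n → Fin d → ℝ) (ε lam ρ : ℝ) (J : ℕ) (w : Fin n → ℝ)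
    (z : Fin d → Bool) : Fin n → ℝ :=
  filterWeights X ε lam ρ J w ((covMul X (1 - 5 * lam) w)^[J] (signs z))

theorem covMul_iterate (X : Fin n → Fin d → ℝ) (κ : ℝ) (w : Fin n → ℝ) (v : Fin d → ℝ) (J : ℕ) :
    (covMul X κ w)^[J] v = covMat X κ w ^ J *ᵥ v := by
  induction J with
  | zero => simp
  | succ J ih => rw [Function.iterate_succ_apply', ih, ← covMat_mulVec, mulVec_mulVec, pow_succ']

/-- The hypotheses under which the algorithm is analyzed. -/
structure Setup (X : Fin n → Fin d → ℝ) (G : Finset (Fin n)) (μ : Fin d → ℝ) (ε lam ρ : ℝ)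
    (J : ℕ) : Prop extends Regular X G μ ε lam where
  n_pos : 0 < n
  ε_pos : 0 < ε
  ε_le : ε ≤ 1 / 1000
  le_lam : ε ≤ lam
  ρ_nonneg : 0 ≤ ρ
  norm_X : ∀ i, X i ⬝ᵥ X i ≤ ρ ^ 2
  norm_μ : μ ⬝ᵥ μ ≤ ρ ^ 2
  J_pos : 0 < J
  le_two_pow : 64 * d * ρ ^ 2 ≤ 2 ^ J * lam

/-! ### Expected decrease of the potential -/

section Potential

variable {X : Fin n → Fin d → ℝ} {G : Finset (Fin n)} {μ : Fin d → ℝ} {ε lam ρ : ℝ} {J : ℕ}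
  {w : Fin n → ℝ}

/-- The potential function. -/
noncomputable def potential (X : Fin n → Fin d → ℝ) (lam : ℝ) (J : ℕ) (w : Fin n → ℝ) : ℝ :=
  (covMat X (1 - 5 * lam) w ^ (2 * J + 1)).trace

theorem Setup.balanced_step (h : Setup X G μ ε lam ρ J) (hw : Balanced G w) (z : Fin d → Bool) :
    Balanced G (step X ε lam ρ J w z) :=
  (filterWeights_spec h.toRegular h.n_pos h.ε_pos h.ε_le h.le_lam h.ρ_nonneg h.norm_X h.norm_μ
    h.J_pos h.le_two_pow hw _).1

/-- Divided by 2^d, the sum over z is the expectation over the coins of a round. The loss of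
potential comes from the bad points whose aᵢ·z is not exceptionally small; the filter leaves them
only O(lam) |v|² n in total. -/
theorem Setup.sum_potential_step_le (h : Setup X G μ ε lam ρ J) (hw : Balanced G w) :
    ∑ z : Fin d → Bool, potential X lam J (step X ε lam ρ J w z) ≤
      2 ^ d * (9 / 10 * potential X lam J w + d * (93000 * lam) ^ (2 * J + 1)) := by
  have hn' : (0 : ℝ) < n := by exact_mod_cast h.n_pos
  have hlam0 : 0 < lam := h.ε_pos.trans_le h.le_lam
  have hB := h.covMat_posSemidef h.n_pos h.ε_pos h.ε_le h.le_lam hw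
  set B := covMat X (1 - 5 * lam) w with hBd
  set M := B ^ J with hM
  have hMt : Mᵀ = M := by
    have := (hB.1.pow J).eq
    rwa [conjTranspose_eq_transpose_of_trivial] at this
  have hMM : B ^ (2 * J) = M * M := by rw [hM, ← pow_add]; congr 1; ring
  set g := goodMean X G w with hg
  -- M is symmetric, so aᵢ·z is the centered projection of Xᵢ to v = Mz, while |aᵢ|² is the total
  -- over the columns of M.
  set a : Fin n → Fin d → ℝ := fun i => (X i - g) ᵥ* M with ha
  set v : (Fin d → Bool) → Fin d → ℝ := fun z => M *ᵥ signs z with hv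
  have hstep : ∀ z, step X ε lam ρ J w z = filterWeights X ε lam ρ J w (v z) := fun z => by
    rw [step, covMul_iterate]
  have hspec := fun z => filterWeights_spec h.toRegular h.n_pos h.ε_pos h.ε_le h.le_lam h.ρ_nonneg
    h.norm_X h.norm_μ h.J_pos h.le_two_pow hw (v z)
  simp only [← hstep] at hspec
  have hq : ∀ w' : Fin n → ℝ, ∑ k, ∑ i ∈ Gᶜ, w' i * (X i ⬝ᵥ Mᵀ k - g ⬝ᵥ Mᵀ k) ^ 2 =
      ∑ i ∈ Gᶜ, w' i * (a i ⬝ᵥ a i) := fun w' => by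
    rw [sum_comm]
    refine sum_congr rfl fun i _ => ?_
    rw [← mul_sum]
    congr 1
    refine sum_congr rfl fun k _ => ?_
    rw [← sub_dotProduct, sq]
    rfl
  have hs : ∀ i z, X i ⬝ᵥ v z - g ⬝ᵥ v z = a i ⬝ᵥ signs z := fun i z => by
    rw [← sub_dotProduct, hv, dotProduct_mulVec]
  have h1 : ∀ z, potential X lam J (step X ε lam ρ J w z) ≤
      6 * lam * (M * M).trace + 1 / n * ∑ i ∈ Gᶜ, step X ε lam ρ J w z i * (a i ⬝ᵥ a i) := by
    intro z
    obtain ⟨hbal, hle, -⟩ := hspec z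
    have hB' := h.covMat_posSemidef h.n_pos h.ε_pos h.ε_le h.le_lam hbal
    have hsub := covMat_sub_posSemidef (X := X) (fun i => (hbal.mem i).1) hle (1 - 5 * lam)
    refine (trace_pow_succ_le hB' hB hsub (2 * J)).trans ?_
    rw [hMM, trace_mul_pow_two_mul hMt, trace_mul_self hMt, ← hq, mul_sum, mul_sum,
      ← sum_add_distrib]
    exact sum_le_sum fun k _ => h.covMat_le h.n_pos h.ε_le hw (fun i => (hbal.mem i).1) hle _
  have h2 : (1 - 2 * ε) / n * ∑ i ∈ Gᶜ, w i * (a i ⬝ᵥ a i) ≤ potential X lam J w := by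
    have e : B ^ (2 * J + 1) = B * (M * M) := by rw [pow_succ', hMM]
    rw [potential, e, trace_mul_pow_two_mul hMt, ← hq, mul_sum]
    exact sum_le_sum fun k _ => h.bad_le_covMat h.n_pos h.ε_pos h.ε_le h.le_lam hw _
  have ha0 : ∀ i, 0 ≤ a i ⬝ᵥ a i := fun i => sum_nonneg fun j _ => mul_self_nonneg _
  -- If (aᵢ·z)² is small, the old weight is kept as a bound. Otherwise |aᵢ|² ≤ 4(aᵢ·z)², and the
  -- guarantee of the filter applies.
  have h3 : ∀ z, ∑ i ∈ Gᶜ, step X ε lam ρ J w z i * (a i ⬝ᵥ a i) ≤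
      ∑ i ∈ Gᶜ, w i * (if (a i ⬝ᵥ signs z) ^ 2 < (a i ⬝ᵥ a i) / 4 then a i ⬝ᵥ a i else 0) +
        4 * (2300 * lam * n * (v z ⬝ᵥ v z)) := by
    intro z
    obtain ⟨hbal, hle, hbd⟩ := hspec z
    have e1 := hbd (g ⬝ᵥ v z) (h.goodMean_sub_sq_le h.n_pos h.ε_le hw _)
    simp only [hs] at e1
    have e2 : ∑ i ∈ Gᶜ, step X ε lam ρ J w z i * (a i ⬝ᵥ a i) ≤
        ∑ i ∈ Gᶜ, (w i * (if (a i ⬝ᵥ signs z) ^ 2 < (a i ⬝ᵥ a i) / 4 then a i ⬝ᵥ a i else 0) +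
          4 * (step X ε lam ρ J w z i * (a i ⬝ᵥ signs z) ^ 2)) := by
      refine sum_le_sum fun i _ => ?_
      have g1 := (hbal.mem i).1
      have g2 := hle i
      split_ifs with hc
      · have g3 := mul_le_mul_of_nonneg_right g2 (ha0 i)
        have g4 := mul_nonneg g1 (sq_nonneg (a i ⬝ᵥ signs z))
        linarith
      · have g3 := mul_le_mul_of_nonneg_left (not_lt.mp hc) g1
        linarith
    rw [sum_add_distrib, ← mul_sum] at e2
    linarith
  have h4 : ∑ z, v z ⬝ᵥ v z = 2 ^ d * (M * M).trace := by
    have e : ∀ z, v z ⬝ᵥ v z = ∑ j, (M j ⬝ᵥ signs z) ^ 2 := fun z => by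
      simp only [sq]; rfl
    simp only [e]
    rw [sum_comm, trace_mul_self hMt, mul_sum]
    refine sum_congr rfl fun j _ => ?_
    rw [sum_signs_sq, hMt]
  have h5 : ∑ z : Fin d → Bool, ∑ i ∈ Gᶜ, w i *
      (if (a i ⬝ᵥ signs z) ^ 2 < (a i ⬝ᵥ a i) / 4 then a i ⬝ᵥ a i else 0) ≤
      2 ^ d * (96 / 121 * ∑ i ∈ Gᶜ, w i * (a i ⬝ᵥ a i)) := by
    rw [sum_comm, mul_sum, mul_sum]
    refine sum_le_sum fun i _ => ?_
    rw [← mul_sum]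
    have := mul_le_mul_of_nonneg_left (sum_signs_small_le (a i)) (hw.mem i).1
    linarith
  -- 9300 exceeds 6 + 4 · 2300 = 9206, and division by η = 1/10 produces 93000.
  have h6 := mul_trace_pow_le hB (c := 9300 * lam) (η := 1 / 10) (by positivity) (by norm_num)
    (2 * J)
  rw [hMM] at h6
  have htr : 0 ≤ (M * M).trace := by
    rw [trace_mul_self hMt]
    exact sum_nonneg fun k _ => sum_nonneg fun j _ => mul_self_nonneg _
  have hbad0 : 0 ≤ ∑ i ∈ Gᶜ, w i * (a i ⬝ᵥ a i) :=
    sum_nonneg fun i _ => mul_nonneg (hw.mem i).1 (ha0 i)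
  set S := ∑ i ∈ Gᶜ, w i * (a i ⬝ᵥ a i) with hS
  have hcard : ((univ : Finset (Fin d → Bool)).card : ℝ) = 2 ^ d := by simp
  have h7 : ∑ z : Fin d → Bool, potential X lam J (step X ε lam ρ J w z) ≤
      2 ^ d * (9206 * lam * (M * M).trace + 96 / 121 * (1 / n * S)) := by
    have e1 : ∀ z, potential X lam J (step X ε lam ρ J w z) ≤ 6 * lam * (M * M).trace + 1 / n *
        (∑ i ∈ Gᶜ, w i * (if (a i ⬝ᵥ signs z) ^ 2 < (a i ⬝ᵥ a i) / 4 then a i ⬝ᵥ a i else 0)) +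
        9200 * lam * (v z ⬝ᵥ v z) := fun z => by
      have e2 := mul_le_mul_of_nonneg_left (h3 z) (by positivity : (0 : ℝ) ≤ 1 / n)
      have e3 : 1 / (n : ℝ) * (4 * (2300 * lam * n * (v z ⬝ᵥ v z))) =
          9200 * lam * (v z ⬝ᵥ v z) := by field_simp; ring
      rw [mul_add, e3] at e2
      linarith [h1 z]
    refine (sum_le_sum fun z _ => e1 z).trans ?_
    rw [sum_add_distrib, sum_add_distrib, sum_const, nsmul_eq_mul, hcard, ← mul_sum, ← mul_sum, h4]
    have e4 := mul_le_mul_of_nonneg_left h5 (by positivity : (0 : ℝ) ≤ 1 / n)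
    linarith
  refine h7.trans (mul_le_mul_of_nonneg_left ?_ (by positivity))
  -- The final factor is (96/121)(500/499) + 1/10 < 9/10.
  have h8 : 499 / 500 * (1 / n * S) ≤ potential X lam J w := by
    refine le_trans ?_ h2
    have : (0 : ℝ) ≤ 1 / n * S := by positivity
    have e : (1 - 2 * ε) / n * S = (1 - 2 * ε) * (1 / n * S) := by ring
    rw [e]
    exact mul_le_mul_of_nonneg_right (by linarith [h.ε_le]) this
  have h9 : (d : ℝ) * (9300 * lam * (9300 * lam / (1 / 10)) ^ (2 * J)) ≤
      d * (93000 * lam) ^ (2 * J + 1) := by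
    have e : 9300 * lam / (1 / 10) = 93000 * lam := by ring
    rw [e, pow_succ']
    gcongr
    linarith
  have h10 : (B ^ (2 * J + 1)).trace = potential X lam J w := rfl
  rw [h10] at h6
  have h11 : 0 ≤ lam * (M * M).trace := by positivity
  have h12 : (0 : ℝ) ≤ 1 / n * S := by positivity
  linarith

/-- The weights after `t` rounds with the coins `ζ`. -/
noncomputable def weightsAt (X : Fin n → Fin d → ℝ) (ε lam ρ : ℝ) (J : ℕ)
    (ζ : ℕ → Fin d → Bool) : ℕ → Fin n → ℝ
  | 0 => fun _ => 1
  | t + 1 => step X ε lam ρ J (weightsAt X ε lam ρ J ζ t) (ζ t)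

theorem weightsAt_congr {ζ ζ' : ℕ → Fin d → Bool} {t : ℕ} (h : ∀ s < t, ζ s = ζ' s) :
    weightsAt X ε lam ρ J ζ t = weightsAt X ε lam ρ J ζ' t := by
  induction t with
  | zero => rfl
  | succ t ih =>
    rw [weightsAt, weightsAt, ih fun s hs => h s (by omega), h t (by omega)]

theorem Setup.balanced_weightsAt (h : Setup X G μ ε lam ρ J) (ζ : ℕ → Fin d → Bool) (t : ℕ) :
    Balanced G (weightsAt X ε lam ρ J ζ t) := by
  induction t with
  | zero => exact ⟨fun i => by simp [weightsAt], by simp [weightsAt]⟩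
  | succ t ih => exact h.balanced_step ih _

/-- Extend a finite sequence by zeros. -/
def extend {T : ℕ} (ζ : Fin T → Fin d → Bool) (t : ℕ) : Fin d → Bool :=
  if h : t < T then ζ ⟨t, h⟩ else fun _ => false

theorem Setup.potential_nonneg (h : Setup X G μ ε lam ρ J) (hw : Balanced G w) :
    0 ≤ potential X lam J w :=
  ((h.covMat_posSemidef h.n_pos h.ε_pos h.ε_le h.le_lam hw).pow _).trace_nonneg

/-- Iterate the one-round bound, averaging over the last round first. The constant 10 = 1/(1 - 9/10)
is the sum of the geometric series of additive errors. -/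
theorem Setup.sum_potential_le (h : Setup X G μ ε lam ρ J) (T : ℕ) :
    ∑ ζ : Fin T → Fin d → Bool, potential X lam J (weightsAt X ε lam ρ J (extend ζ) T) ≤
      (2 ^ d) ^ T * ((9 / 10) ^ T * potential X lam J (fun _ => 1) +
        10 * (d * (93000 * lam) ^ (2 * J + 1))) := by
  have hlam0 : 0 < lam := h.ε_pos.trans_le h.le_lam
  set c := (d : ℝ) * (93000 * lam) ^ (2 * J + 1) with hc
  have hc0 : 0 ≤ c := by positivity
  induction T with
  | zero => simp [weightsAt, hc0]
  | succ T ih =>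
    rw [← (Fin.snocEquiv fun _ => Fin d → Bool).sum_comp, Fintype.sum_prod_type, sum_comm]
    have e : ∀ (ζ : Fin T → Fin d → Bool) (z : Fin d → Bool),
        weightsAt X ε lam ρ J (extend ((Fin.snocEquiv fun _ => Fin d → Bool) (z, ζ))) (T + 1) =
          step X ε lam ρ J (weightsAt X ε lam ρ J (extend ζ) T) z := fun ζ z => by
      rw [weightsAt]
      congr 1
      · refine weightsAt_congr fun s hs => ?_
        have : (⟨s, Nat.lt_succ_of_lt hs⟩ : Fin (T + 1)) = Fin.castSucc ⟨s, hs⟩ := rfl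
        simp only [extend, hs, Nat.lt_succ_of_lt hs, dif_pos, this, Fin.snocEquiv,
          Equiv.coe_fn_mk, Fin.snoc_castSucc]
      · have : (⟨T, Nat.lt_succ_self T⟩ : Fin (T + 1)) = Fin.last T := rfl
        simp only [extend, Nat.lt_succ_self, dif_pos, this, Fin.snocEquiv, Equiv.coe_fn_mk,
          Fin.snoc_last]
    simp only [e]
    refine (sum_le_sum fun ζ _ =>
      h.sum_potential_step_le (h.balanced_weightsAt (extend ζ) T)).trans ?_
    rw [← mul_sum, sum_add_distrib, ← mul_sum, sum_const, nsmul_eq_mul, ← hc]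
    have hcard : ((univ : Finset (Fin T → Fin d → Bool)).card : ℝ) = (2 ^ d) ^ T := by simp
    rw [hcard]
    have h1 : (0 : ℝ) ≤ 2 ^ d := by positivity
    have h2 := mul_le_mul_of_nonneg_left ih h1
    have h3 : (0 : ℝ) ≤ 2 ^ d * ((2 ^ d) ^ T * c) := by positivity
    rw [pow_succ, pow_succ]
    linarith

open scoped Classical in
/-- For most outcomes of the coins, the final covariance is bounded. -/
theorem Setup.card_bad_le (h : Setup X G μ ε lam ρ J) {T : ℕ} {τ : ℝ} (hd : 0 < d)
    (hT : (9 / 10) ^ T * (ρ ^ 2 + 5 * lam) ^ (2 * J + 1) ≤ (93000 * lam) ^ (2 * J + 1))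
    (hJ : 11 * d ≤ τ * 2 ^ (2 * J + 1)) :
    ((univ.filter fun ζ : Fin T → Fin d → Bool => ¬ ∀ u : Fin d → ℝ,
      u ⬝ᵥ (covMat X (1 - 5 * lam) (weightsAt X ε lam ρ J (extend ζ) T) *ᵥ u) ≤
        186000 * lam * (u ⬝ᵥ u)).card : ℝ) ≤ τ * (2 ^ d) ^ T := by
  have hn' : (0 : ℝ) < n := by exact_mod_cast h.n_pos
  have hd' : (0 : ℝ) < d := by exact_mod_cast hd
  have hlam0 : 0 < lam := h.ε_pos.trans_le h.le_lam
  set Λ := 93000 * lam with hΛ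
  have hΛ0 : 0 < Λ := by positivity
  set bad := univ.filter fun ζ : Fin T → Fin d → Bool => ¬ ∀ u : Fin d → ℝ,
      u ⬝ᵥ (covMat X (1 - 5 * lam) (weightsAt X ε lam ρ J (extend ζ) T) *ᵥ u) ≤
        186000 * lam * (u ⬝ᵥ u) with hbad
  have hb1 : Balanced G (fun _ : Fin n => (1 : ℝ)) := h.balanced_weightsAt (fun _ _ => false) 0
  -- Markov's inequality: if the potential were at most (2Λ)^(2J+1), each eigenvalue would be at
  -- most 2Λ.
  have h1 : (bad.card : ℝ) * (2 * Λ) ^ (2 * J + 1) ≤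
      ∑ ζ : Fin T → Fin d → Bool, potential X lam J (weightsAt X ε lam ρ J (extend ζ) T) := by
    rw [← nsmul_eq_mul]
    refine le_trans (card_nsmul_le_sum bad _ _ fun ζ hζ => ?_)
      (sum_le_sum_of_subset_of_nonneg (subset_univ _) fun ζ _ _ =>
        h.potential_nonneg (h.balanced_weightsAt _ _))
    rw [hbad, mem_filter] at hζ
    by_contra! hlt
    refine hζ.2 fun u => ?_
    have := dotProduct_mulVec_le_of_trace_pow
      (h.covMat_posSemidef h.n_pos h.ε_pos h.ε_le h.le_lam (h.balanced_weightsAt (extend ζ) T))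
      (by positivity) (Nat.succ_ne_zero _) hlt.le u
    rw [hΛ] at this
    linarith
  have h2 := h.sum_potential_le T
  have h3 : potential X lam J (fun _ => 1) ≤ d * (ρ ^ 2 + 5 * lam) ^ (2 * J + 1) := by
    refine trace_pow_le (h.covMat_posSemidef h.n_pos h.ε_pos h.ε_le h.le_lam hb1) (fun u => ?_) _
    rw [dotProduct_covMat_mulVec]
    have hu : 0 ≤ u ⬝ᵥ u := sum_nonneg fun j _ => mul_self_nonneg _
    have e1 : pairForm (fun _ : Fin n => (1 : ℝ)) (fun i => X i ⬝ᵥ u) / n ^ 2 ≤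
        ρ ^ 2 * (u ⬝ᵥ u) := by
      rw [div_le_iff₀ (by positivity)]
      refine (pairForm_le _ _ 0).trans ?_
      have e2 : ∀ i, (X i ⬝ᵥ u) ^ 2 ≤ ρ ^ 2 * (u ⬝ᵥ u) := fun i => by
        have := Finset.sum_mul_sq_le_sq_mul_sq univ (X i) u
        have e3 : X i ⬝ᵥ X i = ∑ j, X i j ^ 2 := by simp [dotProduct, sq]
        have e4 : u ⬝ᵥ u = ∑ j, u j ^ 2 := by simp [dotProduct, sq]
        refine le_trans (b := (X i ⬝ᵥ X i) * (u ⬝ᵥ u)) ?_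
          (mul_le_mul_of_nonneg_right (h.norm_X i) hu)
        rw [e3, e4]; exact this
      have e5 : ∑ i, 1 * (X i ⬝ᵥ u - 0) ^ 2 ≤ ∑ _i : Fin n, ρ ^ 2 * (u ⬝ᵥ u) :=
        sum_le_sum fun i _ => by simpa using e2 i
      simp only [sum_const, card_univ, Fintype.card_fin, nsmul_eq_mul, mul_one] at e5 ⊢
      nlinarith [mul_le_mul_of_nonneg_left e5 hn'.le]
    linarith
  have h4 : (9 / 10) ^ T * potential X lam J (fun _ => 1) ≤ d * Λ ^ (2 * J + 1) := by
    calc (9 / 10) ^ T * potential X lam J (fun _ => 1)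
        ≤ (9 / 10) ^ T * (d * (ρ ^ 2 + 5 * lam) ^ (2 * J + 1)) := by gcongr
      _ = d * ((9 / 10) ^ T * (ρ ^ 2 + 5 * lam) ^ (2 * J + 1)) := by ring
      _ ≤ _ := by gcongr
  -- 11 = 1 + 10: what is left of the initial potential, and the accumulated additive errors.
  have h5 : (bad.card : ℝ) * (2 * Λ) ^ (2 * J + 1) ≤
      (2 ^ d) ^ T * (11 * d * Λ ^ (2 * J + 1)) := by
    refine (h1.trans h2).trans (mul_le_mul_of_nonneg_left ?_ (by positivity))
    linarith
  rw [mul_pow] at h5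
  have h6 : (bad.card : ℝ) * 2 ^ (2 * J + 1) ≤ (2 ^ d) ^ T * (11 * d) := by
    refine le_of_mul_le_mul_right ?_ (by positivity : 0 < Λ ^ (2 * J + 1))
    linarith
  refine le_of_mul_le_mul_right (h6.trans ?_) (by positivity : (0 : ℝ) < 2 ^ (2 * J + 1))
  have := mul_le_mul_of_nonneg_left hJ (by positivity : (0 : ℝ) ≤ (2 ^ d) ^ T)
  linarith

/-- If the covariance is bounded, then the weighted mean is close to `μ`. -/
theorem Setup.weightedMean_close (h : Setup X G μ ε lam ρ J) (hw : Balanced G w)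
    (hc : ∀ u : Fin d → ℝ, u ⬝ᵥ (covMat X (1 - 5 * lam) w *ᵥ u) ≤ 186000 * lam * (u ⬝ᵥ u))
    (u : Fin d → ℝ) :
    (((∑ i, w i)⁻¹ • ∑ i, w i • X i - μ) ⬝ᵥ u) ^ 2 ≤ 400000 * (ε * lam) * (u ⬝ᵥ u) := by
  have hn' : (0 : ℝ) < n := by exact_mod_cast h.n_pos
  have hε := h.ε_pos
  have hε1 := h.ε_le
  have hlam0 : 0 < lam := h.ε_pos.trans_le h.le_lam
  have hN : 0 ≤ u ⬝ᵥ u := sum_nonneg fun j _ => mul_self_nonneg _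
  have hm := hw.mass h.card_compl_le
  have hm' : 499 / 500 * n ≤ ∑ i ∈ G, w i := le_trans (by nlinarith) hm
  have hWG : 0 < ∑ i ∈ G, w i := lt_of_lt_of_le (by positivity) hm'
  have hWge : ∑ i ∈ G, w i ≤ ∑ i, w i :=
    sum_le_sum_of_subset_of_nonneg (subset_univ _) fun i _ _ => (hw.mem i).1
  set W := ∑ i, w i with hW
  have hW0 : 0 < W := hWG.trans_le hWge
  set γ := goodMean X G w ⬝ᵥ u with hγ
  have e1 : ((∑ i, w i)⁻¹ • ∑ i, w i • X i) ⬝ᵥ u = W⁻¹ * ∑ i, w i * (X i ⬝ᵥ u) := by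
    rw [smul_dotProduct, sum_dotProduct, smul_eq_mul]
    simp only [smul_dotProduct, smul_eq_mul]
    rfl
  -- Only the bad points move the mean away from γ.
  have e2 : W * (((∑ i, w i)⁻¹ • ∑ i, w i • X i) ⬝ᵥ u - γ) =
      ∑ i ∈ Gᶜ, w i * (X i ⬝ᵥ u - γ) := by
    rw [e1]
    have := sum_mul_sub_goodMean (X := X) hWG.ne' u
    have e3 := sum_add_sum_compl G fun i => w i * (X i ⬝ᵥ u - γ)
    rw [this, zero_add] at e3
    rw [e3]
    simp only [mul_sub, sum_sub_distrib, ← sum_mul]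
    rw [mul_inv_cancel_left₀ hW0.ne']
  have h1 := h.bad_le_covMat h.n_pos hε hε1 h.le_lam hw u
  have h2 : (∑ i ∈ Gᶜ, w i * (X i ⬝ᵥ u - γ)) ^ 2 ≤
      (∑ i ∈ Gᶜ, w i) * ∑ i ∈ Gᶜ, w i * (X i ⬝ᵥ u - γ) ^ 2 :=
    sum_sq_le_sum_mul_sum_of_sq_le_mul _ (fun i _ => (hw.mem i).1)
      (fun i _ => mul_nonneg (hw.mem i).1 (sq_nonneg _)) fun i _ => le_of_eq (by ring)
  have h3 : ∑ i ∈ Gᶜ, w i ≤ ε * n := by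
    refine le_trans ?_ h.card_compl_le
    calc ∑ i ∈ Gᶜ, w i ≤ ∑ _i ∈ Gᶜ, (1 : ℝ) := sum_le_sum fun i _ => (hw.mem i).2
      _ = _ := by simp
  set A := ∑ i ∈ Gᶜ, w i * (X i ⬝ᵥ u - γ) ^ 2 with hA
  have hA0 : 0 ≤ A := sum_nonneg fun i _ => mul_nonneg (hw.mem i).1 (sq_nonneg _)
  have h4 : 499 / 500 * A ≤ n * (186000 * lam * (u ⬝ᵥ u)) := by
    have g1 := h1.trans (hc u)
    have g2 : (1 - 2 * ε) / n * A * n = (1 - 2 * ε) * A := by field_simp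
    have g3 := mul_le_mul_of_nonneg_right g1 hn'.le
    rw [g2] at g3
    have g4 := mul_le_mul_of_nonneg_right (by linarith : (499 : ℝ) / 500 ≤ 1 - 2 * ε) hA0
    linarith
  set D := ((∑ i, w i)⁻¹ • ∑ i, w i • X i) ⬝ᵥ u with hD
  have h5 : W ^ 2 * (D - γ) ^ 2 ≤ ε * n * A := by
    rw [← mul_pow, e2]
    exact h2.trans (mul_le_mul_of_nonneg_right h3 hA0)
  have h6 : (499 / 500 * n) ^ 2 ≤ W ^ 2 := pow_le_pow_left₀ (by positivity) (hm'.trans hWge) 2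
  -- 186000(500/499)³ < 190000. Together with the distance of the good mean from μ this gives 2 ·
  -- 190000 + 2 < 400000.
  have h7 : (D - γ) ^ 2 ≤ 190000 * (ε * lam) * (u ⬝ᵥ u) := by
    have g1 := mul_le_mul_of_nonneg_right h6 (sq_nonneg (D - γ))
    have g2 := mul_le_mul_of_nonneg_left h4 (by positivity : 0 ≤ ε * n)
    refine le_of_mul_le_mul_left ?_ (by positivity : (0 : ℝ) < n ^ 2)
    have g3 : 0 ≤ n ^ 2 * (ε * lam * (u ⬝ᵥ u)) := by positivity
    nlinarith
  have h8 := h.goodMean_sub_sq_le h.n_pos hε1 hw u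
  have h9 := sq_sub_le D (μ ⬝ᵥ u) γ
  rw [sub_dotProduct]
  have h10 : (μ ⬝ᵥ u - γ) ^ 2 = (γ - μ ⬝ᵥ u) ^ 2 := by ring
  have : 0 ≤ ε * lam * (u ⬝ᵥ u) := by positivity
  rw [h10] at h9
  linarith

end Potential

end RobustMean

namespace RobustMean

open Matrix Finset

variable {n d : ℕ}

/-! ### The law of the coins -/

/-- The coins of the rounds `0, …, T - 1`, with `d` coins per round. -/
def rounds (T d : ℕ) (ω : ℕ → Bool) : Fin T → Fin d → Bool := fun t j => ω (t * d + j)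

/-- The fiber is a cylinder: coin k belongs to round k / d and coordinate k % d, and exactly the
first T·d coins are prescribed. -/
theorem rounds_preimage (T : ℕ) (hd : 0 < d) (ζ : Fin T → Fin d → Bool) :
    rounds T d ⁻¹' {ζ} = Set.pi (range (T * d) : Finset ℕ) fun k =>
      {extend ζ (k / d) ⟨k % d, Nat.mod_lt _ hd⟩} := by
  ext ω
  simp only [Set.mem_preimage, Set.mem_singleton_iff, Set.mem_pi, coe_range, Set.mem_Iio]
  constructor
  · rintro rfl k hk
    have hk' : k / d < T := Nat.div_lt_of_lt_mul (by rwa [mul_comm])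
    simp only [extend, hk', dif_pos, rounds]
    rw [Nat.div_add_mod']
  · intro h
    funext t j
    have hlt : t * d + j < T * d := by
      calc (t : ℕ) * d + j < t * d + d := by omega
        _ = (t + 1) * d := by ring
        _ ≤ T * d := Nat.mul_le_mul_right _ t.2
    have h1 := h _ hlt
    have e1 : (t * d + j : ℕ) / d = t := by
      rw [mul_comm, Nat.mul_add_div hd, Nat.div_eq_of_lt j.2, add_zero]
    have e2 : (t * d + j : ℕ) % d = j := by
      rw [mul_comm, Nat.mul_add_mod, Nat.mod_eq_of_lt j.2]
    rw [rounds, h1]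
    simp [e1, e2, extend]

theorem coins_rounds_preimage (T : ℕ) (hd : 0 < d) (ζ : Fin T → Fin d → Bool) :
    RealRAM.coins (rounds T d ⁻¹' {ζ}) = ((2 : ENNReal)⁻¹) ^ (T * d) := by
  rw [rounds_preimage T hd, RealRAM.coins, MeasureTheory.Measure.infinitePi_pi _ (by measurability)]
  have : ∀ b : Bool, (PMF.uniformOfFintype Bool).toMeasure {b} = (2 : ENNReal)⁻¹ := fun b => by
    rw [PMF.toMeasure_apply_singleton _ _ (measurableSet_singleton b)]
    simp
  simp [this]

open scoped Classical in
/-- A property of the coins that fails for few of the outcomes is likely. -/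
theorem ofReal_le_coins {T : ℕ} (hd : 0 < d) {P : (Fin T → Fin d → Bool) → Prop} {τ : ℝ}
    (h : ((univ.filter fun ζ => ¬ P ζ).card : ℝ) ≤ τ * (2 ^ d) ^ T) :
    ENNReal.ofReal (1 - τ) ≤ RealRAM.coins {ω | P (rounds T d ω)} := by
  have e1 : {ω | P (rounds T d ω)} = rounds T d ⁻¹' (univ.filter P : Finset _) := by
    ext ω; simp
  have hmeas : ∀ ζ ∈ univ.filter P, MeasurableSet (rounds T d ⁻¹' {ζ}) := fun ζ _ => by
    rw [rounds_preimage T hd]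
    exact MeasurableSet.pi (Finset.countable_toSet _) fun _ _ => measurableSet_singleton _
  rw [e1, ← MeasureTheory.sum_measure_preimage_singleton _ hmeas]
  simp only [coins_rounds_preimage T hd, sum_const, nsmul_eq_mul]
  have hcard := card_filter_add_card_filter_not (s := (univ : Finset (Fin T → Fin d → Bool))) P
  have hcard' : ((univ.filter P).card : ℝ) + (univ.filter fun ζ => ¬ P ζ).card = (2 ^ d) ^ T := by
    exact_mod_cast hcard.trans (by simp)
  have e2 : ((univ.filter P).card : ENNReal) * (2⁻¹) ^ (T * d) =
      ENNReal.ofReal ((univ.filter P).card * (2⁻¹) ^ (T * d)) := by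
    rw [ENNReal.ofReal_mul (by positivity), ENNReal.ofReal_natCast,
      ENNReal.ofReal_pow (by positivity), ENNReal.ofReal_inv_of_pos (by norm_num)]
    simp
  rw [e2]
  refine ENNReal.ofReal_le_ofReal ?_
  have e3 : ((2 : ℝ)⁻¹) ^ (T * d) = ((2 ^ d) ^ T)⁻¹ := by rw [inv_pow, ← pow_mul, mul_comm]
  rw [e3, ← div_eq_mul_inv, le_div_iff₀ (by positivity)]
  linarith

/-! ### Consequences of stability -/

/-- Stability in terms of weights for the indices. -/
theorem IsStable.index {y : Fin n → Vec d} {ε' δ : ℝ} {μ : Vec d} (h : IsStable y ε' δ μ)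
    (hn : 0 < n) (hε' : ε' < 1) {a : Fin n → ℝ} (ha : ∀ i, 0 ≤ a i ∧ a i ≤ 1)
    (hs : (1 - ε') * n ≤ ∑ i, a i) (v : Fin d → ℝ) :
    (∑ i, a i * (((y i).ofLp - μ.ofLp) ⬝ᵥ v)) ^ 2 ≤ (∑ i, a i) ^ 2 * δ ^ 2 * (v ⬝ᵥ v) ∧
    |∑ i, a i * (((y i).ofLp - μ.ofLp) ⬝ᵥ v) ^ 2 - (∑ i, a i) * (v ⬝ᵥ v)| ≤
      (∑ i, a i) * (δ ^ 2 / ε') * (v ⬝ᵥ v) := by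
  classical
  have hn' : (0 : ℝ) < n := by exact_mod_cast hn
  -- Stability admits only weights that are functions of the point. Averaging `a` over coinciding
  -- points gives such a weight and preserves every sum of the form ∑ aᵢ f(yᵢ).
  let c : Vec d → ℝ := fun p => ((univ.filter fun i => y i = p).card : ℝ)
  let w : Vec d → ℝ := fun p => (c p)⁻¹ * ∑ i ∈ univ.filter (fun i => y i = p), a i
  have hw : ∀ p, 0 ≤ w p ∧ w p ≤ 1 := fun p => by
    constructor
    · exact mul_nonneg (by positivity) (sum_nonneg fun i _ => (ha i).1)
    · have : ∑ i ∈ univ.filter (fun i => y i = p), a i ≤ c p := by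
        calc _ ≤ ∑ _i ∈ univ.filter (fun i => y i = p), (1 : ℝ) := sum_le_sum fun i _ => (ha i).2
          _ = _ := by simp [c]
      exact inv_mul_le_one_of_le₀ this (by positivity)
  have key : ∀ f : Vec d → ℝ, ∑ i, w (y i) * f (y i) = ∑ i, a i * f (y i) := by
    intro f
    have e1 : ∀ i, w (y i) * f (y i) =
        ∑ k, if y k = y i then (c (y k))⁻¹ * a k * f (y k) else 0 := fun i => by
      rw [← sum_filter]
      simp only [w]
      rw [mul_sum, sum_mul]
      refine sum_congr rfl fun k hk => ?_
      rw [(mem_filter.mp hk).2]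
    simp only [e1]
    rw [sum_comm]
    refine sum_congr rfl fun k _ => ?_
    rw [← sum_filter, sum_const, nsmul_eq_mul]
    have e2 : ((univ.filter fun i => y k = y i).card : ℝ) = c (y k) := by
      simp only [c]; congr 2; ext i; simp [eq_comm]
    rw [e2]
    have : c (y k) ≠ 0 := by
      simp only [c]
      exact_mod_cast (card_pos.mpr ⟨k, by simp⟩).ne'
    field_simp
  have hsum : ∑ i, w (y i) = ∑ i, a i := by simpa using key fun _ => 1
  set W := ∑ i, a i with hW
  have hW0 : 0 < W := lt_of_lt_of_le (mul_pos (by linarith) hn') hs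
  obtain ⟨h1, h2⟩ := h w hw (by
    rw [weightMass, hsum, inv_mul_eq_div, le_div_iff₀ hn']; exact hs)
  constructor
  · have e1 : W * ((weightedMean y w - μ).ofLp ⬝ᵥ v) =
        ∑ i, a i * (((y i).ofLp - μ.ofLp) ⬝ᵥ v) := by
      have e2 : (weightedMean y w).ofLp ⬝ᵥ v = W⁻¹ * ∑ i, a i * ((y i).ofLp ⬝ᵥ v) := by
        rw [← key fun p => p.ofLp ⬝ᵥ v, weightedMean, hsum]
        simp only [WithLp.ofLp_smul, WithLp.ofLp_sum, smul_dotProduct, sum_dotProduct, smul_eq_mul]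
      rw [WithLp.ofLp_sub, sub_dotProduct, e2, mul_sub, mul_inv_cancel_left₀ hW0.ne']
      simp only [sub_dotProduct, mul_sub, sum_sub_distrib, ← sum_mul]
      rfl
    rw [← e1, mul_pow, mul_assoc]
    refine mul_le_mul_of_nonneg_left ?_ (sq_nonneg _)
    have e3 := Finset.sum_mul_sq_le_sq_mul_sq univ (weightedMean y w - μ).ofLp v
    have e4 : ∑ j, (weightedMean y w - μ).ofLp j ^ 2 ≤ δ ^ 2 := by
      rw [← EuclideanSpace.real_norm_sq_eq]
      exact pow_le_pow_left₀ (norm_nonneg _) h1 2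
    have e5 : v ⬝ᵥ v = ∑ j, v j ^ 2 := by simp [dotProduct, sq]
    rw [e5]
    exact e3.trans (mul_le_mul_of_nonneg_right e4 (sum_nonneg fun j _ => sq_nonneg _))
  · set M := weightedSecondMoment y w μ - 1 with hM
    have e1 : W * (v ⬝ᵥ (M *ᵥ v)) =
        ∑ i, a i * (((y i).ofLp - μ.ofLp) ⬝ᵥ v) ^ 2 - W * (v ⬝ᵥ v) := by
      rw [hM, sub_mulVec, _root_.dotProduct_sub, one_mulVec, mul_sub]
      congr 1
      rw [weightedSecondMoment, hsum, smul_mulVec, dotProduct_smul, smul_eq_mul,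
        mul_inv_cancel_left₀ hW0.ne', ← key fun p => ((p.ofLp - μ.ofLp) ⬝ᵥ v) ^ 2,
        Matrix.sum_mulVec, dotProduct_sum]
      refine sum_congr rfl fun i _ => ?_
      rw [smul_mulVec, dotProduct_smul, smul_eq_mul]
      congr 1
      have : (Matrix.of fun a b : Fin d => (y i - μ) a * (y i - μ) b) =
          vecMulVec ((y i).ofLp - μ.ofLp) ((y i).ofLp - μ.ofLp) := by
        ext; simp [vecMulVec_apply]
      rw [this, vecMulVec_mulVec, dotProduct_smul, MulOpposite.smul_eq_mul_unop, sq]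
      simp [dotProduct_comm]
    rw [← e1, abs_mul, abs_of_pos hW0, mul_assoc]
    refine mul_le_mul_of_nonneg_left ?_ hW0.le
    have e2 : v ⬝ᵥ (M *ᵥ v) = inner ℝ (WithLp.toLp 2 v)
        (Matrix.toEuclideanCLM (n := Fin d) (𝕜 := ℝ) M (WithLp.toLp 2 v)) := by
      rw [Matrix.inner_toEuclideanCLM]
    have e3 : v ⬝ᵥ v = ‖(WithLp.toLp 2 v : Vec d)‖ ^ 2 := by
      rw [EuclideanSpace.real_norm_sq_eq]; simp [dotProduct, sq]
    rw [e2, e3]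
    refine (abs_real_inner_le_norm _ _).trans ?_
    have e4 := (Matrix.toEuclideanCLM (n := Fin d) (𝕜 := ℝ) M).le_opNorm (WithLp.toLp 2 v)
    have e5 : ‖Matrix.toEuclideanCLM (n := Fin d) (𝕜 := ℝ) M‖ ≤ δ ^ 2 / ε' := h2
    have e6 := norm_nonneg (WithLp.toLp 2 v : Vec d)
    calc _ ≤ ‖(WithLp.toLp 2 v : Vec d)‖ * (δ ^ 2 / ε' * ‖(WithLp.toLp 2 v : Vec d)‖) :=
          mul_le_mul_of_nonneg_left (e4.trans (mul_le_mul_of_nonneg_right e5 e6)) e6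
      _ = _ := by ring

theorem IsStable.comp_perm {y : Fin n → Vec d} {ε' δ : ℝ} {μ : Vec d} (h : IsStable y ε' δ μ)
    (σ : Equiv.Perm (Fin n)) : IsStable (fun i => y (σ i)) ε' δ μ := by
  intro w hw hm
  have e1 : weightMass (fun i => y (σ i)) w = weightMass y w := by
    simp only [weightMass]; rw [Equiv.sum_comp σ fun i => w (y i)]
  have e2 : weightedMean (fun i => y (σ i)) w = weightedMean y w := by
    simp only [weightedMean]
    rw [Equiv.sum_comp σ fun i => w (y i), Equiv.sum_comp σ fun i => w (y i) • y i]
  have e3 : weightedSecondMoment (fun i => y (σ i)) w μ = weightedSecondMoment y w μ := by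
    simp only [weightedSecondMoment]
    rw [Equiv.sum_comp σ fun i => w (y i), Equiv.sum_comp σ fun i =>
      w (y i) • Matrix.of (fun a b : Fin d => (y i - μ) a * (y i - μ) b)]
  rw [e2, e3]
  exact h w hw (e1 ▸ hm)

section

variable {y : Fin n → Vec d} {ε δ : ℝ} {μ : Vec d}

/-- Each stable point is within distance `n * (1 + δ / ε)` of `μ`. -/
theorem IsStable.dist_sq_le (h : IsStable y (2 * ε) δ μ) (hn : 0 < n) (hε : 0 < ε)
    (hε1 : ε ≤ 1 / 1000) (hδ : ε ≤ δ) (i : Fin n) :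
    ((y i).ofLp - μ.ofLp) ⬝ᵥ ((y i).ofLp - μ.ofLp) ≤ (n * (1 + δ / ε)) ^ 2 := by
  have hn' : (1 : ℝ) ≤ n := by exact_mod_cast hn
  have hδ0 : 0 < δ := hε.trans_le hδ
  set v := (y i).ofLp - μ.ofLp with hv
  have hN : 0 ≤ v ⬝ᵥ v := sum_nonneg fun j _ => mul_self_nonneg _
  obtain ⟨-, h2⟩ := h.index hn (by linarith) (a := fun _ => 1) (by simp) (by simp; nlinarith) v
  simp only [one_mul, sum_const, card_univ, Fintype.card_fin, nsmul_eq_mul, mul_one] at h2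
  have h3 := (abs_le.mp h2).2
  -- The second moment is tested in the direction v = yᵢ - μ itself, where the i-th term alone is
  -- |v|⁴.
  have h4 : (v ⬝ᵥ v) ^ 2 ≤ ∑ i, (((y i).ofLp - μ.ofLp) ⬝ᵥ v) ^ 2 :=
    single_le_sum (f := fun i => (((y i).ofLp - μ.ofLp) ⬝ᵥ v) ^ 2) (fun i _ => sq_nonneg _)
      (mem_univ i)
  set r := δ / ε with hr
  have hr0 : 0 < r := by positivity
  have h5 : δ ^ 2 / (2 * ε) ≤ r ^ 2 := by
    rw [hr, div_pow, div_le_div_iff₀ (by positivity) (by positivity)]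
    have : 0 < δ ^ 2 * ε := by positivity
    nlinarith
  have h6 : (v ⬝ᵥ v) * (v ⬝ᵥ v) ≤ (n * (1 + r ^ 2)) * (v ⬝ᵥ v) := by
    have := mul_le_mul_of_nonneg_left h5 (by positivity : 0 ≤ n * (v ⬝ᵥ v))
    linarith
  have h7 : v ⬝ᵥ v ≤ n * (1 + r ^ 2) := by
    rcases hN.eq_or_lt with h0 | h0
    · rw [← h0]; positivity
    · exact le_of_mul_le_mul_right h6 h0
  refine h7.trans ?_
  rw [mul_pow]
  have h8 : (n : ℝ) ≤ n ^ 2 := by nlinarith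
  have h9 : 1 + r ^ 2 ≤ (1 + r) ^ 2 := by nlinarith
  exact mul_le_mul h8 h9 (by positivity) (by positivity)

/-- The points that agree with a stable set are regular, after a translation by `c`. -/
theorem IsStable.regular (h : IsStable y (2 * ε) δ μ) (hn : 0 < n) (hε : 0 < ε)
    (hε1 : ε ≤ 1 / 1000) (hδ : ε ≤ δ) {X : Fin n → Fin d → ℝ} {G : Finset (Fin n)}
    {c : Fin d → ℝ} (hG : ((Gᶜ).card : ℝ) ≤ ε * n) (hX : ∀ i ∈ G, X i = (y i).ofLp - c) :
    Regular X G (μ.ofLp - c) ε (δ ^ 2 / ε) := by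
  classical
  have hn' : (0 : ℝ) < n := by exact_mod_cast hn
  have hδ0 : 0 < δ := hε.trans_le hδ
  set lam := δ ^ 2 / ε with hlam
  have hlam0 : 0 < lam := by positivity
  -- Stability at level 2ε yields lam/2 for the second moments and δ² = ε lam for the squared
  -- deviation of the mean.
  have hl2 : δ ^ 2 / (2 * ε) = lam / 2 := by rw [hlam]; field_simp
  have hle : ε ≤ lam := by rw [hlam, le_div_iff₀ hε]; nlinarith
  have hd2 : δ ^ 2 = ε * lam := by rw [hlam]; field_simp
  have hXi : ∀ i ∈ G, X i - (μ.ofLp - c) = (y i).ofLp - μ.ofLp := fun i hi => by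
    rw [hX i hi]; abel
  have hidx := fun a ha hs v => h.index hn (by linarith : 2 * ε < 1) (a := a) ha hs v
  rw [hl2, hd2] at hidx
  have hext : ∀ (w : Fin n → ℝ), (∀ i, 0 ≤ w i ∧ w i ≤ 1) →
      ∀ i, 0 ≤ (if i ∈ G then w i else 0) ∧ (if i ∈ G then w i else 0) ≤ 1 := fun w hw i => by
    split_ifs
    · exact hw i
    · norm_num
  have hall : ∀ v : Fin d → ℝ, ∑ i, (((y i).ofLp - μ.ofLp) ⬝ᵥ v) ^ 2 ≤
      n * (1 + lam / 2) * (v ⬝ᵥ v) := fun v => by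
    obtain ⟨-, h2⟩ := hidx (fun _ => 1) (by simp) (by simp; nlinarith) v
    simp only [one_mul, sum_const, card_univ, Fintype.card_fin, nsmul_eq_mul, mul_one] at h2
    linarith [(abs_le.mp h2).2]
  have hNv : ∀ v : Fin d → ℝ, 0 ≤ v ⬝ᵥ v := fun v => sum_nonneg fun j _ => mul_self_nonneg _
  refine ⟨hG, fun v => ?_, fun w hw hs v => ?_, fun w hw hs v => ?_, fun b hb hs v => ?_⟩
  · rw [sum_congr rfl fun i hi => by rw [hXi i hi]]
    refine (sum_le_sum_of_subset_of_nonneg (subset_univ _) fun i _ _ => sq_nonneg _).trans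
      ((hall v).trans ?_)
    have := hNv v
    gcongr
    linarith
  · have e : ∑ i ∈ G, w i * ((X i - (μ.ofLp - c)) ⬝ᵥ v) ^ 2 =
        ∑ i ∈ G, w i * (((y i).ofLp - μ.ofLp) ⬝ᵥ v) ^ 2 :=
      sum_congr rfl fun i hi => by rw [hXi i hi]
    rw [e]
    obtain ⟨-, h2⟩ := hidx (fun i => if i ∈ G then w i else 0) (hext w hw) (by simpa using hs) v
    simp only [ite_mul, zero_mul, sum_ite_mem, univ_inter] at h2
    linarith [(abs_le.mp h2).1]
  · rw [sum_congr rfl fun i hi => by rw [hXi i hi]]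
    obtain ⟨h1, -⟩ := hidx (fun i => if i ∈ G then w i else 0) (hext w hw) (by simpa using hs) v
    simpa only [ite_mul, zero_mul, sum_ite_mem, univ_inter] using h1
  · rw [sum_congr rfl fun i hi => by rw [hXi i hi]]
    have e1 : ∑ i, (1 - if i ∈ G then b i else 0) = n - ∑ i ∈ G, b i := by
      rw [sum_sub_distrib]; simp
    -- A small part is the difference of the whole and a large part: the upper bound for the weights
    -- 1 minus the lower bound for the weights 1 - b leaves (2εn + lam n)|v|² at most, and ε ≤ lam.
    obtain ⟨-, h2⟩ := hidx (fun i => 1 - if i ∈ G then b i else 0)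
      (fun i => ⟨by linarith [(hext b hb i).2], by linarith [(hext b hb i).1]⟩)
      (by rw [e1]; linarith) v
    rw [e1] at h2
    simp only [sub_mul, one_mul, ite_mul, zero_mul, sum_sub_distrib, sum_ite_mem, univ_inter] at h2
    have h3 := (abs_le.mp h2).1
    have h4 := hall v
    have hβ : 0 ≤ ∑ i ∈ G, b i := sum_nonneg fun i _ => (hb i).1
    set β := ∑ i ∈ G, b i
    have g1 := mul_nonneg (mul_nonneg hβ hlam0.le) (hNv v)
    have g2 := mul_le_mul_of_nonneg_right hs (hNv v)
    have g3 := mul_le_mul_of_nonneg_right hle (mul_nonneg hn'.le (hNv v))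
    linarith

end

end RobustMean

namespace RealRAM

open Finset

/-! ### A program logic for the real RAM -/

/-- The registers a program may change. -/
def Program.regs : Program → List ℕ
  | .skip => []
  | .setReg v _ => [v]
  | .setArr _ _ _ _ => []
  | .toss v => [v]
  | .seq p q => p.regs ++ q.regs
  | .cond _ p q => p.regs ++ q.regs
  | .loop _ p => p.regs

/-- The arrays a program may change. -/
def Program.arrs : Program → List ℕ
  | .skip => []
  | .setReg _ _ => []
  | .setArr a _ _ _ => [a]
  | .toss _ => []
  | .seq p q => p.arrs ++ q.arrs
  | .cond _ p q => p.arrs ++ q.arrs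
  | .loop _ p => p.arrs

/-- Whether a program may toss coins. -/
def Program.tosses : Program → Bool
  | .skip => false
  | .setReg _ _ => false
  | .setArr _ _ _ _ => false
  | .toss _ => true
  | .seq p q => p.tosses || q.tosses
  | .cond _ p q => p.tosses || q.tosses
  | .loop _ p => p.tosses

/-- What `p` cannot change is the same in `s` and `s'`. -/
structure Frame (p : Program) (s s' : Memory) : Prop where
  reg : ∀ v, v ∉ p.regs → s'.reg v = s.reg v
  arr : ∀ a, a ∉ p.arrs → s'.arr a = s.arr a
  used : p.tosses = false → s'.used = s.used

@[simp] theorem setReg_arr (s : Memory) (v k : ℕ) : (s.setReg v k).arr = s.arr := rfl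
@[simp] theorem setReg_used (s : Memory) (v k : ℕ) : (s.setReg v k).used = s.used := rfl
@[simp] theorem setArr_reg (s : Memory) (a i j : ℕ) (r : ℝ) : (s.setArr a i j r).reg = s.reg := rfl
@[simp] theorem setArr_used (s : Memory) (a i j : ℕ) (r : ℝ) :
    (s.setArr a i j r).used = s.used := rfl
theorem setReg_reg (s : Memory) (v k v' : ℕ) :
    (s.setReg v k).reg v' = if v' = v then k else s.reg v' := rfl
@[simp] theorem setReg_reg_self (s : Memory) (v k : ℕ) : (s.setReg v k).reg v = k := by
  simp [setReg_reg]
theorem setReg_reg_of_ne (s : Memory) {v v' : ℕ} (k : ℕ) (h : v' ≠ v) :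
    (s.setReg v k).reg v' = s.reg v' := by simp [setReg_reg, h]
theorem setArr_arr (s : Memory) (a i j : ℕ) (r : ℝ) (a' i' j' : ℕ) :
    (s.setArr a i j r).arr a' i' j' =
      if a' = a ∧ i' = i ∧ j' = j then r else s.arr a' i' j' := rfl
@[simp] theorem setArr_arr_self (s : Memory) (a i j : ℕ) (r : ℝ) :
    (s.setArr a i j r).arr a i j = r := by simp [setArr_arr]
theorem setArr_arr_of_ne (s : Memory) {a a' : ℕ} (i j : ℕ) (r : ℝ) (h : a' ≠ a) :
    (s.setArr a i j r).arr a' = s.arr a' := by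
  funext i' j'; simp [setArr_arr, h]

theorem Frame.refl (p : Program) (s : Memory) : Frame p s s :=
  ⟨fun _ _ => rfl, fun _ _ => rfl, fun _ => rfl⟩

theorem Frame.trans {p : Program} {s s' s'' : Memory} (h : Frame p s s') (h' : Frame p s' s'') :
    Frame p s s'' :=
  ⟨fun v hv => (h'.reg v hv).trans (h.reg v hv), fun a ha => (h'.arr a ha).trans (h.arr a ha),
    fun hu => (h'.used hu).trans (h.used hu)⟩

theorem Frame.mono {p q : Program} {s s' : Memory} (h : Frame p s s') (h1 : p.regs ⊆ q.regs)
    (h2 : p.arrs ⊆ q.arrs) (h3 : q.tosses = false → p.tosses = false) : Frame q s s' :=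
  ⟨fun v hv => h.reg v fun hm => hv (h1 hm), fun a ha => h.arr a fun hm => ha (h2 hm),
    fun hu => h.used (h3 hu)⟩

theorem Exec.frame {ω : ℕ → Bool} {p : Program} {s s' : Memory} {t : ℕ} (h : Exec ω p s t s') :
    Frame p s s' := by
  induction h with
  | skip s => exact .refl _ _
  | setReg s v e =>
    exact ⟨fun v' hv => setReg_reg_of_ne _ _ (by simpa [Program.regs] using hv),
      fun _ _ => rfl, fun _ => rfl⟩
  | setArr s a i j e =>
    exact ⟨fun _ _ => rfl, fun a' ha => setArr_arr_of_ne _ _ _ _ (by simpa [Program.arrs] using ha),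
      fun _ => rfl⟩
  | toss s v =>
    exact ⟨fun v' hv => setReg_reg_of_ne _ _ (by simpa [Program.regs] using hv),
      fun _ _ => rfl, fun h => by simp [Program.tosses] at h⟩
  | seq _ _ ih₁ ih₂ =>
    refine (ih₁.mono ?_ ?_ ?_).trans (ih₂.mono ?_ ?_ ?_) <;>
      simp +contextual [Program.regs, Program.arrs, Program.tosses]
  | condTrue _ _ ih =>
    refine ih.mono ?_ ?_ ?_ <;> simp +contextual [Program.regs, Program.arrs, Program.tosses]
  | condFalse _ _ ih =>
    refine ih.mono ?_ ?_ ?_ <;> simp +contextual [Program.regs, Program.arrs, Program.tosses]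
  | loopTrue _ _ _ ih₁ ih₂ =>
    exact Frame.trans (p := .loop _ _) (ih₁.mono (fun _ h => h) (fun _ h => h) (fun h => h)) ih₂
  | loopFalse _ => exact .refl _ _

/-- Started in `s`, the program `p` halts within `c` steps in a memory with the property `Q`. -/
def Tri (ω : ℕ → Bool) (p : Program) (s : Memory) (c : ℕ) (Q : Memory → Prop) : Prop :=
  ∃ t s', Exec ω p s t s' ∧ t ≤ c ∧ Q s'

variable {ω : ℕ → Bool} {p q : Program} {s : Memory} {c c₁ c₂ : ℕ} {Q R : Memory → Prop}

theorem Tri.mono (h : Tri ω p s c₁ R) (hQ : ∀ s', Frame p s s' → R s' → Q s') (hc : c₁ ≤ c) :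
    Tri ω p s c Q := by
  obtain ⟨t, s', he, ht, hr⟩ := h
  exact ⟨t, s', he, ht.trans hc, hQ s' he.frame hr⟩

theorem tri_skip (h : Q s) (hc : 1 ≤ c) : Tri ω .skip s c Q := ⟨_, _, .skip s, hc, h⟩

theorem tri_setReg {v : ℕ} {e : NatExpr} (h : Q (s.setReg v (e.eval s))) (hc : e.cost + 1 ≤ c) :
    Tri ω (.setReg v e) s c Q := ⟨_, _, .setReg s v e, hc, h⟩

theorem tri_setArr {a : ℕ} {i j : NatExpr} {e : RealExpr}
    (h : Q (s.setArr a (i.eval s) (j.eval s) (e.eval s)))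
    (hc : i.cost + j.cost + e.cost + 1 ≤ c) : Tri ω (.setArr a i j e) s c Q :=
  ⟨_, _, .setArr s a i j e, hc, h⟩

theorem tri_toss {v : ℕ}
    (h : Q { s.setReg v (if ω s.used = true then 1 else 0) with used := s.used + 1 })
    (hc : 1 ≤ c) : Tri ω (.toss v) s c Q := ⟨_, _, .toss s v, hc, h⟩

/-- The continuation receives the frame condition of the first part. Untouched registers and arrays
can then be read off from the program text by `decide`, and intermediate assertions mention only
what has changed. -/
theorem tri_seq (h₁ : Tri ω p s c₁ R) (h₂ : ∀ s', Frame p s s' → R s' → Tri ω q s' c₂ Q)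
    (hc : c₁ + c₂ ≤ c) : Tri ω (.seq p q) s c Q := by
  obtain ⟨t, s', he, ht, hr⟩ := h₁
  obtain ⟨t', s'', he', ht', hq⟩ := h₂ s' he.frame hr
  exact ⟨_, _, .seq he he', by omega, hq⟩

theorem tri_cond {b : Test} (h₁ : b.Holds s → Tri ω p s c₁ Q) (h₂ : ¬ b.Holds s → Tri ω q s c₁ Q)
    (hc : b.cost + c₁ + 1 ≤ c) : Tri ω (.cond b p q) s c Q := by
  by_cases hb : b.Holds s
  · obtain ⟨t, s', he, ht, hq⟩ := h₁ hb
    exact ⟨_, _, .condTrue hb he, by omega, hq⟩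
  · obtain ⟨t, s', he, ht, hq⟩ := h₂ hb
    exact ⟨_, _, .condFalse hb he, by omega, hq⟩

/-- The rule for loops; `m` bounds the number of remaining iterations. -/
theorem tri_loop {b : Test} (m : Memory → ℕ) {I : Memory → Prop} (h0 : I s)
    (hstep : ∀ s', Frame (.loop b p) s s' → I s' → b.Holds s' →
      Tri ω p s' c₁ fun s'' => I s'' ∧ m s'' < m s')
    (hc : m s * (c₁ + b.cost + 1) + b.cost + 1 ≤ c) :
    Tri ω (.loop b p) s c fun s' => I s' ∧ ¬ b.Holds s' := by
  suffices H : ∀ k s', Frame (.loop b p) s s' → I s' → m s' ≤ k →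
      Tri ω (.loop b p) s' (k * (c₁ + b.cost + 1) + b.cost + 1) fun s'' => I s'' ∧ ¬ b.Holds s'' by
    exact (H _ s (.refl _ _) h0 le_rfl).mono (fun _ _ h => h) hc
  intro k
  induction k with
  | zero =>
    intro s' hf hI hk
    by_cases hb : b.Holds s'
    · obtain ⟨_, s'', _, _, _, hlt⟩ := hstep s' hf hI hb
      omega
    · exact ⟨_, _, .loopFalse hb, by omega, hI, hb⟩
  | succ k ih =>
    intro s' hf hI hk
    by_cases hb : b.Holds s'
    · obtain ⟨t, s'', he, ht, hI', hlt⟩ := hstep s' hf hI hb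
      have hf' : Frame (.loop b p) s' s'' :=
        he.frame.mono (fun _ h => h) (fun _ h => h) (fun h => h)
      obtain ⟨t', s₃, he', ht', hQ⟩ := ih s'' (hf.trans hf') hI' (by omega)
      exact ⟨_, _, .loopTrue hb he he', by rw [Nat.add_mul]; omega, hQ⟩
    · exact ⟨_, _, .loopFalse hb, by omega, hI, hb⟩

/-- `for i < b do p`, where `i` and `b` are registers. -/
def forLoop (i b : ℕ) (p : Program) : Program :=
  .seq (.setReg i (.lit 0)) (.loop (.natLt (.reg i) (.reg b))
    (.seq p (.setReg i (.add (.reg i) (.lit 1)))))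

/-- The invariant `I k` speaks of the memory in which the counter already holds k. Each iteration
costs 8 beyond the body: 4 for the increment, 3 for the test and 1 for the loop. -/
theorem tri_for {i b N : ℕ} {I : ℕ → Memory → Prop} (hi : i ∉ p.regs) (hb : b ∉ p.regs)
    (hib : b ≠ i) (hN : s.reg b = N) (h0 : I 0 (s.setReg i 0))
    (hstep : ∀ k < N, ∀ s', Frame (forLoop i b p) s s' → s'.reg i = k → I k s' →
      Tri ω p s' c₁ fun s'' => I (k + 1) (s''.setReg i (k + 1)))
    (hc : 6 + N * (c₁ + 8) ≤ c) : Tri ω (forLoop i b p) s c (I N) := by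
  have hfr : ∀ {s₁ s₂ : Memory}, Frame p s₁ s₂ → Frame (forLoop i b p) s₁ s₂ := fun h =>
    h.mono (by simp +contextual [forLoop, Program.regs, List.subset_def])
      (by simp [forLoop, Program.arrs]) (by simp [forLoop, Program.tosses])
  have hfs : ∀ (s₁ : Memory) (k : ℕ), Frame (forLoop i b p) s₁ (s₁.setReg i k) := fun s₁ k =>
    ⟨fun v hv => setReg_reg_of_ne _ _ (by simp [forLoop, Program.regs] at hv; tauto),
      fun _ _ => rfl, fun _ => rfl⟩
  refine tri_seq (c₁ := 2) (c₂ := 4 + N * (c₁ + 8)) (R := fun s' => s' = s.setReg i 0)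
    (tri_setReg (by simp [NatExpr.eval]) (by simp [NatExpr.cost])) ?_ (by omega)
  rintro s' - rfl
  let I' : Memory → Prop := fun s' => Frame (forLoop i b p) s s' ∧ s'.reg b = N ∧
    s'.reg i ≤ N ∧ I (s'.reg i) s'
  refine (tri_loop (m := fun s' => N - s'.reg i) (I := I') (c₁ := c₁ + 4)
    (c := 4 + N * (c₁ + 8)) ?_ ?_ ?_).mono ?_ le_rfl
  · exact ⟨hfs _ _, by rw [setReg_reg_of_ne _ _ hib, hN], by simp, by simpa using h0⟩
  · rintro s₁ - ⟨h1, h2, h3, h4⟩ hlt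
    simp only [Test.Holds, NatExpr.eval, h2] at hlt
    refine tri_seq (hstep _ hlt s₁ h1 rfl h4) (c₂ := 4) ?_ le_rfl
    intro s₂ hf₂ hI₂
    have e1 : s₂.reg i = s₁.reg i := hf₂.reg i hi
    have e2 : s₂.reg b = s₁.reg b := hf₂.reg b hb
    refine tri_setReg ?_ (by simp [NatExpr.cost])
    simp only [NatExpr.eval, e1, I', setReg_reg_self, setReg_reg_of_ne _ _ hib, e2]
    exact ⟨⟨(h1.trans (hfr hf₂)).trans (hfs _ _), h2, hlt, hI₂⟩, by omega⟩
  · simp only [setReg_reg_self, Test.cost, NatExpr.cost, Nat.sub_zero]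
    have : c₁ + 4 + (1 + 1 + 1) + 1 = c₁ + 8 := by ring
    rw [this]; omega
  · rintro s₁ - ⟨⟨-, h2, h3, h4⟩, hlt⟩
    simp only [Test.Holds, NatExpr.eval, h2, not_lt] at hlt
    rwa [le_antisymm h3 hlt] at h4

/-- The entry `(0, 0)` of the array `a`, used as a variable. -/
abbrev var (a : ℕ) : RealExpr := .get a (.lit 0) (.lit 0)

/-- Assignment to a variable. -/
abbrev assign (a : ℕ) (e : RealExpr) : Program := .setArr a (.lit 0) (.lit 0) e

/-- The entry of the array `a` whose position in row `0` is held by the register `i`. -/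
abbrev entry (a i : ℕ) : RealExpr := .get a (.lit 0) (.reg i)

theorem tri_assign {a : ℕ} {e : RealExpr} (h : Q (s.setArr a 0 0 (e.eval s)))
    (hc : e.cost + 3 ≤ c) : Tri ω (assign a e) s c Q :=
  tri_setArr h (by simp only [NatExpr.cost]; omega)

/-- Sum up in the variable `a` what the body adds to it. -/
def sumLoop (a i b : ℕ) (p : Program) : Program := .seq (assign a (.lit 0)) (forLoop i b p)

theorem tri_sumLoop {a i b N : ℕ} (f : ℕ → ℝ) (hi : i ∉ p.regs) (hb : b ∉ p.regs) (hib : b ≠ i)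
    (hN : s.reg b = N)
    (hstep : ∀ k < N, ∀ s', Frame (sumLoop a i b p) s s' → s'.reg i = k →
      Tri ω p s' c₁ fun s'' => s''.arr a 0 0 = s'.arr a 0 0 + f k)
    (hc : 10 + N * (c₁ + 8) ≤ c) :
    Tri ω (sumLoop a i b p) s c fun s' => s'.arr a 0 0 = ∑ k ∈ range N, f k := by
  refine tri_seq (c₁ := 4) (c₂ := 6 + N * (c₁ + 8)) (R := fun s' => s'.arr a 0 0 = 0)
    (tri_assign (by simp [RealExpr.eval]) (by simp [RealExpr.cost])) ?_ (by omega)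
  intro s' hf h0
  refine tri_for (I := fun k s' => s'.arr a 0 0 = ∑ k ∈ range k, f k) hi hb hib
    ((hf.reg b (by simp [Program.regs])).trans hN) (by simpa using h0) ?_ le_rfl
  intro k hk s'' hf' hik hI
  refine (hstep k hk s'' ((hf.mono ?_ ?_ ?_).trans (hf'.mono ?_ ?_ ?_)) hik).mono ?_ le_rfl
  · simp [sumLoop, Program.regs]
  · simp [sumLoop, Program.arrs]
  · simp +contextual [sumLoop, Program.tosses]
  · simp [sumLoop, Program.regs]
  · simp [sumLoop, Program.arrs]
  · simp +contextual [sumLoop, Program.tosses]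
  · intro s₃ _ h
    rw [setReg_arr, h, hI, sum_range_succ]

/-- Sum up an expression. -/
abbrev sumExpr (a i b : ℕ) (e : RealExpr) : Program := sumLoop a i b (assign a (.add (var a) e))

theorem tri_sumExpr {a i b N : ℕ} {e : RealExpr} (f : ℕ → ℝ) (hib : b ≠ i) (hN : s.reg b = N)
    (he : ∀ k < N, ∀ s', Frame (sumExpr a i b e) s s' → s'.reg i = k → e.eval s' = f k)
    (hc : 10 + N * (e.cost + 15) ≤ c) :
    Tri ω (sumExpr a i b e) s c fun s' => s'.arr a 0 0 = ∑ k ∈ range N, f k := by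
  refine tri_sumLoop (c₁ := e.cost + 7) f (by simp [Program.regs]) (by simp [Program.regs]) hib hN
    ?_ (by simpa [Nat.add_assoc] using hc)
  intro k hk s' hf hik
  refine tri_assign ?_ ?_
  · simp [RealExpr.eval, NatExpr.eval, he k hk s' hf hik]
  · simp only [RealExpr.cost, NatExpr.cost]; omega

/-- The k-th entry still has its original value when it is reached. This admits bodies that read the
row they overwrite, as in the updates of the direction and of the weights. -/
theorem tri_fillLoop {a i b N : ℕ} (f : ℕ → ℝ) (hi : i ∉ p.regs) (hb : b ∉ p.regs) (hib : b ≠ i)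
    (hN : s.reg b = N)
    (hstep : ∀ k < N, ∀ s', Frame (forLoop i b p) s s' → s'.reg i = k →
      s'.arr a 0 k = s.arr a 0 k →
      Tri ω p s' c₁ fun s'' => s''.arr a 0 k = f k ∧ ∀ k' ≠ k, s''.arr a 0 k' = s'.arr a 0 k')
    (hc : 6 + N * (c₁ + 8) ≤ c) :
    Tri ω (forLoop i b p) s c fun s' => ∀ k < N, s'.arr a 0 k = f k := by
  refine (tri_for (I := fun k s' => (∀ l < k, s'.arr a 0 l = f l) ∧
    ∀ l, k ≤ l → s'.arr a 0 l = s.arr a 0 l) hi hb hib hN (by simp) ?_ hc).mono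
      (fun _ _ h => h.1) le_rfl
  rintro k hk s' hf hik ⟨h1, h2⟩
  refine (hstep k hk s' hf hik (h2 k le_rfl)).mono ?_ le_rfl
  rintro s'' - ⟨h3, h4⟩
  simp only [setReg_arr]
  refine ⟨fun l hl => ?_, fun l hl => ?_⟩
  · rcases Nat.lt_succ_iff_lt_or_eq.mp hl with hl | rfl
    · rw [h4 l hl.ne, h1 l hl]
    · exact h3
  · rw [h4 l (by omega), h2 l (by omega)]

/-- Fill a row with the values of an expression. -/
abbrev fillExpr (a i b : ℕ) (e : RealExpr) : Program :=
  forLoop i b (.setArr a (.lit 0) (.reg i) e)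

theorem tri_fillExpr {a i b N : ℕ} {e : RealExpr} (f : ℕ → ℝ) (hib : b ≠ i) (hN : s.reg b = N)
    (he : ∀ k < N, ∀ s', Frame (fillExpr a i b e) s s' → s'.reg i = k →
      s'.arr a 0 k = s.arr a 0 k → e.eval s' = f k)
    (hc : 6 + N * (e.cost + 11) ≤ c) :
    Tri ω (fillExpr a i b e) s c fun s' => ∀ k < N, s'.arr a 0 k = f k := by
  refine tri_fillLoop (c₁ := e.cost + 3) f (by simp [Program.regs]) (by simp [Program.regs]) hib hN
    ?_ (by simpa [Nat.add_assoc] using hc)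
  intro k hk s' hf hik ha
  refine tri_setArr ?_ ?_
  · simp only [NatExpr.eval, hik, he k hk s' hf hik ha]
    exact ⟨by simp, fun k' hk' => by simp [setArr_arr, hk']⟩
  · simp only [NatExpr.cost]; omega

end RealRAM

namespace RobustMean

open Matrix Finset RealRAM

variable {n d : ℕ}

/-! ### The program

Registers: `0, 1` hold `n, d`; `2, 3, 4` hold the numbers `L, J, T` of iterations; `5, 6, 7, 8, 14`
are loop counters; `9, 10, 11` are used in the search for a rough center; `12` holds a coin.

Arrays: `3, 9` hold the candidates for a rough center and their weights, `4` the centered points, `5`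
their weights, `6` the direction, `7` the projections, `8` their scores; the other arrays hold single
numbers. -/

section Round

variable {ω : ℕ → Bool} {s : Memory} {X : Fin n → Fin d → ℝ} {w : Fin n → ℝ} {v : Fin d → ℝ}

/-- Compute the projections of the points to the direction. -/
def projProgram : Program :=
  forLoop 5 0 (.seq (sumExpr 13 6 1 (.mul (.get 4 (.reg 5) (.reg 6)) (entry 6 6)))
    (.setArr 7 (.lit 0) (.reg 5) (var 13)))

theorem tri_proj (hn : s.reg 0 = n) (hd : s.reg 1 = d) (hd0 : 0 < d) (hn0 : 0 < n)
    (hX : ∀ i : Fin n, ∀ j : Fin d, s.arr 4 i j = X i j) (hv : ∀ j : Fin d, s.arr 6 0 j = v j) :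
    Tri ω projProgram s (60 * (n * d)) fun s' => ∀ i : Fin n, s'.arr 7 0 i = X i ⬝ᵥ v := by
  have h1 : n ≤ n * d := Nat.le_mul_of_pos_right _ hd0
  have h2 : 1 ≤ n * d := Nat.mul_pos hn0 hd0
  refine (tri_fillLoop (a := 7) (N := n) (c₁ := 10 + d * 22 + 6)
    (fun k => ∑ j ∈ range d, s.arr 4 k j * s.arr 6 0 j) (by decide) (by decide) (by decide) hn
    ?_ (by linarith)).mono ?_ le_rfl
  · intro k hk s₁ hf hik _
    refine tri_seq (tri_sumExpr (N := d) (fun j => s.arr 4 k j * s.arr 6 0 j) (by decide)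
      ((hf.reg 1 (by decide)).trans hd) ?_ (by simp only [RealExpr.cost, NatExpr.cost]; exact le_rfl))
      (c₂ := 6) ?_ le_rfl
    · intro j hj s₂ hf₂ hij
      simp only [RealExpr.eval, NatExpr.eval, hij, hf₂.reg 5 (by decide), hik,
        hf₂.arr 4 (by decide), hf₂.arr 6 (by decide), hf.arr 4 (by decide), hf.arr 6 (by decide)]
    · intro s₂ hf₂ hs₂
      refine tri_setArr ?_ (by simp only [RealExpr.cost, NatExpr.cost]; norm_num)
      simp only [RealExpr.eval, NatExpr.eval, hf₂.reg 5 (by decide), hik, setArr_arr_self, hs₂,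
        true_and]
      intro k' hk'
      simp [setArr_arr, hk', hf₂.arr 7 (by decide)]
  · intro s' _ h i
    rw [h i i.2, sum_range]
    simp only [hX, hv, dotProduct]

/-- Replace the direction by its product with the covariance. -/
def covProgram : Program :=
  .seq (sumExpr 14 5 0 (entry 5 5)) (.seq projProgram
    (.seq (sumExpr 15 5 0 (.mul (entry 5 5) (entry 7 5)))
      (forLoop 6 1 (.seq
        (sumExpr 16 5 0 (.mul (.mul (entry 5 5) (entry 7 5)) (.get 4 (.reg 5) (.reg 6))))
        (.seq (sumExpr 17 5 0 (.mul (entry 5 5) (.get 4 (.reg 5) (.reg 6))))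
          (.setArr 6 (.lit 0) (.reg 6)
            (.sub (.div (.sub (.mul (var 14) (var 16)) (.mul (var 17) (var 15)))
              (.mul (.ofNat (.reg 0)) (.ofNat (.reg 0))))
              (.mul (.sub (.lit 1) (.mul (.lit 5) (var 12))) (entry 6 6)))))))))

/-- The covariance matrix is never formed: its product with a vector needs only the projections and
weighted sums of the points, hence time O(nd). -/
theorem tri_cov {lam : ℝ} (hn : s.reg 0 = n) (hd : s.reg 1 = d) (hd0 : 0 < d) (hn0 : 0 < n)
    (hX : ∀ i : Fin n, ∀ j : Fin d, s.arr 4 i j = X i j) (hw : ∀ i : Fin n, s.arr 5 0 i = w i)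
    (hl : s.arr 12 0 0 = lam) (hv : ∀ j : Fin d, s.arr 6 0 j = v j) :
    Tri ω covProgram s (300 * (n * d)) fun s' => ∀ j : Fin d,
      s'.arr 6 0 j = covMul X (1 - 5 * lam) w v j := by
  have h1 : n ≤ n * d := Nat.le_mul_of_pos_right _ hd0
  have h2 : 1 ≤ n * d := Nat.mul_pos hn0 hd0
  have h3 : d ≤ n * d := Nat.le_mul_of_pos_left _ hn0
  refine tri_seq (tri_sumExpr (N := n) (fun i => s.arr 5 0 i) (by decide) hn ?_
    (by simp only [RealExpr.cost, NatExpr.cost]; exact le_rfl)) (c₂ := 270 * (n * d)) ?_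
      (by linarith)
  · intro i hi s₁ hf hik
    simp only [RealExpr.eval, NatExpr.eval, hik, hf.arr 5 (by decide)]
  intro s₁ f₁ e₁
  refine tri_seq (tri_proj (X := X) (v := v) ((f₁.reg 0 (by decide)).trans hn)
    ((f₁.reg 1 (by decide)).trans hd) hd0 hn0 (by rwa [f₁.arr 4 (by decide)])
    (by rwa [f₁.arr 6 (by decide)])) (c₂ := 210 * (n * d)) ?_ (by linarith)
  intro s₂ f₂ e₂
  refine tri_seq (tri_sumExpr (N := n) (fun i => s.arr 5 0 i * s₂.arr 7 0 i) (by decide)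
    (by rw [f₂.reg 0 (by decide), f₁.reg 0 (by decide), hn]) ?_
    (by simp only [RealExpr.cost, NatExpr.cost]; exact le_rfl)) (c₂ := 170 * (n * d)) ?_
      (by linarith)
  · intro i hi s₁ hf hik
    simp only [RealExpr.eval, NatExpr.eval, hik, hf.arr 5 (by decide), hf.arr 7 (by decide),
      f₂.arr 5 (by decide), f₁.arr 5 (by decide)]
  intro s₃ f₃ e₃
  have g5 : s₃.arr 5 = s.arr 5 := by
    rw [f₃.arr 5 (by decide), f₂.arr 5 (by decide), f₁.arr 5 (by decide)]
  have g4 : s₃.arr 4 = s.arr 4 := by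
    rw [f₃.arr 4 (by decide), f₂.arr 4 (by decide), f₁.arr 4 (by decide)]
  have g6 : s₃.arr 6 = s.arr 6 := by
    rw [f₃.arr 6 (by decide), f₂.arr 6 (by decide), f₁.arr 6 (by decide)]
  have g7 : s₃.arr 7 = s₂.arr 7 := f₃.arr 7 (by decide)
  have g12 : s₃.arr 12 0 0 = lam := by
    rw [f₃.arr 12 (by decide), f₂.arr 12 (by decide), f₁.arr 12 (by decide), hl]
  have g14 : s₃.arr 14 0 0 = ∑ i, w i := by
    rw [f₃.arr 14 (by decide), f₂.arr 14 (by decide), e₁, sum_range]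
    simp only [hw]
  have g15 : s₃.arr 15 0 0 = ∑ i, w i * (X i ⬝ᵥ v) := by
    rw [e₃, sum_range]
    simp only [hw, e₂]
  have g0 : s₃.reg 0 = n := by
    rw [f₃.reg 0 (by decide), f₂.reg 0 (by decide), f₁.reg 0 (by decide), hn]
  have g1 : s₃.reg 1 = d := by
    rw [f₃.reg 1 (by decide), f₂.reg 1 (by decide), f₁.reg 1 (by decide), hd]
  refine (tri_fillLoop (a := 6) (N := d) (c₁ := 70 + n * 52)
    (fun j => ((∑ i, w i) * (∑ i : Fin n, w i * (X i ⬝ᵥ v) * s.arr 4 i j) -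
      (∑ i : Fin n, w i * s.arr 4 i j) * ∑ i, w i * (X i ⬝ᵥ v)) / n ^ 2 -
        (1 - 5 * lam) * s.arr 6 0 j) (by decide) (by decide) (by decide) g1
    ?_ (by linarith)).mono ?_ le_rfl
  · intro j hj s₄ f₄ hij h6
    refine tri_seq (tri_sumExpr (N := n) (fun i => s.arr 5 0 i * s₂.arr 7 0 i * s.arr 4 i j)
      (by decide) ((f₄.reg 0 (by decide)).trans g0) ?_
      (by simp only [RealExpr.cost, NatExpr.cost]; exact le_rfl)) (c₂ := 60 + n * 26) ?_
        (by linarith)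
    · intro i hi s₅ f₅ hii
      simp only [RealExpr.eval, NatExpr.eval, hii, f₅.arr 5 (by decide), f₅.arr 7 (by decide),
        f₅.arr 4 (by decide), f₄.arr 5 (by decide), f₄.arr 7 (by decide), f₄.arr 4 (by decide),
        f₅.reg 6 (by decide), hij, g5, g7, g4]
    intro s₅ f₅ e₅
    refine tri_seq (tri_sumExpr (N := n) (fun i => s.arr 5 0 i * s.arr 4 i j)
      (by decide) ((f₅.reg 0 (by decide)).trans ((f₄.reg 0 (by decide)).trans g0)) ?_
      (by simp only [RealExpr.cost, NatExpr.cost]; exact le_rfl)) (c₂ := 40) ?_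
        (by linarith)
    · intro i hi s₆ f₆ hii
      simp only [RealExpr.eval, NatExpr.eval, hii, f₆.arr 5 (by decide),
        f₆.arr 4 (by decide), f₅.arr 5 (by decide), f₅.arr 4 (by decide), f₄.arr 5 (by decide),
        f₄.arr 4 (by decide), f₆.reg 6 (by decide), f₅.reg 6 (by decide), hij, g5, g4]
    intro s₆ f₆ e₆
    refine tri_setArr ?_ (by simp only [RealExpr.cost, NatExpr.cost]; norm_num)
    have k6 : s₆.reg 6 = j := by rw [f₆.reg 6 (by decide), f₅.reg 6 (by decide), hij]
    have k0 : s₆.reg 0 = n := by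
      rw [f₆.reg 0 (by decide), f₅.reg 0 (by decide), f₄.reg 0 (by decide), g0]
    have k14 : s₆.arr 14 0 0 = ∑ i, w i := by
      rw [f₆.arr 14 (by decide), f₅.arr 14 (by decide), f₄.arr 14 (by decide), g14]
    have k15 : s₆.arr 15 0 0 = ∑ i, w i * (X i ⬝ᵥ v) := by
      rw [f₆.arr 15 (by decide), f₅.arr 15 (by decide), f₄.arr 15 (by decide), g15]
    have k12 : s₆.arr 12 0 0 = lam := by
      rw [f₆.arr 12 (by decide), f₅.arr 12 (by decide), f₄.arr 12 (by decide), g12]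
    have k16 : s₆.arr 16 0 0 = ∑ i : Fin n, w i * (X i ⬝ᵥ v) * s.arr 4 i j := by
      rw [f₆.arr 16 (by decide), e₅, sum_range]
      simp only [hw, e₂]
    have k17 : s₆.arr 17 0 0 = ∑ i : Fin n, w i * s.arr 4 i j := by
      rw [e₆, sum_range]
      simp only [hw]
    have k66 : s₆.arr 6 0 j = s.arr 6 0 j := by
      rw [f₆.arr 6 (by decide), f₅.arr 6 (by decide), h6, g6]
    simp only [RealExpr.eval, NatExpr.eval, k6, k0, k14, k15, k12, k16, k17, k66, setArr_arr_self]
    refine ⟨by push_cast; ring, fun k' hk' => ?_⟩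
    simp [setArr_arr, hk', f₆.arr 6 (by decide), f₅.arr 6 (by decide)]
  · intro s' _ h j
    rw [h j j.2, covMul]
    simp only [hX, hv]

/-- Toss a coin for the sign of each entry of the direction. -/
def tossProgram : Program :=
  forLoop 6 1 (.seq (.toss 12) (.setArr 6 (.lit 0) (.reg 6)
    (.sub (.mul (.lit 2) (.ofNat (.reg 12))) (.lit 1))))

theorem tri_toss_signs (hd : s.reg 1 = d) (hd0 : 0 < d) :
    Tri ω tossProgram s (30 * d) fun s' => s'.used = s.used + d ∧
      ∀ j : Fin d, s'.arr 6 0 j = signs (fun j : Fin d => ω (s.used + j)) j := by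
  refine (tri_for (I := fun k s' => s'.used = s.used + k ∧ ∀ l < k, s'.arr 6 0 l =
    if ω (s.used + l) then 1 else -1) (N := d) (c₁ := 10) (by decide) (by decide) (by decide) hd
    (by simp) ?_ (by linarith)).mono ?_ le_rfl
  · rintro k hk s₁ f₁ hik ⟨h1, h2⟩
    refine tri_seq (R := fun s' => s'.used = s₁.used + 1 ∧
      s'.reg 12 = (if ω s₁.used = true then 1 else 0) ∧ s'.arr = s₁.arr)
      (tri_toss ⟨rfl, by simp, rfl⟩ le_rfl) (c₂ := 9) ?_ le_rfl
    rintro s₂ f₂ ⟨h3, h4, h5⟩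
    refine tri_setArr ?_ (by simp only [RealExpr.cost, NatExpr.cost]; norm_num)
    simp only [RealExpr.eval, NatExpr.eval, f₂.reg 6 (by decide), hik, h4, h1, setReg_arr,
      setReg_used, setArr_used, h3]
    refine ⟨by ring, fun l hl => ?_⟩
    rcases Nat.lt_succ_iff_lt_or_eq.mp hl with hl | rfl
    · rw [setArr_arr, if_neg (by omega), h5, h2 l hl]
    · rw [setArr_arr_self]
      split_ifs <;> norm_num
  · rintro s' - ⟨h1, h2⟩
    exact ⟨h1, fun j => h2 j j.2⟩

/-- Power iteration. -/
def powerProgram : Program := forLoop 14 3 covProgram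

theorem tri_power {lam : ℝ} {J : ℕ} (hn : s.reg 0 = n) (hd : s.reg 1 = d) (hd0 : 0 < d)
    (hn0 : 0 < n) (hJ : s.reg 3 = J) (hX : ∀ i : Fin n, ∀ j : Fin d, s.arr 4 i j = X i j)
    (hw : ∀ i : Fin n, s.arr 5 0 i = w i) (hl : s.arr 12 0 0 = lam)
    (hv : ∀ j : Fin d, s.arr 6 0 j = v j) :
    Tri ω powerProgram s (6 + J * (300 * (n * d) + 8)) fun s' => ∀ j : Fin d,
      s'.arr 6 0 j = (covMul X (1 - 5 * lam) w)^[J] v j := by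
  refine tri_for (I := fun k s' => ∀ j : Fin d,
      s'.arr 6 0 j = (covMul X (1 - 5 * lam) w)^[k] v j) (by decide) (by decide) (by decide) hJ
    hv ?_ le_rfl
  intro k hk s₁ f₁ _ hI
  refine (tri_cov (X := X) (w := w) (lam := lam) ((f₁.reg 0 (by decide)).trans hn)
    ((f₁.reg 1 (by decide)).trans hd) hd0 hn0 (by rwa [f₁.arr 4 (by decide)])
    (by rwa [f₁.arr 5 (by decide)]) (by rwa [f₁.arr 12 (by decide)]) hI).mono ?_ le_rfl
  intro s' _ h j
  rw [setReg_arr, h j, Function.iterate_succ_apply']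

/-- Count the indices of points for which the test `b` holds. -/
def countProgram (b : Test) : Program :=
  sumLoop 23 5 0 (.cond b (assign 23 (.add (var 23) (.lit 1))) .skip)

theorem tri_count {b : Test} (P : ℕ → Prop) [DecidablePred P] (hn : s.reg 0 = n)
    (hb : ∀ k < n, ∀ s', Frame (countProgram b) s s' → s'.reg 5 = k → (b.Holds s' ↔ P k)) :
    Tri ω (countProgram b) s (10 + n * (b.cost + 17)) fun s' =>
      s'.arr 23 0 0 = count fun i : Fin n => P i := by
  refine (tri_sumLoop (c₁ := b.cost + 9) (N := n) (fun k => if P k then 1 else 0)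
    (by simp [Program.regs]) (by simp [Program.regs]) (by decide) hn ?_
    (by simp [Nat.add_assoc])).mono ?_ le_rfl
  · intro k hk s₁ f₁ hik
    refine tri_cond (c₁ := 8) (fun h => ?_) (fun h => ?_) le_rfl
    · refine tri_assign ?_ (by simp only [RealExpr.cost, NatExpr.cost]; norm_num)
      simp [RealExpr.eval, NatExpr.eval, (hb k hk s₁ f₁ hik).mp h]
    · refine tri_skip ?_ (by norm_num)
      simp [mt (hb k hk s₁ f₁ hik).mpr h]
  · intro s' _ h
    rw [h, sum_range, count]

/-- Bisection for an approximate median. -/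
def bisectProgram : Program :=
  forLoop 14 3 (.seq (assign 22 (.div (.add (var 20) (var 21)) (.lit 2)))
    (.seq (countProgram (.realLt (entry 7 5) (var 22)))
      (.cond (.realLt (.mul (.lit 2) (var 23)) (.ofNat (.reg 0)))
        (assign 20 (var 22)) (assign 21 (var 22)))))

theorem tri_bisect {π : Fin n → ℝ} {lo hi : ℝ} {J : ℕ} (hn : s.reg 0 = n) (hn0 : 0 < n)
    (hJ : s.reg 3 = J) (hπ : ∀ i : Fin n, s.arr 7 0 i = π i)
    (hlo : s.arr 20 0 0 = lo) (hhi : s.arr 21 0 0 = hi) :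
    Tri ω bisectProgram s (6 + J * (80 * n)) fun s' =>
      s'.arr 20 0 0 = ((bisectStep π)^[J] (lo, hi)).1 := by
  refine (tri_for (I := fun k s' => s'.arr 20 0 0 = ((bisectStep π)^[k] (lo, hi)).1 ∧
      s'.arr 21 0 0 = ((bisectStep π)^[k] (lo, hi)).2) (c₁ := 72 * n) (N := J)
    (by decide) (by decide) (by decide) hJ ⟨hlo, hhi⟩ ?_
    (Nat.add_le_add_left (Nat.mul_le_mul_left _ (by omega)) 6)).mono (fun _ _ h => h.1) le_rfl
  rintro k hk s₁ f₁ - ⟨h1, h2⟩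
  set q := (bisectStep π)^[k] (lo, hi) with hq
  refine tri_seq (R := fun s' => s'.arr 22 0 0 = (q.1 + q.2) / 2) (c₁ := 12)
    (tri_assign ?_ (by simp only [RealExpr.cost, NatExpr.cost]; norm_num))
    (c₂ := 30 + n * 24) ?_ (by linarith)
  · simp [RealExpr.eval, NatExpr.eval, h1, h2]
  intro s₂ f₂ e₂
  refine tri_seq (tri_count (n := n) (fun k => s.arr 7 0 k < (q.1 + q.2) / 2)
    (by rw [f₂.reg 0 (by decide), f₁.reg 0 (by decide), hn]) ?_) (c₂ := 20) ?_
    (by simp only [Test.cost, RealExpr.cost, NatExpr.cost]; linarith)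
  · intro i hi' s₃ f₃ hik
    simp only [Test.Holds, RealExpr.eval, NatExpr.eval, hik, f₃.arr 7 (by decide),
      f₂.arr 7 (by decide), f₁.arr 7 (by decide), f₃.arr 22 (by decide), e₂]
  intro s₃ f₃ e₃
  have k0 : s₃.reg 0 = n := by
    rw [f₃.reg 0 (by decide), f₂.reg 0 (by decide), f₁.reg 0 (by decide), hn]
  have k22 : s₃.arr 22 0 0 = (q.1 + q.2) / 2 := by rw [f₃.arr 22 (by decide), e₂]
  have k20 : s₃.arr 20 0 0 = q.1 := by rw [f₃.arr 20 (by decide), f₂.arr 20 (by decide), h1]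
  have k21 : s₃.arr 21 0 0 = q.2 := by rw [f₃.arr 21 (by decide), f₂.arr 21 (by decide), h2]
  simp only [hπ] at e₃
  rw [Function.iterate_succ_apply', ← hq]
  refine tri_cond (c₁ := 6) (fun h => ?_) (fun h => ?_)
    (by simp only [Test.cost, RealExpr.cost, NatExpr.cost]; norm_num) <;>
  · simp only [Test.Holds, RealExpr.eval, NatExpr.eval, k0, e₃, Rat.cast_ofNat] at h
    refine tri_assign ?_ (by simp only [RealExpr.cost, NatExpr.cost]; norm_num)
    simp only [bisectStep, h, if_true, if_false, RealExpr.eval, NatExpr.eval, k22, setReg_arr,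
      setArr_arr_self, setArr_arr_of_ne _ _ _ _ (by decide : 21 ≠ 20),
      setArr_arr_of_ne _ _ _ _ (by decide : 20 ≠ 21), k20, k21, and_self]

/-- Search for the threshold for the scores. -/
def thresholdProgram : Program :=
  forLoop 14 3 (.seq (countProgram (.realLt (var 24) (entry 8 5)))
    (.cond (.realLt (.mul (.mul (.lit 2) (.get 1 (.lit 0) (.lit 0))) (.ofNat (.reg 0))) (var 23))
      (assign 24 (.mul (.lit 2) (var 24))) .skip))

theorem tri_threshold {f : Fin n → ℝ} {θ ε : ℝ} {J : ℕ} (hn : s.reg 0 = n) (hn0 : 0 < n)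
    (hJ : s.reg 3 = J) (hf : ∀ i : Fin n, s.arr 8 0 i = f i)
    (hε : s.arr 1 0 0 = ε) (hθ : s.arr 24 0 0 = θ) :
    Tri ω thresholdProgram s (6 + J * (80 * n)) fun s' =>
      s'.arr 24 0 0 = (thresholdStep f (2 * ε * n))^[J] θ := by
  refine tri_for (I := fun k s' => s'.arr 24 0 0 = (thresholdStep f (2 * ε * n))^[k] θ)
    (c₁ := 72 * n) (N := J) (by decide) (by decide) (by decide) hJ hθ ?_
    (Nat.add_le_add_left (Nat.mul_le_mul_left _ (by omega)) 6)
  rintro k hk s₁ f₁ - h1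
  set q := (thresholdStep f (2 * ε * n))^[k] θ with hq
  refine tri_seq (tri_count (n := n) (fun k => q < s.arr 8 0 k)
    (by rw [f₁.reg 0 (by decide), hn]) ?_) (c₂ := 30) ?_
    (by simp only [Test.cost, RealExpr.cost, NatExpr.cost]; linarith)
  · intro i hi' s₃ f₃ hik
    simp only [Test.Holds, RealExpr.eval, NatExpr.eval, hik, f₃.arr 8 (by decide),
      f₁.arr 8 (by decide), f₃.arr 24 (by decide), h1]
  intro s₃ f₃ e₃
  have k0 : s₃.reg 0 = n := by rw [f₃.reg 0 (by decide), f₁.reg 0 (by decide), hn]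
  have k24 : s₃.arr 24 0 0 = q := by rw [f₃.arr 24 (by decide), h1]
  have k1 : s₃.arr 1 0 0 = ε := by rw [f₃.arr 1 (by decide), f₁.arr 1 (by decide), hε]
  simp only [hf] at e₃
  rw [Function.iterate_succ_apply', ← hq]
  refine tri_cond (c₁ := 9) (fun h => ?_) (fun h => ?_)
    (by simp only [Test.cost, RealExpr.cost, NatExpr.cost]; norm_num)
  · simp only [Test.Holds, RealExpr.eval, NatExpr.eval, k0, k1, e₃, Rat.cast_ofNat] at h
    refine tri_assign ?_ (by simp only [RealExpr.cost, NatExpr.cost]; norm_num)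
    simp only [thresholdStep, h, if_true, RealExpr.eval, NatExpr.eval, k24, setReg_arr,
      setArr_arr_self, Rat.cast_ofNat]
  · simp only [Test.Holds, RealExpr.eval, NatExpr.eval, k0, k1, e₃, Rat.cast_ofNat] at h
    refine tri_skip ?_ (by norm_num)
    simp only [thresholdStep, h, if_false, setReg_arr, k24]

/-- Search for the rate at which the weights are decreased. -/
def rateProgram : Program :=
  forLoop 14 3 (.seq (sumExpr 28 5 0 (.div (.mul (entry 5 5) (entry 8 5))
      (.add (.lit 1) (.mul (var 27) (entry 8 5)))))
    (.cond (.realLt (.mul (.lit 4) (var 25)) (var 28))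
      (assign 27 (.add (.mul (.lit 2) (var 27)) (var 26))) .skip))

theorem tri_rate {τ : Fin n → ℝ} {t t₀ T₀ : ℝ} {J : ℕ} (hn : s.reg 0 = n) (hn0 : 0 < n)
    (hJ : s.reg 3 = J) (hw : ∀ i : Fin n, s.arr 5 0 i = w i) (hτ : ∀ i : Fin n, s.arr 8 0 i = τ i)
    (ht : s.arr 27 0 0 = t) (ht₀ : s.arr 26 0 0 = t₀) (hT₀ : s.arr 25 0 0 = T₀) :
    Tri ω rateProgram s (6 + J * (90 * n)) fun s' =>
      s'.arr 27 0 0 = (rateStep w τ t₀ T₀)^[J] t := by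
  refine tri_for (I := fun k s' => s'.arr 27 0 0 = (rateStep w τ t₀ T₀)^[k] t)
    (c₁ := 82 * n) (N := J) (by decide) (by decide) (by decide) hJ ht ?_
    (Nat.add_le_add_left (Nat.mul_le_mul_left _ (by omega)) 6)
  rintro k hk s₁ f₁ - h1
  set q := (rateStep w τ t₀ T₀)^[k] t with hq
  refine tri_seq (tri_sumExpr (N := n)
    (fun i => s.arr 5 0 i * s.arr 8 0 i / (1 + q * s.arr 8 0 i)) (by decide)
    (by rw [f₁.reg 0 (by decide), hn]) ?_
    (by simp only [RealExpr.cost, NatExpr.cost]; exact le_rfl)) (c₂ := 32) ?_ (by linarith)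
  · intro i hi' s₃ f₃ hik
    simp only [RealExpr.eval, NatExpr.eval, hik, f₃.arr 8 (by decide), f₃.arr 5 (by decide),
      f₁.arr 8 (by decide), f₁.arr 5 (by decide), f₃.arr 27 (by decide), h1, Rat.cast_one]
  intro s₃ f₃ e₃
  have k27 : s₃.arr 27 0 0 = q := by rw [f₃.arr 27 (by decide), h1]
  have k26 : s₃.arr 26 0 0 = t₀ := by rw [f₃.arr 26 (by decide), f₁.arr 26 (by decide), ht₀]
  have k25 : s₃.arr 25 0 0 = T₀ := by rw [f₃.arr 25 (by decide), f₁.arr 25 (by decide), hT₀]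
  have k28 : s₃.arr 28 0 0 = softMass w τ q := by
    rw [e₃, sum_range]; simp only [hw, hτ, softMass]
  rw [Function.iterate_succ_apply', ← hq]
  refine tri_cond (c₁ := 14) (fun h => ?_) (fun h => ?_)
    (by simp only [Test.cost, RealExpr.cost, NatExpr.cost]; norm_num)
  · simp only [Test.Holds, RealExpr.eval, NatExpr.eval, k25, k28, Rat.cast_ofNat] at h
    refine tri_assign ?_ (by simp only [RealExpr.cost, NatExpr.cost]; norm_num)
    simp only [rateStep, h, if_true, RealExpr.eval, NatExpr.eval, k27, k26, setReg_arr,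
      setArr_arr_self, Rat.cast_ofNat]
  · simp only [Test.Holds, RealExpr.eval, NatExpr.eval, k25, k28, Rat.cast_ofNat] at h
    refine tri_skip ?_ (by norm_num)
    simp only [rateStep, h, if_false, setReg_arr, k27]

/-- Decrease the weights of the points with large scores. -/
def filterProgram : Program :=
  .seq (sumExpr 18 6 1 (.mul (entry 6 6) (entry 6 6)))
  (.seq (sumLoop 19 6 1 (.cond (.realLt (entry 6 6) (.lit 0))
    (assign 19 (.sub (var 19) (entry 6 6))) (assign 19 (.add (var 19) (entry 6 6)))))
  (.seq (assign 19 (.mul (var 11) (var 19)))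
  (.seq projProgram
  (.seq (assign 20 (.sub (.lit 0) (var 19)))
  (.seq (assign 21 (var 19))
  (.seq bisectProgram
  (.seq (fillExpr 8 5 0 (.mul (.sub (entry 7 5) (var 20)) (.sub (entry 7 5) (var 20))))
  (.seq (assign 24 (.mul (.add (.lit 1) (var 12)) (var 18)))
  (.seq thresholdProgram
  (.seq (forLoop 5 0 (.cond (.realLt (var 24) (entry 8 5)) .skip
    (.setArr 8 (.lit 0) (.reg 5) (.lit 0))))
  (.seq (assign 25 (.mul (.mul (.mul (.lit 200) (var 12)) (.ofNat (.reg 0))) (var 18)))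
  (.seq (assign 26 (.div (.lit 1) (.mul (.lit 4) (.mul (var 19) (var 19)))))
  (.seq (assign 27 (.lit 0))
  (.seq rateProgram
  (fillExpr 5 5 0 (.div (entry 5 5) (.add (.lit 1) (.mul (var 27) (entry 8 5)))))))))))))))))))

/-- The part proportional to J comes from the three searches, for the median, the threshold and the
rate, which cost 80 + 80 + 90 = 250 units per step and point. -/
theorem tri_filter {ε lam ρ : ℝ} {J : ℕ} (hn : s.reg 0 = n) (hd : s.reg 1 = d) (hd0 : 0 < d)
    (hn0 : 0 < n) (hJ : s.reg 3 = J) (hX : ∀ i : Fin n, ∀ j : Fin d, s.arr 4 i j = X i j)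
    (hw : ∀ i : Fin n, s.arr 5 0 i = w i) (hv : ∀ j : Fin d, s.arr 6 0 j = v j)
    (hε : s.arr 1 0 0 = ε) (hl : s.arr 12 0 0 = lam) (hρ : s.arr 11 0 0 = ρ) :
    Tri ω filterProgram s (500 * (n * d) + J * (250 * (n * d))) fun s' => ∀ i : Fin n,
      s'.arr 5 0 i = filterWeights X ε lam ρ J w v i := by
  have c1 : n ≤ n * d := Nat.le_mul_of_pos_right _ hd0
  have c2 : 1 ≤ n * d := Nat.mul_pos hn0 hd0
  have c3 : d ≤ n * d := Nat.le_mul_of_pos_left _ hn0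
  have c4 : J * n ≤ J * (n * d) := Nat.mul_le_mul_left _ c1
  refine tri_seq (tri_sumExpr (N := d) (fun j => s.arr 6 0 j * s.arr 6 0 j) (by decide) hd ?_
    (by simp only [RealExpr.cost, NatExpr.cost]; exact le_rfl))
    (c₂ := 460 * (n * d) + J * (250 * (n * d))) ?_ (by linarith)
  · intro j hj s₁ f₁ hij
    simp only [RealExpr.eval, NatExpr.eval, hij, f₁.arr 6 (by decide)]
  intro s₁ f₁ e₁
  refine tri_seq (tri_sumLoop (N := d) (c₁ := 20) (fun j => |s.arr 6 0 j|) (by decide) (by decide)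
    (by decide) (by rw [f₁.reg 1 (by decide), hd]) ?_ le_rfl)
    (c₂ := 420 * (n * d) + J * (250 * (n * d))) ?_ (by linarith)
  · intro j hj s₂ f₂ hij
    have k6 : s₂.arr 6 0 j = s.arr 6 0 j := by rw [f₂.arr 6 (by decide), f₁.arr 6 (by decide)]
    refine tri_cond (c₁ := 12) (fun h => ?_) (fun h => ?_)
      (by simp only [Test.cost, RealExpr.cost, NatExpr.cost]; norm_num) <;>
    · simp only [Test.Holds, RealExpr.eval, NatExpr.eval, hij, k6, Rat.cast_zero] at h
      refine tri_assign ?_ (by simp only [RealExpr.cost, NatExpr.cost]; norm_num)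
      simp only [RealExpr.eval, NatExpr.eval, hij, k6, setArr_arr_self]
      first
        | rw [abs_of_neg h]; ring
        | rw [abs_of_nonneg (not_lt.mp h)]
  intro s₂ f₂ e₂
  set H := ρ * ∑ j, |v j| with hH
  refine tri_seq (R := fun s' => s'.arr 19 0 0 = H) (c₁ := 10)
    (tri_assign ?_ (by simp only [RealExpr.cost, NatExpr.cost]; norm_num))
    (c₂ := 410 * (n * d) + J * (250 * (n * d))) ?_ (by linarith)
  · simp only [RealExpr.eval, NatExpr.eval, setArr_arr_self, e₂, f₂.arr 11 (by decide),
      f₁.arr 11 (by decide), hρ]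
    rw [sum_range, hH]
    simp only [hv]
  intro s₃ f₃ e₃
  refine tri_seq (tri_proj (X := X) (v := v)
    (by rw [f₃.reg 0 (by decide), f₂.reg 0 (by decide), f₁.reg 0 (by decide), hn])
    (by rw [f₃.reg 1 (by decide), f₂.reg 1 (by decide), f₁.reg 1 (by decide), hd]) hd0 hn0
    (by rwa [f₃.arr 4 (by decide), f₂.arr 4 (by decide), f₁.arr 4 (by decide)])
    (by rwa [f₃.arr 6 (by decide), f₂.arr 6 (by decide), f₁.arr 6 (by decide)]))
    (c₂ := 340 * (n * d) + J * (250 * (n * d))) ?_ (by linarith)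
  intro s₄ f₄ e₄
  have F₄ : Frame filterProgram s s₄ := by
    refine (f₁.mono ?_ ?_ ?_).trans ((f₂.mono ?_ ?_ ?_).trans ((f₃.mono ?_ ?_ ?_).trans
      (f₄.mono ?_ ?_ ?_))) <;> decide
  have k18 : s₄.arr 18 0 0 = v ⬝ᵥ v := by
    rw [f₄.arr 18 (by decide), f₃.arr 18 (by decide), f₂.arr 18 (by decide), e₁, sum_range]
    simp only [hv, dotProduct]
  have k19 : s₄.arr 19 0 0 = H := by rw [f₄.arr 19 (by decide), e₃]
  have k5 : s₄.arr 5 = s.arr 5 := by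
    rw [f₄.arr 5 (by decide), f₃.arr 5 (by decide), f₂.arr 5 (by decide), f₁.arr 5 (by decide)]
  clear f₁ f₂ f₃ f₄ e₁ e₂ e₃
  refine tri_seq (R := fun s' => s'.arr 20 0 0 = -H) (c₁ := 8)
    (tri_assign ?_ (by simp only [RealExpr.cost, NatExpr.cost]; norm_num))
    (c₂ := 330 * (n * d) + J * (250 * (n * d))) ?_ (by linarith)
  · simp only [RealExpr.eval, NatExpr.eval, setArr_arr_self, k19, Rat.cast_zero, zero_sub]
  intro s₅ f₅ e₅
  refine tri_seq (R := fun s' => s'.arr 21 0 0 = H) (c₁ := 6)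
    (tri_assign ?_ (by simp only [RealExpr.cost, NatExpr.cost]; norm_num))
    (c₂ := 320 * (n * d) + J * (250 * (n * d))) ?_ (by linarith)
  · simp only [RealExpr.eval, NatExpr.eval, setArr_arr_self, f₅.arr 19 (by decide), k19]
  intro s₆ f₆ e₆
  refine tri_seq (tri_bisect (π := fun i => X i ⬝ᵥ v) (lo := -H) (hi := H) (J := J)
    (by rw [f₆.reg 0 (by decide), f₅.reg 0 (by decide), F₄.reg 0 (by decide), hn]) hn0
    (by rw [f₆.reg 3 (by decide), f₅.reg 3 (by decide), F₄.reg 3 (by decide), hJ])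
    (by rwa [f₆.arr 7 (by decide), f₅.arr 7 (by decide)])
    (by rw [f₆.arr 20 (by decide), e₅]) e₆)
    (c₂ := 310 * (n * d) + J * (170 * (n * d))) ?_ (by linarith)
  intro s₇ f₇ e₇
  set m := center (fun i => X i ⬝ᵥ v) H J with hm
  have e₇' : s₇.arr 20 0 0 = m := e₇
  have k7 : ∀ i : Fin n, s₇.arr 7 0 i = X i ⬝ᵥ v := by
    rwa [f₇.arr 7 (by decide), f₆.arr 7 (by decide), f₅.arr 7 (by decide)]
  have k18' : s₇.arr 18 0 0 = v ⬝ᵥ v := by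
    rw [f₇.arr 18 (by decide), f₆.arr 18 (by decide), f₅.arr 18 (by decide), k18]
  have k19' : s₇.arr 19 0 0 = H := by
    rw [f₇.arr 19 (by decide), f₆.arr 19 (by decide), f₅.arr 19 (by decide), k19]
  have k5' : s₇.arr 5 = s.arr 5 := by
    rw [f₇.arr 5 (by decide), f₆.arr 5 (by decide), f₅.arr 5 (by decide), k5]
  have F₇ : Frame filterProgram s s₇ := by
    refine F₄.trans ((f₅.mono ?_ ?_ ?_).trans ((f₆.mono ?_ ?_ ?_).trans
      (f₇.mono ?_ ?_ ?_))) <;> decide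
  clear f₅ f₆ f₇ e₅ e₆ e₇ k18 k19 k5 F₄ e₄
  refine tri_seq (tri_fillExpr (N := n) (fun i => (s₇.arr 7 0 i - m) ^ 2) (by decide)
    (by rw [F₇.reg 0 (by decide), hn]) ?_
    (by simp only [RealExpr.cost, NatExpr.cost]; exact le_rfl))
    (c₂ := 270 * (n * d) + J * (170 * (n * d))) ?_ (by linarith)
  · intro i hi s₈ f₈ hii _
    simp only [RealExpr.eval, NatExpr.eval, hii, f₈.arr 7 (by decide), f₈.arr 20 (by decide), e₇']
    ring
  intro s₈ f₈ e₈
  set f : Fin n → ℝ := fun i => (X i ⬝ᵥ v - m) ^ 2 with hf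
  have k8 : ∀ i : Fin n, s₈.arr 8 0 i = f i := fun i => by rw [e₈ i i.2, k7]
  refine tri_seq (R := fun s' => s'.arr 24 0 0 = (1 + lam) * (v ⬝ᵥ v)) (c₁ := 12)
    (tri_assign ?_ (by simp only [RealExpr.cost, NatExpr.cost]; norm_num))
    (c₂ := 250 * (n * d) + J * (170 * (n * d))) ?_ (by linarith)
  · simp only [RealExpr.eval, NatExpr.eval, setArr_arr_self, f₈.arr 18 (by decide), k18',
      f₈.arr 12 (by decide), F₇.arr 12 (by decide), hl, Rat.cast_one]
  intro s₉ f₉ e₉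
  refine tri_seq (tri_threshold (f := f) (ε := ε) (J := J)
    (by rw [f₉.reg 0 (by decide), f₈.reg 0 (by decide), F₇.reg 0 (by decide), hn]) hn0
    (by rw [f₉.reg 3 (by decide), f₈.reg 3 (by decide), F₇.reg 3 (by decide), hJ])
    (by rwa [f₉.arr 8 (by decide)])
    (by rw [f₉.arr 1 (by decide), f₈.arr 1 (by decide), F₇.arr 1 (by decide), hε]) e₉)
    (c₂ := 240 * (n * d) + J * (90 * (n * d))) ?_ (by linarith)
  intro s₁₀ f₁₀ e₁₀
  set θ := (thresholdStep f (2 * ε * n))^[J] ((1 + lam) * (v ⬝ᵥ v)) with hθ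
  have k8' : ∀ i : Fin n, s₁₀.arr 8 0 i = f i := by
    rwa [f₁₀.arr 8 (by decide), f₉.arr 8 (by decide)]
  refine tri_seq (tri_fillLoop (a := 8) (N := n) (c₁ := 20)
    (fun i => if θ < s₁₀.arr 8 0 i then s₁₀.arr 8 0 i else 0) (by decide) (by decide) (by decide)
    (by rw [f₁₀.reg 0 (by decide), f₉.reg 0 (by decide), f₈.reg 0 (by decide),
      F₇.reg 0 (by decide), hn]) ?_ le_rfl)
    (c₂ := 200 * (n * d) + J * (90 * (n * d))) ?_ (by linarith)
  · intro i hi s₁₁ f₁₁ hii h8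
    refine tri_cond (c₁ := 6) (fun h => ?_) (fun h => ?_)
      (by simp only [Test.cost, RealExpr.cost, NatExpr.cost]; norm_num)
    · simp only [Test.Holds, RealExpr.eval, NatExpr.eval, hii, h8, f₁₁.arr 24 (by decide),
        e₁₀] at h
      refine tri_skip ?_ (by norm_num)
      simp [h, h8]
    · simp only [Test.Holds, RealExpr.eval, NatExpr.eval, hii, h8, f₁₁.arr 24 (by decide),
        e₁₀] at h
      refine tri_setArr ?_ (by simp only [RealExpr.cost, NatExpr.cost]; norm_num)
      simp only [NatExpr.eval, RealExpr.eval, hii, h, if_false, setArr_arr_self, Rat.cast_zero,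
        true_and]
      intro k' hk'
      simp [setArr_arr, hk']
  intro s₁₁ f₁₁ e₁₁
  have t8 : ∀ i : Fin n, s₁₁.arr 8 0 i = tail f θ i := fun i => by
    rw [e₁₁ i i.2, k8', tail]
  have t18 : s₁₁.arr 18 0 0 = v ⬝ᵥ v := by
    rw [f₁₁.arr 18 (by decide), f₁₀.arr 18 (by decide), f₉.arr 18 (by decide),
      f₈.arr 18 (by decide), k18']
  have t19 : s₁₁.arr 19 0 0 = H := by
    rw [f₁₁.arr 19 (by decide), f₁₀.arr 19 (by decide), f₉.arr 19 (by decide),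
      f₈.arr 19 (by decide), k19']
  have t5 : s₁₁.arr 5 = s.arr 5 := by
    rw [f₁₁.arr 5 (by decide), f₁₀.arr 5 (by decide), f₉.arr 5 (by decide),
      f₈.arr 5 (by decide), k5']
  have F₁₁ : Frame filterProgram s s₁₁ := by
    refine F₇.trans ((f₈.mono ?_ ?_ ?_).trans ((f₉.mono ?_ ?_ ?_).trans
      ((f₁₀.mono ?_ ?_ ?_).trans (f₁₁.mono ?_ ?_ ?_)))) <;> decide
  clear f₈ f₉ f₁₀ f₁₁ e₈ e₉ e₁₀ e₁₁ k18' k19' k5' F₇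
  refine tri_seq (R := fun s' => s'.arr 25 0 0 = 200 * lam * n * (v ⬝ᵥ v)) (c₁ := 20)
    (tri_assign ?_ (by simp only [RealExpr.cost, NatExpr.cost]; norm_num))
    (c₂ := 180 * (n * d) + J * (90 * (n * d))) ?_ (by linarith)
  · simp only [RealExpr.eval, NatExpr.eval, setArr_arr_self, t18, F₁₁.arr 12 (by decide), hl,
      F₁₁.reg 0 (by decide), hn, Rat.cast_ofNat]
  intro s₁₂ f₁₂ e₁₂
  refine tri_seq (R := fun s' => s'.arr 26 0 0 = 1 / (4 * H ^ 2)) (c₁ := 20)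
    (tri_assign ?_ (by simp only [RealExpr.cost, NatExpr.cost]; norm_num))
    (c₂ := 160 * (n * d) + J * (90 * (n * d))) ?_ (by linarith)
  · simp only [RealExpr.eval, NatExpr.eval, setArr_arr_self, f₁₂.arr 19 (by decide), t19,
      Rat.cast_ofNat, Rat.cast_one, sq]
  intro s₁₃ f₁₃ e₁₃
  refine tri_seq (R := fun s' => s'.arr 27 0 0 = 0) (c₁ := 20)
    (tri_assign ?_ (by simp only [RealExpr.cost]; norm_num))
    (c₂ := 140 * (n * d) + J * (90 * (n * d))) ?_ (by linarith)
  · simp only [RealExpr.eval, setArr_arr_self, Rat.cast_zero]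
  intro s₁₄ f₁₄ e₁₄
  refine tri_seq (tri_rate (w := w) (τ := tail f θ) (J := J)
    (by rw [f₁₄.reg 0 (by decide), f₁₃.reg 0 (by decide), f₁₂.reg 0 (by decide),
      F₁₁.reg 0 (by decide), hn]) hn0
    (by rw [f₁₄.reg 3 (by decide), f₁₃.reg 3 (by decide), f₁₂.reg 3 (by decide),
      F₁₁.reg 3 (by decide), hJ])
    (by rwa [f₁₄.arr 5 (by decide), f₁₃.arr 5 (by decide), f₁₂.arr 5 (by decide), t5])
    (by rwa [f₁₄.arr 8 (by decide), f₁₃.arr 8 (by decide), f₁₂.arr 8 (by decide)]) e₁₄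
    (by rw [f₁₄.arr 26 (by decide), e₁₃])
    (by rw [f₁₄.arr 25 (by decide), f₁₃.arr 25 (by decide), e₁₂]))
    (c₂ := 130 * (n * d)) ?_ (by linarith)
  intro s₁₅ f₁₅ e₁₅
  have u5 : s₁₅.arr 5 = s.arr 5 := by
    rw [f₁₅.arr 5 (by decide), f₁₄.arr 5 (by decide), f₁₃.arr 5 (by decide),
      f₁₂.arr 5 (by decide), t5]
  have u8 : s₁₅.arr 8 = s₁₁.arr 8 := by
    rw [f₁₅.arr 8 (by decide), f₁₄.arr 8 (by decide), f₁₃.arr 8 (by decide),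
      f₁₂.arr 8 (by decide)]
  set t := (rateStep w (tail f θ) (1 / (4 * H ^ 2)) (200 * lam * n * (v ⬝ᵥ v)))^[J] 0 with ht
  refine (tri_fillExpr (N := n) (fun i => s.arr 5 0 i / (1 + t * s₁₁.arr 8 0 i)) (by decide)
    (by rw [f₁₅.reg 0 (by decide), f₁₄.reg 0 (by decide), f₁₃.reg 0 (by decide),
      f₁₂.reg 0 (by decide), F₁₁.reg 0 (by decide), hn]) ?_
    (by simp only [RealExpr.cost, NatExpr.cost]; exact le_rfl)).mono ?_ (by linarith)
  · intro i hi s₁₆ f₁₆ hii h5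
    simp only [RealExpr.eval, NatExpr.eval, hii, h5, u5, f₁₆.arr 8 (by decide), u8,
      f₁₆.arr 27 (by decide), e₁₅, Rat.cast_one]
  · intro s' _ h i
    rw [h i i.2, hw, t8]
    rfl

/-- One round. -/
def roundProgram : Program := .seq tossProgram (.seq powerProgram filterProgram)

theorem tri_round {ε lam ρ : ℝ} {J : ℕ} (hn : s.reg 0 = n) (hd : s.reg 1 = d) (hd0 : 0 < d)
    (hn0 : 0 < n) (hJ : s.reg 3 = J) (hX : ∀ i : Fin n, ∀ j : Fin d, s.arr 4 i j = X i j)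
    (hw : ∀ i : Fin n, s.arr 5 0 i = w i)
    (hε : s.arr 1 0 0 = ε) (hl : s.arr 12 0 0 = lam) (hρ : s.arr 11 0 0 = ρ) :
    Tri ω roundProgram s (600 * (n * d) + J * (600 * (n * d))) fun s' =>
      s'.used = s.used + d ∧ ∀ i : Fin n,
        s'.arr 5 0 i = step X ε lam ρ J w (fun j : Fin d => ω (s.used + j)) i := by
  have c2 : 1 ≤ n * d := Nat.mul_pos hn0 hd0
  have c3 : d ≤ n * d := Nat.le_mul_of_pos_left _ hn0
  have c4 : J * 1 ≤ J * (n * d) := Nat.mul_le_mul_left _ c2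
  refine tri_seq (tri_toss_signs hd hd0) (c₂ := 520 * (n * d) + J * (600 * (n * d))) ?_
    (by linarith)
  rintro s₁ f₁ ⟨e₁, e₁'⟩
  refine tri_seq (tri_power (X := X) (w := w) (lam := lam) (J := J)
    (by rw [f₁.reg 0 (by decide), hn]) (by rw [f₁.reg 1 (by decide), hd]) hd0 hn0
    (by rw [f₁.reg 3 (by decide), hJ]) (by rwa [f₁.arr 4 (by decide)])
    (by rwa [f₁.arr 5 (by decide)]) (by rwa [f₁.arr 12 (by decide)]) e₁')
    (c₂ := 500 * (n * d) + J * (250 * (n * d))) ?_ (by linarith)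
  intro s₂ f₂ e₂
  refine (tri_filter (X := X) (w := w) (ε := ε) (lam := lam) (ρ := ρ) (J := J)
    (by rw [f₂.reg 0 (by decide), f₁.reg 0 (by decide), hn])
    (by rw [f₂.reg 1 (by decide), f₁.reg 1 (by decide), hd]) hd0 hn0
    (by rw [f₂.reg 3 (by decide), f₁.reg 3 (by decide), hJ])
    (by rwa [f₂.arr 4 (by decide), f₁.arr 4 (by decide)])
    (by rwa [f₂.arr 5 (by decide), f₁.arr 5 (by decide)]) e₂
    (by rw [f₂.arr 1 (by decide), f₁.arr 1 (by decide), hε])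
    (by rw [f₂.arr 12 (by decide), f₁.arr 12 (by decide), hl])
    (by rw [f₂.arr 11 (by decide), f₁.arr 11 (by decide), hρ])).mono ?_ le_rfl
  intro s' f₃ h
  exact ⟨by rw [f₃.used (by decide), f₂.used (by decide), e₁], h⟩

end Round

end RobustMean

namespace RealRAM

/-- Makes the outcome of the deterministic preparation common to all coin sequences, so that the
probability concerns the rounds alone. -/
theorem Exec.of_tosses_eq_false {ω ω' : ℕ → Bool} {p : Program} {s s' : Memory} {t : ℕ}
    (h : Exec ω p s t s') (hp : p.tosses = false) : Exec ω' p s t s' := by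
  induction h with
  | skip s => exact .skip s
  | setReg s v e => exact .setReg s v e
  | setArr s a i j e => exact .setArr s a i j e
  | toss s v => simp [Program.tosses] at hp
  | seq _ _ ih₁ ih₂ =>
    simp only [Program.tosses, Bool.or_eq_false_iff] at hp
    exact .seq (ih₁ hp.1) (ih₂ hp.2)
  | condTrue hc _ ih =>
    simp only [Program.tosses, Bool.or_eq_false_iff] at hp
    exact .condTrue hc (ih hp.1)
  | condFalse hc _ ih =>
    simp only [Program.tosses, Bool.or_eq_false_iff] at hp
    exact .condFalse hc (ih hp.2)
  | loopTrue hc _ _ ih₁ ih₂ => exact .loopTrue hc (ih₁ hp) (ih₂ hp)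
  | loopFalse hc => exact .loopFalse hc

end RealRAM

namespace RobustMean

open Matrix Finset RealRAM

variable {n d : ℕ}

/-! ### A rough center

A tournament: each candidate has a weight, and when two candidates meet, one of them survives, with
the sum of the weights if the two are close and with the difference of the weights otherwise. -/

/-- The candidate `c` with weight `w` represents a set of points whose good members outnumber the
others by `D`. -/
def Leads (μ : Fin d → ℝ) (r : ℝ) (c : Fin d → ℝ) (w D : ℝ) : Prop :=
  0 ≤ w ∧ D ≤ w ∧ (¬ (c - μ) ⬝ᵥ (c - μ) ≤ r ^ 2 → D ≤ -w)

theorem dotProduct_self_le_of_add {a b e : Fin d → ℝ} {x y : ℝ} (h : e = a + b) (hx : 0 ≤ x)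
    (hy : 0 ≤ y) (ha : a ⬝ᵥ a ≤ x ^ 2) (hb : b ⬝ᵥ b ≤ y ^ 2) : e ⬝ᵥ e ≤ (x + y) ^ 2 := by
  have key : ∀ v : Fin d → ℝ, v ⬝ᵥ v = ‖WithLp.toLp 2 v‖ ^ 2 := fun v => by
    rw [EuclideanSpace.real_norm_sq_eq]
    simp [dotProduct, sq]
  rw [key] at *
  subst h
  rw [WithLp.toLp_add]
  exact pow_le_pow_left₀ (norm_nonneg _) ((norm_add_le _ _).trans (add_le_add
    (abs_le_of_sq_le_sq ha hx |> (le_abs_self _).trans)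
    (abs_le_of_sq_le_sq hb hy |> (le_abs_self _).trans))) 2

namespace Leads

variable {μ c c₁ c₂ : Fin d → ℝ} {r r' w w₁ w₂ D D₁ D₂ : ℝ}

theorem mono (h : Leads μ r c w D) (hr : 0 ≤ r) (hr' : r ≤ r') : Leads μ r' c w D :=
  ⟨h.1, h.2.1, fun hc => h.2.2 fun hc' => hc (hc'.trans (pow_le_pow_left₀ hr hr' 2))⟩

/-- If the survivor is farther than 3r from μ, then both candidates are farther than r, and the two
deficits add up. The factor 3 comes from r + 2r. -/
theorem of_close (h₁ : Leads μ r c₁ w₁ D₁) (h₂ : Leads μ r c₂ w₂ D₂) (hr : 0 ≤ r)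
    (hc : (c₁ - c₂) ⬝ᵥ (c₁ - c₂) ≤ (2 * r) ^ 2) : Leads μ (3 * r) c₁ (w₁ + w₂) (D₁ + D₂) := by
  obtain ⟨p₁, q₁, t₁⟩ := h₁
  obtain ⟨p₂, q₂, t₂⟩ := h₂
  refine ⟨by linarith, by linarith, fun hn => ?_⟩
  have e₁ := t₁ fun h => hn (h.trans (pow_le_pow_left₀ hr (by linarith) 2))
  have e₂ := t₂ fun h => hn (by
    have := dotProduct_self_le_of_add (e := c₁ - μ) (a := c₁ - c₂) (b := c₂ - μ) (by simp)
      (by linarith) hr hc h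
    rwa [show 2 * r + r = 3 * r by ring] at this)
  linarith

/-- Candidates more than 2r apart are not both within r of μ, so at least one block has a deficit as
large as its weight. The heavier one survives, which keeps the weight nonnegative. -/
theorem of_far (h₁ : Leads μ r c₁ w₁ D₁) (h₂ : Leads μ r c₂ w₂ D₂) (hr : 0 ≤ r)
    (hc : ¬ (c₁ - c₂) ⬝ᵥ (c₁ - c₂) ≤ (2 * r) ^ 2) (hw : w₂ ≤ w₁) :
    Leads μ (3 * r) c₁ (w₁ - w₂) (D₁ + D₂) := by
  obtain ⟨p₁, q₁, t₁⟩ := h₁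
  obtain ⟨p₂, q₂, t₂⟩ := h₂
  by_cases g₁ : (c₁ - μ) ⬝ᵥ (c₁ - μ) ≤ r ^ 2
  · have e₂ := t₂ fun g₂ => hc (by
      have h' : (μ - c₂) ⬝ᵥ (μ - c₂) ≤ r ^ 2 := by
        rw [← neg_sub c₂ μ, neg_dotProduct_neg]; exact g₂
      have := dotProduct_self_le_of_add (e := c₁ - c₂) (a := c₁ - μ) (b := μ - c₂) (by simp)
        hr hr g₁ h'
      rwa [← two_mul] at this)
    exact ⟨by linarith, by linarith, fun hn =>
      absurd (g₁.trans (pow_le_pow_left₀ hr (by linarith) 2)) hn⟩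
  · have e₁ := t₁ g₁
    exact ⟨by linarith, by linarith, fun _ => by linarith⟩

end Leads

section Center

variable {ω : ℕ → Bool} {s : Memory}

/-- The candidate in position `i`. -/
def candidate (d : ℕ) (s : Memory) (i : ℕ) : Fin d → ℝ := fun j => s.arr 3 i j

theorem candidate_congr {s' : Memory} {i : ℕ} (h : s.arr 3 i = s'.arr 3 i) :
    candidate d s i = candidate d s' i := by
  funext j
  simp only [candidate, h]

/-- Let the candidates in the positions held by the registers `10` and `11` meet. -/
def mergeProgram : Program :=
  .seq (sumExpr 13 6 1 (.mul (.sub (.get 3 (.reg 10) (.reg 6)) (.get 3 (.reg 11) (.reg 6)))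
    (.sub (.get 3 (.reg 10) (.reg 6)) (.get 3 (.reg 11) (.reg 6)))))
  (.cond (.realLt (.mul (var 11) (var 11)) (var 13))
    (.cond (.realLt (entry 9 10) (entry 9 11))
      (.seq (forLoop 6 1 (.setArr 3 (.reg 10) (.reg 6) (.get 3 (.reg 11) (.reg 6))))
        (.setArr 9 (.lit 0) (.reg 10) (.sub (entry 9 11) (entry 9 10))))
      (.setArr 9 (.lit 0) (.reg 10) (.sub (entry 9 10) (entry 9 11))))
    (.setArr 9 (.lit 0) (.reg 10) (.add (entry 9 10) (entry 9 11))))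

theorem tri_merge {a b : ℕ} {r : ℝ} {μ : Fin d → ℝ} (hd : s.reg 1 = d) (hd0 : 0 < d)
    (ha : s.reg 10 = a) (hb : s.reg 11 = b) (hab : b ≠ a) (hr : 0 ≤ r)
    (hρ : s.arr 11 0 0 = 2 * r) :
    Tri ω mergeProgram s (150 * d) fun s' =>
      (∀ i ≠ a, s'.arr 3 i = s.arr 3 i ∧ s'.arr 9 0 i = s.arr 9 0 i) ∧
      ∀ D₁ D₂, Leads μ r (candidate d s a) (s.arr 9 0 a) D₁ →
        Leads μ r (candidate d s b) (s.arr 9 0 b) D₂ →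
        Leads μ (3 * r) (candidate d s' a) (s'.arr 9 0 a) (D₁ + D₂) := by
  refine tri_seq (tri_sumExpr (N := d) (fun j => (s.arr 3 a j - s.arr 3 b j) *
    (s.arr 3 a j - s.arr 3 b j)) (by decide) hd ?_
    (by simp only [RealExpr.cost, NatExpr.cost]; exact le_rfl)) (c₂ := 100 * d) ?_ (by linarith)
  · intro j hj s₁ f₁ hij
    simp only [RealExpr.eval, NatExpr.eval, hij, f₁.reg 10 (by decide), f₁.reg 11 (by decide), ha,
      hb, f₁.arr 3 (by decide)]
  intro s₁ f₁ e₁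
  have k10 : s₁.reg 10 = a := by rw [f₁.reg 10 (by decide), ha]
  have k11 : s₁.reg 11 = b := by rw [f₁.reg 11 (by decide), hb]
  have g3 : s₁.arr 3 = s.arr 3 := f₁.arr 3 (by decide)
  have g9 : s₁.arr 9 = s.arr 9 := f₁.arr 9 (by decide)
  have g11 : s₁.arr 11 0 0 = 2 * r := by rw [f₁.arr 11 (by decide), hρ]
  have e₁' : s₁.arr 13 0 0 = (candidate d s a - candidate d s b) ⬝ᵥ
      (candidate d s a - candidate d s b) := by
    rw [e₁, sum_range]
    rfl
  have hcand : ∀ x, candidate d s₁ x = candidate d s x := fun x =>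
    candidate_congr (by rw [g3])
  refine tri_cond (c₁ := 80 * d) (fun h => ?_) (fun h => ?_)
    (by simp only [Test.cost, RealExpr.cost, NatExpr.cost]; linarith)
  · simp only [Test.Holds, RealExpr.eval, NatExpr.eval, g11, e₁'] at h
    have hfar : ¬ (candidate d s a - candidate d s b) ⬝ᵥ
        (candidate d s a - candidate d s b) ≤ (2 * r) ^ 2 := by rw [sq]; exact not_le.mpr h
    refine tri_cond (c₁ := 60 * d) (fun h => ?_) (fun h => ?_)
      (by simp only [Test.cost, RealExpr.cost, NatExpr.cost]; linarith)
    · simp only [Test.Holds, RealExpr.eval, NatExpr.eval, k10, k11, g9] at h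
      refine tri_seq (tri_for (N := d) (c₁ := 6) (I := fun k s' => (∀ i ≠ a, s'.arr 3 i = s.arr 3 i)
        ∧ ∀ j < k, s'.arr 3 a j = s.arr 3 b j) (by decide) (by decide) (by decide)
        (by rw [f₁.reg 1 (by decide), hd]) ⟨fun i _ => by rw [setReg_arr, g3], by simp⟩ ?_ le_rfl)
        (c₂ := 20) ?_ (by linarith)
      · rintro j hj s₂ f₂ hij ⟨h1, h2⟩
        refine tri_setArr ?_ (by simp only [RealExpr.cost, NatExpr.cost]; norm_num)
        simp only [RealExpr.eval, NatExpr.eval, hij, f₂.reg 10 (by decide), f₂.reg 11 (by decide),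
          k10, k11, setReg_arr]
        refine ⟨fun i hi => ?_, fun l hl => ?_⟩
        · funext j'
          rw [setArr_arr, if_neg (by tauto), h1 i hi]
        · rcases Nat.lt_succ_iff_lt_or_eq.mp hl with hl | rfl
          · rw [setArr_arr, if_neg (by omega), h2 l hl]
          · rw [setArr_arr_self, h1 b hab]
      rintro s₂ f₂ ⟨h1, h2⟩
      refine tri_setArr ?_ (by simp only [RealExpr.cost, NatExpr.cost]; norm_num)
      simp only [RealExpr.eval, NatExpr.eval, f₂.reg 10 (by decide), f₂.reg 11 (by decide),
          k10, k11, f₂.arr 9 (by decide), g9]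
      refine ⟨fun i hi => ⟨by rw [setArr_arr_of_ne _ _ _ _ (by decide), h1 i hi], ?_⟩, ?_⟩
      · rw [setArr_arr, if_neg (by tauto), f₂.arr 9 (by decide), g9]
      · intro D₁ D₂ l₁ l₂
        have : candidate d (s₂.setArr 9 0 a (s.arr 9 0 b - s.arr 9 0 a)) a = candidate d s b := by
          funext j
          simp only [candidate, setArr_arr_of_ne _ _ _ _ (by decide : 3 ≠ 9), h2 j j.2]
        rw [this, setArr_arr_self, add_comm]
        refine l₂.of_far l₁ hr ?_ h.le
        rwa [← neg_sub, neg_dotProduct_neg]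
    · simp only [Test.Holds, RealExpr.eval, NatExpr.eval, k10, k11, g9, not_lt] at h
      refine tri_setArr ?_ (by simp only [RealExpr.cost, NatExpr.cost]; linarith)
      simp only [RealExpr.eval, NatExpr.eval, k10, k11, g9]
      refine ⟨fun i hi => ⟨by rw [setArr_arr_of_ne _ _ _ _ (by decide), g3], ?_⟩, ?_⟩
      · rw [setArr_arr, if_neg (by tauto), g9]
      · intro D₁ D₂ l₁ l₂
        have : candidate d (s₁.setArr 9 0 a (s.arr 9 0 a - s.arr 9 0 b)) a = candidate d s a := by
          rw [← hcand]; rfl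
        rw [this, setArr_arr_self]
        exact l₁.of_far l₂ hr hfar h
  · simp only [Test.Holds, RealExpr.eval, NatExpr.eval, g11, e₁', not_lt] at h
    refine tri_setArr ?_ (by simp only [RealExpr.cost, NatExpr.cost]; linarith)
    simp only [RealExpr.eval, NatExpr.eval, k10, k11, g9]
    refine ⟨fun i hi => ⟨by rw [setArr_arr_of_ne _ _ _ _ (by decide), g3], ?_⟩, ?_⟩
    · rw [setArr_arr, if_neg (by tauto), g9]
    · intro D₁ D₂ l₁ l₂
      have : candidate d (s₁.setArr 9 0 a (s.arr 9 0 a + s.arr 9 0 b)) a = candidate d s a := by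
        rw [← hcand]; rfl
      rw [this, setArr_arr_self]
      exact l₁.of_close l₂ hr (by rw [sq]; exact h)

/-- The candidates in the positions divisible by `h` represent blocks of length `h`. -/
def Leaders (n h : ℕ) (μ : Fin d → ℝ) (f : ℕ → ℝ) (r : ℝ) (s : Memory) : Prop :=
  ∀ q, h * q < n → Leads μ r (candidate d s (h * q)) (s.arr 9 0 (h * q))
    (∑ x ∈ range h, f (h * q + x))

/-- One level of the tournament; register `9` holds the length of the blocks. -/
def levelProgram : Program :=
  .seq (.setReg 10 (.lit 0))
  (.seq (forLoop 8 0 (.cond (.natLt (.add (.reg 10) (.reg 9)) (.reg 0))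
    (.seq (.setReg 11 (.add (.reg 10) (.reg 9)))
      (.seq mergeProgram (.setReg 10 (.add (.reg 11) (.reg 9))))) .skip))
  (.seq (.setReg 9 (.add (.reg 9) (.reg 9))) (assign 11 (.mul (.lit 3) (var 11)))))

theorem tri_level {h : ℕ} {r : ℝ} {μ : Fin d → ℝ} {f : ℕ → ℝ} (hn : s.reg 0 = n)
    (hd : s.reg 1 = d) (hd0 : 0 < d) (hn0 : 0 < n) (hh : s.reg 9 = h) (hh0 : 0 < h) (hr : 0 ≤ r)
    (hρ : s.arr 11 0 0 = 2 * r) (hf : ∀ i, n ≤ i → f i = 0) :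
    Tri ω levelProgram s (250 * (n * d)) fun s' => s'.reg 9 = 2 * h ∧
      s'.arr 11 0 0 = 2 * (3 * r) ∧
      (Leaders n h μ f r s → Leaders n (2 * h) μ f (3 * r) s') := by
  have c1 : n ≤ n * d := Nat.le_mul_of_pos_right _ hd0
  have c2 : 1 ≤ n * d := Nat.mul_pos hn0 hd0
  refine tri_seq (R := fun s' => s' = s.setReg 10 0) (c₁ := 2) (c₂ := 240 * (n * d))
    (tri_setReg (by simp [NatExpr.eval]) (by simp [NatExpr.cost])) ?_ (by linarith)
  rintro s₀ f₀ rfl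
  -- The loop runs n times, more often than there are pairs of blocks; once the second block of a
  -- pair would start beyond the last point, iterations do nothing. Hence the alternative for q.
  -- Positions from 2hq on are still untouched.
  refine tri_seq (tri_for (N := n) (c₁ := 180 * d) (I := fun k s' => ∃ q,
      s'.reg 10 = 2 * h * q ∧ (q = k ∨ n ≤ 2 * h * q + h) ∧
      (Leaders n h μ f r s →
        (∀ q' < q, 2 * h * q' < n → Leads μ (3 * r) (candidate d s' (2 * h * q'))
          (s'.arr 9 0 (2 * h * q')) (∑ x ∈ range (2 * h), f (2 * h * q' + x))) ∧
        ∀ i, 2 * h * q ≤ i → s'.arr 3 i = s.arr 3 i ∧ s'.arr 9 0 i = s.arr 9 0 i))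
    (by decide) (by decide) (by decide) ((setReg_reg_of_ne _ _ (by decide)).trans hn)
    ⟨0, by simp [setReg_reg], Or.inl rfl, fun _ => ⟨by simp, fun i _ => ⟨rfl, rfl⟩⟩⟩ ?_ le_rfl)
    (c₂ := 20) ?_ (by linarith)
  · rintro k hk s₁ f₁ hik ⟨q, hq, hq', hL⟩
    have k9 : s₁.reg 9 = h := by
      rw [f₁.reg 9 (by decide), setReg_reg_of_ne _ _ (by decide), hh]
    have k0 : s₁.reg 0 = n := by
      rw [f₁.reg 0 (by decide), setReg_reg_of_ne _ _ (by decide), hn]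
    have k1 : s₁.reg 1 = d := by
      rw [f₁.reg 1 (by decide), setReg_reg_of_ne _ _ (by decide), hd]
    have k11 : s₁.arr 11 0 0 = 2 * r := by rw [f₁.arr 11 (by decide), setReg_arr, hρ]
    refine tri_cond (c₁ := 170 * d) (fun hlt => ?_) (fun hlt => ?_)
      (by simp only [Test.cost, NatExpr.cost]; linarith)
    · simp only [Test.Holds, NatExpr.eval, k9, k0, hq] at hlt
      refine tri_seq (R := fun s' => s' = s₁.setReg 11 (2 * h * q + h)) (c₁ := 4)
        (c₂ := 160 * d) (tri_setReg (by simp [NatExpr.eval, hq, k9]) (by simp [NatExpr.cost])) ?_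
        (by linarith)
      rintro s₂ f₂ rfl
      refine tri_seq (tri_merge (d := d) (a := 2 * h * q) (b := 2 * h * q + h) (r := r) (μ := μ)
        (by rw [setReg_reg_of_ne _ _ (by decide), k1]) hd0
        (by rw [setReg_reg_of_ne _ _ (by decide), hq]) (by simp) (by omega) hr
        (by rw [setReg_arr, k11])) (c₂ := 4) ?_ (by linarith)
      rintro s₃ f₃ ⟨e₃, l₃⟩
      refine tri_setReg ?_ (by simp [NatExpr.cost])
      refine ⟨q + 1, ?_, ?_, fun hs => ?_⟩
      · simp only [NatExpr.eval, f₃.reg 11 (by decide), f₃.reg 9 (by decide), setReg_reg, k9]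
        norm_num
        ring
      · rcases hq' with hq' | hq'
        · exact Or.inl (by rw [hq'])
        · omega
      · obtain ⟨m₁, m₂⟩ := hL hs
        simp only [setReg_arr] at e₃ ⊢
        have hcand : ∀ i, candidate d ((s₃.setReg 10 (NatExpr.eval s₃ ((NatExpr.reg 11).add
            (NatExpr.reg 9)))).setReg 8 (k + 1)) i = candidate d s₃ i := fun i => rfl
        refine ⟨fun q' hlt' hq'n => ?_, fun i hi => ?_⟩
        · rw [hcand]
          rcases Nat.lt_succ_iff_lt_or_eq.mp hlt' with hlt' | rfl
          · have hne : 2 * h * q' ≠ 2 * h * q := by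
              have := Nat.mul_lt_mul_of_pos_left hlt' (by omega : 0 < 2 * h)
              omega
            have := m₁ q' hlt' hq'n
            rwa [(e₃ _ hne).2, candidate_congr (e₃ _ hne).1]
          · rw [two_mul h, sum_range_add, ← two_mul]
            refine l₃ _ _ ?_ ?_
            · have := hs (2 * q') (by rw [← mul_assoc, mul_comm h]; exact hq'n)
              rw [show h * (2 * q') = 2 * h * q' by ring] at this
              rwa [candidate_congr (s := s₁.setReg _ _) (s' := s) (m₂ _ le_rfl).1, setReg_arr, (m₂ _ le_rfl).2]
            · have := hs (2 * q' + 1) (by rw [show h * (2 * q' + 1) = 2 * h * q' + h by ring]; exact hlt)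
              rw [show h * (2 * q' + 1) = 2 * h * q' + h by ring] at this
              rw [candidate_congr (s := s₁.setReg _ _) (s' := s) (m₂ _ (Nat.le_add_right _ h)).1, setReg_arr,
                (m₂ _ (Nat.le_add_right _ h)).2]
              simpa only [add_assoc] using this
        · have hi' : 2 * h * q + 2 * h ≤ i := by rw [← Nat.mul_succ]; exact hi
          rw [(e₃ i (by omega)).1, (e₃ i (by omega)).2]
          exact m₂ i (by omega)
    · simp only [Test.Holds, NatExpr.eval, k9, k0, hq, not_lt] at hlt
      refine tri_skip ?_ (by linarith)
      exact ⟨q, by rw [setReg_reg_of_ne _ _ (by decide), hq], Or.inr hlt, hL⟩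
  rintro s₁ f₁ ⟨q, hq, hq', hL⟩
  have k9 : s₁.reg 9 = h := by
    rw [f₁.reg 9 (by decide), setReg_reg_of_ne _ _ (by decide), hh]
  have k11 : s₁.arr 11 0 0 = 2 * r := by rw [f₁.arr 11 (by decide), setReg_arr, hρ]
  refine tri_seq (R := fun s' => s' = s₁.setReg 9 (2 * h)) (c₁ := 4) (c₂ := 10)
    (tri_setReg (by simp [NatExpr.eval, k9, two_mul]) (by simp [NatExpr.cost])) ?_ (by norm_num)
  rintro s₂ f₂ rfl
  refine tri_assign ?_ (by simp only [RealExpr.cost, NatExpr.cost]; norm_num)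
  simp only [RealExpr.eval, NatExpr.eval, setReg_arr, k11, setArr_reg, setReg_reg_self,
    setArr_arr_self, true_and]
  refine ⟨by push_cast; ring, fun hs => ?_⟩
  obtain ⟨m₁, m₂⟩ := hL hs
  intro q' hq'n
  have hcand : ∀ i, candidate d ((s₁.setReg 9 (2 * h)).setArr 11 0 0 (((3 : ℚ) : ℝ) * (2 * r))) i
      = candidate d s₁ i := fun i => rfl
  rw [setArr_arr_of_ne _ _ _ _ (by decide), setReg_arr, hcand]
  -- A block without a partner passes on unchanged: the second half of its doubled block lies beyond
  -- n, where f vanishes, and the radius only grows.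
  rcases lt_or_ge q' q with hlt | hge
  · exact m₁ q' hlt hq'n
  · have hle : 2 * h * q ≤ 2 * h * q' := Nat.mul_le_mul_left _ hge
    have hnh : n ≤ 2 * h * q + h := by
      rcases hq' with rfl | h'
      · have : q ≤ 2 * h * q := Nat.le_mul_of_pos_left _ (by omega)
        omega
      · exact h'
    have := hs (2 * q') (by rw [← mul_assoc, mul_comm h]; exact hq'n)
    rw [show h * (2 * q') = 2 * h * q' by ring] at this
    rw [two_mul h, sum_range_add, ← two_mul, sum_eq_zero (s := range h)
      (f := fun x => f (2 * h * q' + (h + x))) (fun x _ => hf _ (by omega)), add_zero]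
    rw [candidate_congr (m₂ _ hle).1, (m₂ _ hle).2]
    exact this.mono hr (by linarith)

/-- The tournament. -/
def centerProgram : Program := forLoop 7 2 levelProgram

theorem tri_center {L : ℕ} {r : ℝ} {μ : Fin d → ℝ} {f : ℕ → ℝ} (hn : s.reg 0 = n)
    (hd : s.reg 1 = d) (hd0 : 0 < d) (hn0 : 0 < n) (hL : s.reg 2 = L) (h9 : s.reg 9 = 1)
    (hr : 0 ≤ r) (hρ : s.arr 11 0 0 = 2 * r) (hf : ∀ i, n ≤ i → f i = 0) :
    Tri ω centerProgram s (6 + L * (260 * (n * d))) fun s' =>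
      s'.arr 11 0 0 = 2 * (3 ^ L * r) ∧
      (Leaders n 1 μ f r s → Leaders n (2 ^ L) μ f (3 ^ L * r) s') := by
  have c2 : 1 ≤ n * d := Nat.mul_pos hn0 hd0
  refine (tri_for (N := L) (c₁ := 250 * (n * d)) (I := fun k s' => s'.reg 9 = 2 ^ k ∧
      s'.arr 11 0 0 = 2 * (3 ^ k * r) ∧
      (Leaders n 1 μ f r s → Leaders n (2 ^ k) μ f (3 ^ k * r) s'))
    (by decide) (by decide) (by decide) hL ⟨by rw [setReg_reg_of_ne _ _ (by decide), h9, pow_zero],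
      by simpa using hρ, fun h => by rw [pow_zero, pow_zero, one_mul]; exact h⟩ ?_
    (Nat.add_le_add_left (Nat.mul_le_mul_left _ (by omega)) 6)).mono
      (fun s' _ h => ⟨h.2.1, h.2.2⟩) le_rfl
  rintro k hk s₁ f₁ - ⟨h1, h2, h3⟩
  refine (tri_level (n := n) (d := d) (h := 2 ^ k) (r := 3 ^ k * r) (μ := μ) (f := f)
    (by rw [f₁.reg 0 (by decide), hn]) (by rw [f₁.reg 1 (by decide), hd]) hd0 hn0 h1
    (by positivity) (by positivity) h2 hf).mono ?_ le_rfl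
  rintro s₂ f₂ ⟨h4, h5, h6⟩
  refine ⟨by rw [setReg_reg_of_ne _ _ (by decide), h4, pow_succ, mul_comm], ?_, fun h => ?_⟩
  · rw [setReg_arr, h5, pow_succ]; ring
  · have := h6 (h3 h)
    rw [pow_succ, mul_comm (2 ^ k), pow_succ, mul_comm (3 ^ k), mul_assoc]
    exact this

end Center

end RobustMean

namespace RealRAM

theorem tri_fillRow {ω : ℕ → Bool} {s : Memory} {c a r i b N k : ℕ} {e : RealExpr} (f : ℕ → ℝ)
    (hib : b ≠ i) (hri : r ≠ i) (hr : s.reg r = k) (hN : s.reg b = N)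
    (he : ∀ j < N, ∀ s', Frame (forLoop i b (.setArr a (.reg r) (.reg i) e)) s s' →
      s'.reg i = j → e.eval s' = f j)
    (hc : 6 + N * (e.cost + 11) ≤ c) :
    Tri ω (forLoop i b (.setArr a (.reg r) (.reg i) e)) s c fun s' =>
      (∀ j < N, s'.arr a k j = f j) ∧ ∀ l ≠ k, s'.arr a l = s.arr a l := by
  refine tri_for (c₁ := e.cost + 3) (I := fun m s' => (∀ j < m, s'.arr a k j = f j) ∧
    ∀ l ≠ k, s'.arr a l = s.arr a l) (by simp [Program.regs]) (by simp [Program.regs]) hib hN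
    (by simp) ?_ (by simpa [Nat.add_assoc] using hc)
  rintro j hj s₁ f₁ hij ⟨h1, h2⟩
  refine tri_setArr ?_ (by simp only [NatExpr.cost]; omega)
  have k1 : s₁.reg r = k := by
    rw [f₁.reg r (by simp [forLoop, Program.regs, hri]), hr]
  simp only [NatExpr.eval, hij, he j hj s₁ f₁ hij, k1, setReg_arr]
  refine ⟨fun l hl => ?_, fun l hl => ?_⟩
  · rcases Nat.lt_succ_iff_lt_or_eq.mp hl with hl | rfl
    · rw [setArr_arr, if_neg (by omega), h1 l hl]
    · rw [setArr_arr_self]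
  · funext j'
    rw [setArr_arr, if_neg (by tauto), h2 l hl]

end RealRAM

/-! ### Preparation, pruning and the complete run -/

namespace RobustMean

open Matrix Finset RealRAM

variable {n d : ℕ} {ω : ℕ → Bool} {s : Memory} {ε δ τ : ℝ} {S : Fin n → Vec d}

/-- Compute the parameters. -/
def paramProgram : Program :=
  .seq (assign 12 (.div (.mul (.get 1 (.lit 0) (.lit 1)) (.get 1 (.lit 0) (.lit 1)))
    (.get 1 (.lit 0) (.lit 0))))
  (.seq (assign 10 (.lit 1))
  (.seq (.loop (.realLt (var 10) (.div (.mul (.lit 16) (.mul (.ofNat (.reg 0)) (.ofNat (.reg 1))))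
      (.mul (.get 1 (.lit 0) (.lit 0)) (.get 1 (.lit 0) (.lit 2)))))
    (.seq (assign 10 (.mul (.lit 2) (var 10)))
      (.seq (.setReg 2 (.add (.reg 2) (.lit 1))) (.setReg 3 (.add (.reg 3) (.lit 256))))))
  (forLoop 5 3 (.setReg 4 (.add (.reg 4) (.reg 3))))))

/-- The machine cannot round reals, so the logarithm L is found by doubling a real variable. It has
no product of naturals either: J = 256 L grows along with L, and the number J² of rounds is obtained
by repeated addition. -/
theorem tri_param {M : ℕ} (hM : 16 * (n * d) / (ε * τ) ≤ 2 ^ M) (hn : s.reg 0 = n)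
    (hd : s.reg 1 = d) (h2 : s.reg 2 = 0) (h3 : s.reg 3 = 0) (h4 : s.reg 4 = 0)
    (hε : s.arr 1 0 0 = ε) (hδ : s.arr 1 0 1 = δ) (hτ : s.arr 1 0 2 = τ) :
    Tri ω paramProgram s (100 + M * 3200) fun s' => s'.arr 12 0 0 = δ ^ 2 / ε ∧
      ∃ L ≤ M, 16 * (n * d) / (ε * τ) ≤ 2 ^ L ∧ s'.reg 2 = L ∧ s'.reg 3 = 256 * L ∧
        s'.reg 4 = (256 * L) * (256 * L) := by
  refine tri_seq (R := fun s' => s'.arr 12 0 0 = δ ^ 2 / ε) (c₁ := 20)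
    (tri_assign ?_ (by simp only [RealExpr.cost, NatExpr.cost]; norm_num)) (c₂ := 80 + M * 3200) ?_
    (by omega)
  · simp [RealExpr.eval, NatExpr.eval, hδ, hε, sq]
  intro s₁ f₁ e₁
  refine tri_seq (R := fun s' => s'.arr 10 0 0 = 1) (c₁ := 5)
    (tri_assign ?_ (by simp only [RealExpr.cost]; norm_num)) (c₂ := 70 + M * 3200) ?_ (by omega)
  · simp [RealExpr.eval]
  intro s₂ f₂ e₂
  have k0 : s₂.reg 0 = n := by rw [f₂.reg 0 (by decide), f₁.reg 0 (by decide), hn]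
  have k1 : s₂.reg 1 = d := by rw [f₂.reg 1 (by decide), f₁.reg 1 (by decide), hd]
  have k2 : s₂.reg 2 = 0 := by rw [f₂.reg 2 (by decide), f₁.reg 2 (by decide), h2]
  have k3 : s₂.reg 3 = 0 := by rw [f₂.reg 3 (by decide), f₁.reg 3 (by decide), h3]
  have k4 : s₂.reg 4 = 0 := by rw [f₂.reg 4 (by decide), f₁.reg 4 (by decide), h4]
  have g1 : s₂.arr 1 = s.arr 1 := by rw [f₂.arr 1 (by decide), f₁.arr 1 (by decide)]
  have g12 : s₂.arr 12 0 0 = δ ^ 2 / ε := by rw [f₂.arr 12 (by decide), e₁]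
  clear e₁ f₁ f₂
  refine tri_seq (tri_loop (m := fun s' => M - s'.reg 2) (c₁ := 30)
    (I := fun s' => s'.reg 0 = n ∧ s'.reg 1 = d ∧ s'.arr 1 = s.arr 1 ∧ s'.reg 2 ≤ M ∧
      s'.arr 10 0 0 = 2 ^ s'.reg 2 ∧ s'.reg 3 = 256 * s'.reg 2)
    ⟨k0, k1, g1, by omega, by rw [e₂, k2, pow_zero], by rw [k3, k2]⟩ ?_ le_rfl)
    (c₂ := 6 + M * 3100) ?_ (by
      simp only [Test.cost, RealExpr.cost, NatExpr.cost, k2, Nat.sub_zero]; omega)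
  · rintro s₃ f₃ ⟨i1, i2, i3, i4, i5, i6⟩ ht
    simp only [Test.Holds, RealExpr.eval, NatExpr.eval, i1, i2, i3, i5, hε, hτ,
      Rat.cast_ofNat] at ht
    have hlt : s₃.reg 2 < M := by
      by_contra hge
      exact absurd (ht.trans_le hM) (not_lt.mpr
        (pow_le_pow_right₀ one_le_two (not_lt.mp hge)))
    refine tri_seq (R := fun s' => s' = s₃.setArr 10 0 0 (2 * 2 ^ s₃.reg 2)) (c₁ := 10)
      (tri_assign ?_ (by simp only [RealExpr.cost, NatExpr.cost]; norm_num)) (c₂ := 10) ?_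
      (by norm_num)
    · simp [RealExpr.eval, NatExpr.eval, i5]
    rintro s₄ f₄ rfl
    refine tri_seq (R := fun s' => s' =
        (s₃.setArr 10 0 0 (2 * 2 ^ s₃.reg 2)).setReg 2 (s₃.reg 2 + 1)) (c₁ := 4)
      (tri_setReg rfl (by simp [NatExpr.cost])) (c₂ := 4) ?_ (by norm_num)
    rintro s₅ f₅ rfl
    refine tri_setReg ?_ (by simp [NatExpr.cost])
    simp only [NatExpr.eval, setReg_reg, setReg_arr, setArr_reg, setArr_arr_self]
    norm_num
    rw [setArr_arr_of_ne _ _ _ _ (by decide)]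
    refine ⟨⟨i1, i2, i3, hlt, by rw [pow_succ, mul_comm], by omega⟩, by omega⟩
  rintro s₃ f₃ ⟨⟨i1, i2, i3, i4, i5, i6⟩, ht⟩
  simp only [Test.Holds, RealExpr.eval, NatExpr.eval, i1, i2, i3, i5, hε, hτ, not_lt,
    Rat.cast_ofNat] at ht
  set L := s₃.reg 2 with hL
  refine (tri_for (N := 256 * L) (c₁ := 4) (I := fun k s' => s'.reg 4 = k * (256 * L))
    (by decide) (by decide) (by decide) i6 ?_ ?_ ?_).mono ?_ le_rfl
  · rw [setReg_reg_of_ne _ _ (by decide), f₃.reg 4 (by decide), k4, zero_mul]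
  · intro k hk s₄ f₄ _ hI
    refine tri_setReg ?_ (by simp [NatExpr.cost])
    rw [setReg_reg_of_ne _ _ (by decide), setReg_reg_self]
    simp only [NatExpr.eval, hI, f₄.reg 3 (by decide), i6]
    ring
  · omega
  · intro s₄ f₄ h
    refine ⟨by rw [f₄.arr 12 (by decide), f₃.arr 12 (by decide), g12], L, i4, ht, ?_, ?_, h⟩
    · rw [f₄.reg 2 (by decide)]
    · rw [f₄.reg 3 (by decide), i6]

/-- Make all points candidates of weight `1`. -/
def loadProgram : Program :=
  .seq (forLoop 5 0 (.seq (forLoop 6 1 (.setArr 3 (.reg 5) (.reg 6) (.get 0 (.reg 5) (.reg 6))))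
    (.setArr 9 (.lit 0) (.reg 5) (.lit 1))))
  (.seq (.setReg 9 (.lit 1))
  (assign 11 (.mul (.lit 2) (.mul (.ofNat (.reg 0)) (.add (.lit 1)
    (.div (.get 1 (.lit 0) (.lit 1)) (.get 1 (.lit 0) (.lit 0))))))))

theorem tri_load (hn : s.reg 0 = n) (hd : s.reg 1 = d) (hd0 : 0 < d) (hn0 : 0 < n)
    (hε : s.arr 1 0 0 = ε) (hδ : s.arr 1 0 1 = δ) :
    Tri ω loadProgram s (100 * (n * d)) fun s' => s'.reg 9 = 1 ∧
      s'.arr 11 0 0 = 2 * (n * (1 + δ / ε)) ∧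
      ∀ i < n, s'.arr 9 0 i = 1 ∧ ∀ j < d, s'.arr 3 i j = s.arr 0 i j := by
  have c1 : n ≤ n * d := Nat.le_mul_of_pos_right _ hd0
  have c2 : 1 ≤ n * d := Nat.mul_pos hn0 hd0
  refine tri_seq (tri_for (N := n) (c₁ := 12 + d * 14) (I := fun k s' => ∀ i < k,
    s'.arr 9 0 i = 1 ∧ ∀ j < d, s'.arr 3 i j = s.arr 0 i j) (by decide) (by decide) (by decide) hn
    (by simp) ?_ le_rfl) (c₂ := 40) ?_ (by linarith)
  · intro k hk s₁ f₁ hik hI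
    refine tri_seq (tri_fillRow (N := d) (k := k) (fun j => s.arr 0 k j) (by decide) (by decide)
      hik (by rw [f₁.reg 1 (by decide), hd]) ?_
      (by simp only [RealExpr.cost, NatExpr.cost]; exact le_rfl)) (c₂ := 6) ?_ (by omega)
    · intro j hj s₂ f₂ hij
      simp only [RealExpr.eval, NatExpr.eval, hij, f₂.reg 5 (by decide), hik, f₂.arr 0 (by decide),
        f₁.arr 0 (by decide)]
    rintro s₂ f₂ ⟨e₂, e₂'⟩
    refine tri_setArr ?_ (by simp only [RealExpr.cost, NatExpr.cost]; norm_num)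
    simp only [RealExpr.eval, NatExpr.eval, f₂.reg 5 (by decide), hik, setReg_arr, Rat.cast_one]
    intro i hi
    rw [setArr_arr_of_ne _ _ _ _ (by decide : 3 ≠ 9)]
    rcases Nat.lt_succ_iff_lt_or_eq.mp hi with hi | rfl
    · rw [setArr_arr, if_neg (by omega), f₂.arr 9 (by decide), e₂' i hi.ne]
      exact hI i hi
    · exact ⟨setArr_arr_self .., e₂⟩
  intro s₁ f₁ e₁
  refine tri_seq (R := fun s' => s' = s₁.setReg 9 1) (c₁ := 2)
    (tri_setReg rfl (by simp [NatExpr.cost])) (c₂ := 20) ?_ (by norm_num)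
  rintro s₂ f₂ rfl
  refine tri_assign ?_ (by simp only [RealExpr.cost, NatExpr.cost]; norm_num)
  simp only [RealExpr.eval, NatExpr.eval, setReg_arr, setArr_reg, setReg_reg_self, setArr_arr_self,
    setReg_reg_of_ne _ _ (by decide : 0 ≠ 9), f₁.reg 0 (by decide), hn, f₁.arr 1 (by decide), hδ,
    hε, setArr_arr_of_ne _ _ _ _ (by decide : 3 ≠ 11), setArr_arr_of_ne _ _ _ _ (by decide : 9 ≠ 11)]
  exact ⟨trivial, by push_cast; ring, e₁⟩

/-- The points, centered at `c`; those far from `c` are replaced by `0`. -/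
noncomputable def centered (S : Fin n → Vec d) (c : Fin d → ℝ) (ρ : ℝ) (i : Fin n) : Fin d → ℝ :=
  if ((S i).ofLp - c) ⬝ᵥ ((S i).ofLp - c) ≤ ρ ^ 2 then (S i).ofLp - c else 0

/-- Center and prune the points, and make all weights `1`. -/
def pruneProgram : Program :=
  forLoop 5 0 (.seq (.setArr 5 (.lit 0) (.reg 5) (.lit 1))
  (.seq (sumExpr 13 6 1 (.mul (.sub (.get 0 (.reg 5) (.reg 6)) (entry 3 6))
    (.sub (.get 0 (.reg 5) (.reg 6)) (entry 3 6))))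
  (.cond (.realLt (.mul (var 11) (var 11)) (var 13))
    (forLoop 6 1 (.setArr 4 (.reg 5) (.reg 6) (.lit 0)))
    (forLoop 6 1 (.setArr 4 (.reg 5) (.reg 6) (.sub (.get 0 (.reg 5) (.reg 6)) (entry 3 6)))))))

theorem tri_prune {ρ : ℝ} (hn : s.reg 0 = n) (hd : s.reg 1 = d) (hd0 : 0 < d) (hn0 : 0 < n)
    (hS : ∀ i : Fin n, ∀ j : Fin d, s.arr 0 i j = S i j) (hρ : s.arr 11 0 0 = ρ) :
    Tri ω pruneProgram s (150 * (n * d)) fun s' => ∀ i : Fin n, s'.arr 5 0 i = 1 ∧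
      ∀ j : Fin d, s'.arr 4 i j = centered S (candidate d s 0) ρ i j := by
  have c1 : n ≤ n * d := Nat.le_mul_of_pos_right _ hd0
  have c2 : 1 ≤ n * d := Nat.mul_pos hn0 hd0
  refine (tri_for (N := n) (c₁ := 60 + d * 50) (I := fun k s' => ∀ i : Fin n, i.1 < k →
    s'.arr 5 0 i = 1 ∧ ∀ j : Fin d, s'.arr 4 i j = centered S (candidate d s 0) ρ i j)
    (by decide) (by decide) (by decide) hn (by simp) ?_ (by linarith)).mono
    (fun s' _ h i => h i i.2) le_rfl
  intro k hk s₁ f₁ hik hI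
  refine tri_seq (R := fun s' => s' = s₁.setArr 5 0 k 1) (c₁ := 5)
    (tri_setArr (by simp [NatExpr.eval, RealExpr.eval, hik]) (by simp [NatExpr.cost, RealExpr.cost]))
    (c₂ := 50 + d * 50) ?_ (by omega)
  rintro s₂ f₂ rfl
  refine tri_seq (tri_sumExpr (N := d) (fun j => (s.arr 0 k j - s.arr 3 0 j) *
    (s.arr 0 k j - s.arr 3 0 j)) (by decide) (by rw [setArr_reg, f₁.reg 1 (by decide), hd]) ?_
    (by simp only [RealExpr.cost, NatExpr.cost]; exact le_rfl)) (c₂ := 30 + d * 20) ?_ (by omega)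
  · intro j hj s₃ f₃ hij
    simp only [RealExpr.eval, NatExpr.eval, hij, f₃.reg 5 (by decide), f₃.arr 0 (by decide),
      f₃.arr 3 (by decide), setArr_reg, hik, setArr_arr_of_ne _ _ _ _ (by decide : 0 ≠ 5),
      setArr_arr_of_ne _ _ _ _ (by decide : 3 ≠ 5), f₁.arr 0 (by decide), f₁.arr 3 (by decide)]
  intro s₃ f₃ e₃
  have k5 : s₃.reg 5 = k := by rw [f₃.reg 5 (by decide), setArr_reg, hik]
  have k1 : s₃.reg 1 = d := by rw [f₃.reg 1 (by decide), setArr_reg, f₁.reg 1 (by decide), hd]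
  have g0 : s₃.arr 0 = s.arr 0 := by
    rw [f₃.arr 0 (by decide), setArr_arr_of_ne _ _ _ _ (by decide), f₁.arr 0 (by decide)]
  have g3 : s₃.arr 3 = s.arr 3 := by
    rw [f₃.arr 3 (by decide), setArr_arr_of_ne _ _ _ _ (by decide), f₁.arr 3 (by decide)]
  have g4 : s₃.arr 4 = s₁.arr 4 := by
    rw [f₃.arr 4 (by decide), setArr_arr_of_ne _ _ _ _ (by decide)]
  have g11 : s₃.arr 11 0 0 = ρ := by
    rw [f₃.arr 11 (by decide), setArr_arr_of_ne _ _ _ _ (by decide), f₁.arr 11 (by decide), hρ]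
  have e₃' : s₃.arr 13 0 0 = ((S ⟨k, hk⟩).ofLp - candidate d s 0) ⬝ᵥ
      ((S ⟨k, hk⟩).ofLp - candidate d s 0) := by
    rw [e₃, sum_range]
    refine sum_congr rfl fun j _ => ?_
    rw [hS ⟨k, hk⟩ j]
    rfl
  have finish : ∀ s' : Memory, s'.arr 5 = s₃.arr 5 →
      (∀ j : Fin d, s'.arr 4 k j = centered S (candidate d s 0) ρ ⟨k, hk⟩ j) →
      (∀ l ≠ k, s'.arr 4 l = s₃.arr 4 l) → ∀ i : Fin n, i.1 < k + 1 →
      s'.arr 5 0 i = 1 ∧ ∀ j : Fin d, s'.arr 4 i j = centered S (candidate d s 0) ρ i j := by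
    intro s' h5 h4 h4' i hi
    rw [h5, f₃.arr 5 (by decide)]
    rcases Nat.lt_succ_iff_lt_or_eq.mp hi with hi | hi
    · rw [setArr_arr, if_neg (by omega), h4' i hi.ne, g4]
      exact hI i hi
    · have : i = ⟨k, hk⟩ := Fin.ext hi
      subst this
      exact ⟨setArr_arr_self .., h4⟩
  refine tri_cond (c₁ := 6 + d * 20) (fun h => ?_) (fun h => ?_)
    (by simp only [Test.cost, RealExpr.cost, NatExpr.cost]; omega)
  · simp only [Test.Holds, RealExpr.eval, NatExpr.eval, g11, e₃', ← sq] at h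
    refine (tri_fillRow (N := d) (k := k) (fun j => 0) (by decide) (by decide) k5 k1
      (fun j hj s₄ f₄ hij => by simp [RealExpr.eval])
      (by simp only [RealExpr.cost]; omega)).mono ?_ le_rfl
    rintro s₄ f₄ ⟨e₄, e₄'⟩
    refine finish s₄ (f₄.arr 5 (by decide)) (fun j => ?_) e₄'
    rw [e₄ j j.2, centered, if_neg (not_le.mpr h)]
    rfl
  · simp only [Test.Holds, RealExpr.eval, NatExpr.eval, g11, e₃', not_lt, ← sq] at h
    refine (tri_fillRow (N := d) (k := k) (fun j => s.arr 0 k j - s.arr 3 0 j) (by decide)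
      (by decide) k5 k1 (fun j hj s₄ f₄ hij => ?_)
      (by simp only [RealExpr.cost, NatExpr.cost]; omega)).mono ?_ le_rfl
    · simp only [RealExpr.eval, NatExpr.eval, hij, f₄.reg 5 (by decide), k5, f₄.arr 0 (by decide),
        f₄.arr 3 (by decide), g0, g3]
    rintro s₄ f₄ ⟨e₄, e₄'⟩
    refine finish s₄ (f₄.arr 5 (by decide)) (fun j => ?_) e₄'
    rw [e₄ j j.2, centered, if_pos h, hS ⟨k, hk⟩ j]
    rfl

/-- Everything that precedes the first round. -/
def prepareProgram : Program :=
  .seq paramProgram (.seq loadProgram (.seq centerProgram pruneProgram))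

/-- The memory before the first round. -/
structure Prepared (S : Fin n → Vec d) (ε δ : ℝ) (L : ℕ) (s : Memory) : Prop where
  reg_zero : s.reg 0 = n
  reg_one : s.reg 1 = d
  reg_three : s.reg 3 = 256 * L
  reg_four : s.reg 4 = (256 * L) * (256 * L)
  used : s.used = 0
  epsilon : s.arr 1 0 0 = ε
  lam : s.arr 12 0 0 = δ ^ 2 / ε
  radius : s.arr 11 0 0 = 2 * (3 ^ L * (n * (1 + δ / ε)))
  weights : ∀ i : Fin n, s.arr 5 0 i = 1
  points : ∀ i : Fin n, ∀ j : Fin d, s.arr 4 i j =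
    centered S (candidate d s 0) (2 * (3 ^ L * (n * (1 + δ / ε)))) i j

/-- The program knows neither G nor μ; they occur only in the last conclusion. The bound on n
ensures n ≤ 2^L, so that after L levels the first block contains all points. -/
theorem tri_prepare {M : ℕ} (hd0 : 0 < d) (hn0 : 0 < n) (hR : 0 ≤ n * (1 + δ / ε))
    (hM : 16 * (n * d) / (ε * τ) ≤ 2 ^ M) (hnX : (n : ℝ) ≤ 16 * (n * d) / (ε * τ))
    (G : Finset (Fin n)) (μ : Fin d → ℝ) :
    Tri ω prepareProgram (inputMemory S ε δ τ) ((400 + M * 3500) * (n * d)) fun s' =>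
      ∃ L ≤ M, 16 * (n * d) / (ε * τ) ≤ 2 ^ L ∧ Prepared S ε δ L s' ∧
        ((∀ i ∈ G, ((S i).ofLp - μ) ⬝ᵥ ((S i).ofLp - μ) ≤ (n * (1 + δ / ε)) ^ 2) →
          Gᶜ.card < G.card → (candidate d s' 0 - μ) ⬝ᵥ (candidate d s' 0 - μ) ≤
            (3 ^ L * (n * (1 + δ / ε))) ^ 2) := by
  have c2 : 1 ≤ n * d := Nat.mul_pos hn0 hd0
  have c3 : M * 1 ≤ M * (n * d) := Nat.mul_le_mul_left _ c2
  set s := inputMemory S ε δ τ with hs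
  refine tri_seq (tri_param (n := n) (d := d) (δ := δ) hM (by simp [hs, inputMemory])
    (by simp [hs, inputMemory]) (by simp [hs, inputMemory]) (by simp [hs, inputMemory])
    (by simp [hs, inputMemory]) (by simp [hs, inputMemory]) (by simp [hs, inputMemory])
    (by simp [hs, inputMemory])) (c₂ := (260 + M * 260) * (n * d)) ?_ (by linarith)
  rintro s₁ f₁ ⟨e₁, L, hLM, hXL, r2, r3, r4⟩
  have c4 : L * (n * d) ≤ M * (n * d) := Nat.mul_le_mul_right _ hLM
  have i0 : s.reg 0 = n := by simp [hs, inputMemory]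
  have i1 : s.reg 1 = d := by simp [hs, inputMemory]
  have iε : s.arr 1 0 0 = ε := by simp [hs, inputMemory]
  have iδ : s.arr 1 0 1 = δ := by simp [hs, inputMemory]
  have iS : ∀ i : Fin n, ∀ j : Fin d, s.arr 0 i j = S i j := by simp [hs, inputMemory]
  have iu : s.used = 0 := by simp [hs, inputMemory]
  refine tri_seq (tri_load (n := n) (d := d) (ε := ε) (δ := δ)
    (by rw [f₁.reg 0 (by decide), i0])
    (by rw [f₁.reg 1 (by decide), i1]) hd0 hn0 (by rw [f₁.arr 1 (by decide), iε])
    (by rw [f₁.arr 1 (by decide), iδ])) (c₂ := (156 + M * 260) * (n * d)) ?_ (by linarith)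
  rintro s₂ f₂ ⟨r9, e11, e₂⟩
  have hL9 : ((n : ℕ) : ℝ) ≤ ((2 ^ L : ℕ) : ℝ) := by push_cast; exact hnX.trans hXL
  have hnL : n ≤ 2 ^ L := by exact_mod_cast hL9
  refine tri_seq (tri_center (n := n) (d := d) (L := L) (r := n * (1 + δ / ε)) (μ := μ)
    (f := fun i => if h : i < n then if (⟨i, h⟩ : Fin n) ∈ G then 1 else -1 else 0)
    (by rw [f₂.reg 0 (by decide), f₁.reg 0 (by decide), i0])
    (by rw [f₂.reg 1 (by decide), f₁.reg 1 (by decide), i1]) hd0 hn0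
    (by rw [f₂.reg 2 (by decide), r2]) r9 hR e11 (fun i hi => dif_neg (by omega)))
    (c₂ := 150 * (n * d)) ?_ (by linarith)
  rintro s₃ f₃ ⟨e₃, e₃'⟩
  refine (tri_prune (n := n) (d := d) (S := S)
    (by rw [f₃.reg 0 (by decide), f₂.reg 0 (by decide), f₁.reg 0 (by decide), i0])
    (by rw [f₃.reg 1 (by decide), f₂.reg 1 (by decide), f₁.reg 1 (by decide), i1]) hd0 hn0
    (by rwa [f₃.arr 0 (by decide), f₂.arr 0 (by decide), f₁.arr 0 (by decide)]) e₃).mono ?_ le_rfl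
  intro s₄ f₄ e₄
  have hcand : candidate d s₄ 0 = candidate d s₃ 0 := candidate_congr (by rw [f₄.arr 3 (by decide)])
  refine ⟨L, hLM, hXL, ?_, fun hG hcard => ?_⟩
  · constructor
    · rw [f₄.reg 0 (by decide), f₃.reg 0 (by decide), f₂.reg 0 (by decide), f₁.reg 0 (by decide), i0]
    · rw [f₄.reg 1 (by decide), f₃.reg 1 (by decide), f₂.reg 1 (by decide), f₁.reg 1 (by decide), i1]
    · rw [f₄.reg 3 (by decide), f₃.reg 3 (by decide), f₂.reg 3 (by decide), r3]
    · rw [f₄.reg 4 (by decide), f₃.reg 4 (by decide), f₂.reg 4 (by decide), r4]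
    · rw [f₄.used (by decide), f₃.used (by decide), f₂.used (by decide), f₁.used (by decide), iu]
    · rw [f₄.arr 1 (by decide), f₃.arr 1 (by decide), f₂.arr 1 (by decide), f₁.arr 1 (by decide), iε]
    · rw [f₄.arr 12 (by decide), f₃.arr 12 (by decide), f₂.arr 12 (by decide), e₁]
    · rw [f₄.arr 11 (by decide), e₃]
    · exact fun i => (e₄ i).1
    · rw [hcand]
      exact fun i => (e₄ i).2
  · rw [hcand]
    -- The only remaining candidate leads by |G| - |Gᶜ| > 0. Were it far from μ, this lead would be
    -- at most minus its nonnegative weight.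
    have lead := e₃' ?_ 0 (by simpa using hn0)
    · by_contra hfar
      rw [mul_zero] at lead
      have h1 := lead.2.2 hfar
      have h2 := lead.1
      have h3 : ∀ x, n ≤ x → (if h : 0 + x < n then if (⟨0 + x, h⟩ : Fin n) ∈ G then (1 : ℝ)
          else -1 else 0) = 0 := fun x hx => dif_neg (by omega)
      have h4 : ∑ x ∈ range (2 ^ L), (if h : 0 + x < n then if (⟨0 + x, h⟩ : Fin n) ∈ G
          then (1 : ℝ) else -1 else 0) = (G.card : ℝ) - Gᶜ.card := by
        obtain ⟨m, hm⟩ := Nat.exists_eq_add_of_le hnL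
        rw [hm, sum_range_add, sum_eq_zero (s := range m) (fun x _ => h3 _ (by omega)), add_zero,
          sum_range]
        simp only [zero_add, Fin.is_lt, dif_pos, Fin.eta]
        rw [← sum_add_sum_compl G, sum_congr rfl (fun i hi => if_pos hi),
          sum_congr (s₁ := Gᶜ) rfl (fun i hi => if_neg (mem_compl.mp hi))]
        simp [sub_eq_add_neg]
      rw [h4] at h1
      have h5 : (Gᶜ.card : ℝ) < G.card := by exact_mod_cast hcard
      linarith
    · intro i hi
      rw [one_mul] at hi ⊢
      have hc : candidate d s₂ i = (S ⟨i, hi⟩).ofLp := by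
        funext j
        rw [candidate, (e₂ i hi).2 j j.2, f₁.arr 0 (by decide)]
        exact iS ⟨i, hi⟩ j
      simp only [range_one, sum_singleton, add_zero, hi, dif_pos]
      rw [hc, (e₂ i hi).1]
      split_ifs with hiG
      · exact ⟨zero_le_one, le_rfl, fun h => absurd (hG _ hiG) h⟩
      · exact ⟨zero_le_one, by norm_num, fun _ => le_rfl⟩

/-- Run the rounds, and output the weighted mean. -/
def estimateProgram : Program :=
  .seq (forLoop 8 4 roundProgram)
  (.seq (sumExpr 14 5 0 (entry 5 5))
  (forLoop 6 1 (.seq (sumExpr 16 5 0 (.mul (entry 5 5) (.get 4 (.reg 5) (.reg 6))))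
    (.setArr 2 (.lit 0) (.reg 6) (.add (entry 3 6) (.div (var 16) (var 14)))))))

theorem tri_estimate {L : ℕ} (hd0 : 0 < d) (hn0 : 0 < n) (h : Prepared S ε δ L s) :
    Tri ω estimateProgram s ((100 + (256 * L) * (256 * L) * (700 + 256 * L * 600)) * (n * d))
      fun s' => ∀ (X : Fin n → Fin d → ℝ) (w : Fin n → ℝ),
        X = centered S (candidate d s 0) (2 * (3 ^ L * (n * (1 + δ / ε)))) →
        w = weightsAt X ε (δ ^ 2 / ε) (2 * (3 ^ L * (n * (1 + δ / ε)))) (256 * L)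
          (fun t j => ω (t * d + j)) ((256 * L) * (256 * L)) →
        (outputVec d s').ofLp = candidate d s 0 + (∑ i, w i)⁻¹ • ∑ i, w i • X i := by
  have c1 : n ≤ n * d := Nat.le_mul_of_pos_right _ hd0
  have c2 : 1 ≤ n * d := Nat.mul_pos hn0 hd0
  have c3 : d ≤ n * d := Nat.le_mul_of_pos_left _ hn0
  set ρ := 2 * (3 ^ L * (n * (1 + δ / ε)))
  set X := centered S (candidate d s 0) ρ
  set J := 256 * L
  have c4 : J * J * 1 ≤ J * J * (n * d) := Nat.mul_le_mul_left _ c2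
  refine tri_seq (tri_for (N := J * J) (c₁ := 600 * (n * d) + J * (600 * (n * d)))
    -- The preparation tosses no coin, so round t uses exactly the coins t·d, …, t·d + d - 1.
    (I := fun t s' => s'.used = t * d ∧ ∀ i : Fin n, s'.arr 5 0 i =
      weightsAt X ε (δ ^ 2 / ε) ρ J (fun t j => ω (t * d + j)) t i)
    (by decide) (by decide) (by decide) h.reg_four ⟨by simpa using h.used, h.weights⟩ ?_ le_rfl)
    (c₂ := 94 * (n * d)) ?_ (by nlinarith)
  · rintro t ht s₁ f₁ - ⟨h1, h2⟩
    refine (tri_round (X := X) (ε := ε) (lam := δ ^ 2 / ε) (ρ := ρ) (J := J)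
      (by rw [f₁.reg 0 (by decide), h.reg_zero]) (by rw [f₁.reg 1 (by decide), h.reg_one]) hd0 hn0
      (by rw [f₁.reg 3 (by decide), h.reg_three]) (by rw [f₁.arr 4 (by decide)]; exact h.points)
      h2 (by rw [f₁.arr 1 (by decide), h.epsilon]) (by rw [f₁.arr 12 (by decide), h.lam])
      (by rw [f₁.arr 11 (by decide), h.radius])).mono ?_ le_rfl
    rintro s₂ f₂ ⟨h3, h4⟩
    refine ⟨by rw [setReg_used, h3, h1]; ring, fun i => ?_⟩
    rw [setReg_arr, h4 i, h1]
    rfl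
  rintro s₁ f₁ ⟨-, h2⟩
  set w := weightsAt X ε (δ ^ 2 / ε) ρ J (fun t j => ω (t * d + j)) (J * J)
  have k0 : s₁.reg 0 = n := by rw [f₁.reg 0 (by decide), h.reg_zero]
  have k1 : s₁.reg 1 = d := by rw [f₁.reg 1 (by decide), h.reg_one]
  have g4 : ∀ i : Fin n, ∀ j : Fin d, s₁.arr 4 i j = X i j := by
    rw [f₁.arr 4 (by decide)]; exact h.points
  have g3 : s₁.arr 3 = s.arr 3 := f₁.arr 3 (by decide)
  clear f₁
  refine tri_seq (tri_sumExpr (N := n) (fun i => s₁.arr 5 0 i) (by decide) k0 ?_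
    (by simp only [RealExpr.cost, NatExpr.cost]; exact le_rfl)) (c₂ := 64 * (n * d)) ?_
    (by linarith)
  · intro i hi s₂ f₂ hii
    simp only [RealExpr.eval, NatExpr.eval, hii, f₂.arr 5 (by decide)]
  intro s₂ f₂ e₂
  refine (tri_fillLoop (a := 2) (N := d) (c₁ := 24 + n * 22) (fun j => s.arr 3 0 j +
    (∑ i ∈ range n, s₁.arr 5 0 i * s₁.arr 4 i j) / ∑ i ∈ range n, s₁.arr 5 0 i)
    (by decide) (by decide) (by decide) (by rw [f₂.reg 1 (by decide), k1]) ?_ (by linarith)).mono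
    ?_ le_rfl
  · intro j hj s₃ f₃ hij _
    refine tri_seq (tri_sumExpr (N := n) (fun i => s₁.arr 5 0 i * s₁.arr 4 i j) (by decide)
      (by rw [f₃.reg 0 (by decide), f₂.reg 0 (by decide), k0]) ?_
      (by simp only [RealExpr.cost, NatExpr.cost]; exact le_rfl)) (c₂ := 14) ?_ (by omega)
    · intro i hi s₄ f₄ hii
      simp only [RealExpr.eval, NatExpr.eval, hii, f₄.arr 5 (by decide), f₄.arr 4 (by decide),
        f₄.reg 6 (by decide), hij, f₃.arr 5 (by decide), f₃.arr 4 (by decide),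
        f₂.arr 5 (by decide), f₂.arr 4 (by decide)]
    intro s₄ f₄ e₄
    refine tri_setArr ?_ (by simp only [RealExpr.cost, NatExpr.cost]; norm_num)
    simp only [RealExpr.eval, NatExpr.eval, f₄.reg 6 (by decide), hij, e₄, f₄.arr 14 (by decide),
      f₃.arr 14 (by decide), e₂, f₄.arr 3 (by decide), f₃.arr 3 (by decide), f₂.arr 3 (by decide),
      g3, setArr_arr_self, true_and]
    intro k' hk'
    simp [setArr_arr, hk', f₄.arr 2 (by decide)]
  · rintro s₃ f₃ h3 _ _ rfl rfl
    funext j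
    simp only [outputVec, h3 j j.2, sum_range, h2, g4, Pi.add_apply, Pi.smul_apply, Finset.sum_apply,
      smul_eq_mul, candidate, inv_mul_eq_div]
    rfl

end RobustMean

namespace RobustMean

open Matrix Finset RealRAM

variable {n d : ℕ}

/-! ### The choice of the parameters -/

section Parameters

variable {ε δ τ : ℝ} {L : ℕ}

/-- One condition on L serves several purposes: enough levels for the tournament, a bound on the
pruning radius, a failure probability of at most τ, and enough steps for the searches. -/
theorem le_two_pow_of_parameters (hd : 0 < d) (hn : 0 < n) (hε : 0 < ε) (hε1 : ε < 1 / 1000)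
    (hτ : 0 < τ) (hτ1 : τ < 1) (hL : 16 * (n * d) / (ε * τ) ≤ 2 ^ L) :
    0 < L ∧ 16 * (n : ℝ) ≤ ε * 2 ^ L ∧ 16 * (d : ℝ) ≤ τ * 2 ^ L ∧ (n : ℝ) ≤ 2 ^ L ∧
      16 * (d : ℝ) ≤ 2 ^ L := by
  have hn' : (1 : ℝ) ≤ n := by exact_mod_cast hn
  have hd' : (1 : ℝ) ≤ d := by exact_mod_cast hd
  have hY : (0 : ℝ) < 2 ^ L := by positivity
  rw [div_le_iff₀ (by positivity)] at hL
  have h1 : 2 ^ L * (ε * τ) ≤ ε * 2 ^ L := by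
    nlinarith [mul_pos hY hε]
  have h2 : 2 ^ L * (ε * τ) ≤ τ * 2 ^ L := by
    nlinarith [mul_pos hY hτ]
  have hnd : (n : ℝ) ≤ n * d := le_mul_of_one_le_right (by linarith) hd'
  have hdn : (d : ℝ) ≤ n * d := le_mul_of_one_le_left (by linarith) hn'
  have h3 : ε * 2 ^ L ≤ 2 ^ L := by nlinarith
  have h4 : τ * 2 ^ L ≤ 2 ^ L := by nlinarith
  refine ⟨?_, by linarith, by linarith, by linarith, by linarith⟩
  rcases Nat.eq_zero_or_pos L with rfl | h
  · norm_num at h4 h3 h2 hL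
    linarith
  · exact h

/-- Since 1 + δ/ε ≤ 2δ/ε, the left side is at most 9^L · (16n²/ε) · δ²/ε. The first factor is at
most 2^(4L), the second at most 2^(2L). -/
theorem radius_sq_le (hn : 0 < n) (hε : 0 < ε) (hδ : ε ≤ δ) (h1 : 16 * (n : ℝ) ≤ ε * 2 ^ L)
    (h2 : (n : ℝ) ≤ 2 ^ L) :
    (2 * (3 ^ L * (n * (1 + δ / ε)))) ^ 2 ≤ 2 ^ (6 * L) * (δ ^ 2 / ε) := by
  have hδ0 : 0 < δ := hε.trans_le hδ
  have hn' : (0 : ℝ) < n := by exact_mod_cast hn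
  have e1 : 1 + δ / ε ≤ 2 * (δ / ε) := by
    have : 1 ≤ δ / ε := (one_le_div hε).mpr hδ
    linarith
  have e2 : (2 * (3 ^ L * (n * (1 + δ / ε)))) ^ 2 ≤ (2 * (3 ^ L * (n * (2 * (δ / ε))))) ^ 2 := by
    gcongr
  refine e2.trans ?_
  have e3 : (2 * (3 ^ L * (n * (2 * (δ / ε))))) ^ 2 =
      9 ^ L * (16 * n * n / ε) * (δ ^ 2 / ε) := by
    rw [show (9 : ℝ) ^ L = (3 ^ L) ^ 2 by rw [← pow_mul, mul_comm, pow_mul]; norm_num]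
    field_simp
    ring
  rw [e3]
  refine mul_le_mul_of_nonneg_right ?_ (by positivity)
  have e4 : 16 * n * n / ε ≤ (2 : ℝ) ^ L * 2 ^ L := by
    rw [div_le_iff₀ hε]
    calc 16 * (n : ℝ) * n ≤ (ε * 2 ^ L) * 2 ^ L := by gcongr
      _ = _ := by ring
  calc (9 : ℝ) ^ L * (16 * n * n / ε) ≤ 16 ^ L * (2 ^ L * 2 ^ L) := by gcongr; norm_num
    _ = 2 ^ (6 * L) := by
      rw [← mul_pow, ← mul_pow, pow_mul]; norm_num

/-- The ratio to be made up is at most 2^(6L(2J+1)) ≤ 2^(18LJ). As (9/10)⁷ < 1/2, 126 LJ rounds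
suffice, and J² = 256 LJ. -/
theorem pow_mul_radius_le {J : ℕ} {lam ρ : ℝ} (hlam : 0 ≤ lam)
    (hρ : ρ ^ 2 ≤ 2 ^ (6 * L) * lam) (hJ : J = 256 * L) :
    (9 / 10) ^ (J * J) * (ρ ^ 2 + 5 * lam) ^ (2 * J + 1) ≤ (93000 * lam) ^ (2 * J + 1) := by
  rcases Nat.eq_zero_or_pos L with rfl | hL
  · subst hJ
    simp only [mul_zero, pow_zero, one_mul, zero_add, pow_one] at *
    linarith
  have h1 : ρ ^ 2 + 5 * lam ≤ 2 ^ (6 * L) * (93000 * lam) := by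
    have : (1 : ℝ) ≤ 2 ^ (6 * L) := one_le_pow₀ one_le_two
    nlinarith [mul_nonneg (sub_nonneg.mpr this) hlam]
  have h2 : (9 / 10 : ℝ) ^ (J * J) * (2 ^ (6 * L)) ^ (2 * J + 1) ≤ 1 := by
    have e1 : (9 / 10 : ℝ) ^ (J * J) ≤ (9 / 10) ^ (7 * (18 * (L * J))) := by
      refine pow_le_pow_of_le_one (by norm_num) (by norm_num) ?_
      calc 7 * (18 * (L * J)) = 126 * (L * J) := by ring
        _ ≤ 256 * (L * J) := by omega
        _ = J * J := by rw [hJ]; ring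
    have e2 : ((2 : ℝ) ^ (6 * L)) ^ (2 * J + 1) ≤ 2 ^ (18 * (L * J)) := by
      rw [← pow_mul]
      refine pow_le_pow_right₀ one_le_two ?_
      calc 6 * L * (2 * J + 1) ≤ 6 * L * (3 * J) := Nat.mul_le_mul_left _ (by omega)
        _ = 18 * (L * J) := by ring
    calc (9 / 10 : ℝ) ^ (J * J) * (2 ^ (6 * L)) ^ (2 * J + 1)
        ≤ (9 / 10) ^ (7 * (18 * (L * J))) * 2 ^ (18 * (L * J)) := by gcongr
      _ = ((9 / 10) ^ 7 * 2) ^ (18 * (L * J)) := by rw [pow_mul, mul_pow]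
      _ ≤ 1 := pow_le_one₀ (by norm_num) (by norm_num)
  calc (9 / 10) ^ (J * J) * (ρ ^ 2 + 5 * lam) ^ (2 * J + 1)
      ≤ (9 / 10) ^ (J * J) * (2 ^ (6 * L) * (93000 * lam)) ^ (2 * J + 1) := by gcongr
    _ = ((9 / 10) ^ (J * J) * (2 ^ (6 * L)) ^ (2 * J + 1)) * (93000 * lam) ^ (2 * J + 1) := by
      rw [mul_pow]; ring
    _ ≤ 1 * (93000 * lam) ^ (2 * J + 1) := by gcongr
    _ = _ := one_mul _

/-- The size of the input, up to logarithmic factors in the running time. -/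
noncomputable def logSize (d n : ℕ) (ε τ : ℝ) : ℝ :=
  1 + Real.log d + Real.log n + Real.log (1 / ε) + Real.log (1 / τ)

theorem exists_two_pow_le (hd : 0 < d) (hn : 0 < n) (hε : 0 < ε) (hε1 : ε < 1 / 1000)
    (hτ : 0 < τ) (hτ1 : τ < 1) :
    ∃ M : ℕ, 16 * (n * d) / (ε * τ) ≤ 2 ^ M ∧ (1 + M : ℝ) ≤ 8 * logSize d n ε τ := by
  have hn' : (1 : ℝ) ≤ n := by exact_mod_cast hn
  have hd' : (1 : ℝ) ≤ d := by exact_mod_cast hd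
  set X := 16 * ((n : ℝ) * d) / (ε * τ) with hX
  have hX0 : 0 < X := by positivity
  have hlog : Real.log X = Real.log 16 + (logSize d n ε τ - 1) := by
    rw [hX, Real.log_div (by positivity) (by positivity), Real.log_mul (by norm_num) (by positivity),
      Real.log_mul (by positivity) (by positivity), Real.log_mul hε.ne' hτ.ne', logSize,
      one_div, one_div, Real.log_inv, Real.log_inv]
    ring
  have h16 : Real.log 16 = 4 * Real.log 2 := by
    rw [show (16 : ℝ) = 2 ^ 4 by norm_num, Real.log_pow]; norm_num
  have hl : 1 ≤ logSize d n ε τ := by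
    have a1 := Real.log_nonneg hn'
    have a2 := Real.log_nonneg hd'
    have a3 : 0 ≤ Real.log (1 / ε) := Real.log_nonneg (by rw [le_div_iff₀ hε]; linarith)
    have a4 : 0 ≤ Real.log (1 / τ) := Real.log_nonneg (by rw [le_div_iff₀ hτ]; linarith)
    rw [logSize]
    linarith
  have hl2 := Real.log_two_gt_d9
  -- log X is log 16 plus the four logarithms in `logSize`, and 1/log 2 ≤ 2.
  have hb : Real.logb 2 X ≤ 4 + 2 * (logSize d n ε τ - 1) := by
    rw [Real.logb, div_le_iff₀ (by linarith), hlog, h16]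
    nlinarith
  have hb0 : 0 ≤ Real.logb 2 X := by
    refine div_nonneg ?_ (by linarith)
    rw [hlog, h16]
    linarith
  refine ⟨⌈Real.logb 2 X⌉₊, ?_, ?_⟩
  · have := Real.rpow_le_rpow_of_exponent_le one_le_two (Nat.le_ceil (Real.logb 2 X))
    rwa [Real.rpow_logb (by norm_num) (by norm_num) hX0, Real.rpow_natCast] at this
  · have := Nat.ceil_lt_add_one hb0
    linarith

theorem steps_le {M L t₁ t₂ : ℕ} {Λ : ℝ} (hLM : L ≤ M) (hM : (1 + M : ℝ) ≤ 8 * Λ)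
    (h₁ : t₁ ≤ (400 + M * 3500) * (n * d))
    (h₂ : t₂ ≤ (100 + (256 * L) * (256 * L) * (700 + 256 * L * 600)) * (n * d)) :
    ((t₁ + t₂ : ℕ) : ℝ) ≤ 10 ^ 14 * (n * d * Λ ^ 3) := by
  -- J² rounds of J products each make the count cubic in L, with leading coefficient 600 · 256³ ≈
  -- 1.01 · 10¹⁰. The factor 8³ enters with M.
  have h3 : t₁ + t₂ ≤ 15000000000 * (1 + M) ^ 3 * (n * d) := by
    have e1 : (256 * L) * (256 * L) * (700 + 256 * L * 600) ≤
        (256 * M) * (256 * M) * (700 + 256 * M * 600) := by gcongr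
    calc t₁ + t₂ ≤ ((400 + M * 3500) + (100 + (256 * M) * (256 * M) * (700 + 256 * M * 600))) *
          (n * d) := by
          rw [add_mul]
          exact add_le_add h₁ (h₂.trans (Nat.mul_le_mul_right _ (by omega)))
      _ ≤ _ := by
          refine Nat.mul_le_mul_right _ ?_
          ring_nf
          nlinarith [Nat.zero_le M]
  have h4 : ((t₁ + t₂ : ℕ) : ℝ) ≤ 15000000000 * (1 + M : ℝ) ^ 3 * (n * d) := by exact_mod_cast h3
  refine h4.trans ?_
  have h5 : (1 + M : ℝ) ^ 3 ≤ (8 * Λ) ^ 3 := pow_le_pow_left₀ (by positivity) hM 3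
  calc 15000000000 * (1 + M : ℝ) ^ 3 * (n * d) ≤ 15000000000 * (8 * Λ) ^ 3 * (n * d) := by gcongr
    _ = 7680000000000 * (n * d * Λ ^ 3) := by ring
    _ ≤ _ := by
      have : 0 ≤ (n : ℝ) * d * Λ ^ 3 := by
        have : (0 : ℝ) ≤ 8 * Λ := le_trans (by positivity) hM
        have : 0 ≤ Λ := by linarith
        positivity
      nlinarith

end Parameters

/-! ### Correctness -/

/-- The algorithm. -/
def program : Program := .seq prepareProgram estimateProgram

section Correctness

variable {ε δ τ : ℝ} {S S₀ : Fin n → Vec d} {μ : Vec d} {c : Fin d → ℝ} {G : Finset (Fin n)} {L : ℕ}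

theorem IsStable.setup {y : Fin n → Vec d} (h : IsStable y (2 * ε) δ μ) (hd : 0 < d) (hn : 0 < n)
    (hε : 0 < ε) (hε1 : ε < 1 / 1000) (hδ : ε ≤ δ) (hτ : 0 < τ) (hτ1 : τ < 1)
    (hL : 16 * (n * d) / (ε * τ) ≤ 2 ^ L) (hG : (Gᶜ.card : ℝ) ≤ ε * n)
    (hGy : ∀ i ∈ G, S i = y i)
    (hc : (c - μ.ofLp) ⬝ᵥ (c - μ.ofLp) ≤ (3 ^ L * (n * (1 + δ / ε))) ^ 2) :
    Setup (centered S c (2 * (3 ^ L * (n * (1 + δ / ε))))) G (μ.ofLp - c) ε (δ ^ 2 / ε)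
      (2 * (3 ^ L * (n * (1 + δ / ε)))) (256 * L) := by
  obtain ⟨hL0, p1, -, p3, p4⟩ := le_two_pow_of_parameters hd hn hε hε1 hτ hτ1 hL
  have hδ0 : 0 < δ := hε.trans_le hδ
  have hρ := radius_sq_le (L := L) hn hε hδ p1 p3
  set R := (n : ℝ) * (1 + δ / ε) with hR
  have hR0 : 0 ≤ R := by positivity
  have h3 : R ≤ 3 ^ L * R := le_mul_of_one_le_left hR0 (one_le_pow₀ (by norm_num))
  have hc' : (μ.ofLp - c) ⬝ᵥ (μ.ofLp - c) ≤ (3 ^ L * R) ^ 2 := by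
    rwa [← neg_sub, neg_dotProduct_neg]
  -- Pruning spares the good points: they are within R of μ, and c is within 3^L R of μ, so their
  -- distance from c is at most 2 · 3^L R.
  have hreg := h.regular hn hε hε1.le hδ (X := centered S c (2 * (3 ^ L * R))) (c := c) hG
    (fun i hi => by
      have := dotProduct_self_le_of_add (e := (S i).ofLp - c) (a := (y i).ofLp - μ.ofLp)
        (b := μ.ofLp - c) (by rw [hGy i hi]; simp) hR0 (by positivity)
        (h.dist_sq_le hn hε hε1.le hδ i) hc'
      rw [centered, if_pos, hGy i hi]
      exact this.trans (pow_le_pow_left₀ (by positivity) (by linarith) 2))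
  refine { hreg with
    n_pos := hn, ε_pos := hε, ε_le := hε1.le, le_lam := ?_, ρ_nonneg := by positivity,
    norm_X := fun i => ?_, norm_μ := ?_, J_pos := by omega, le_two_pow := ?_ }
  · rw [le_div_iff₀ hε, sq]
    exact mul_le_mul hδ hδ hε.le hδ0.le
  · rw [centered]
    split_ifs with hi
    · exact hi
    · simp only [dotProduct_zero]; positivity
  · exact hc'.trans (pow_le_pow_left₀ (by positivity) (by linarith) 2)
  · have hlam : 0 ≤ δ ^ 2 / ε := by positivity
    have e1 : (64 : ℝ) * d ≤ 2 ^ (L + 2) := by rw [pow_add]; linarith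
    calc 64 * (d : ℝ) * (2 * (3 ^ L * R)) ^ 2 ≤ 2 ^ (L + 2) * (2 ^ (6 * L) * (δ ^ 2 / ε)) := by
          gcongr
      _ = 2 ^ (L + 2 + 6 * L) * (δ ^ 2 / ε) := by rw [pow_add _ (L + 2)]; ring
      _ ≤ 2 ^ (256 * L) * (δ ^ 2 / ε) := by
          gcongr
          · norm_num
          · omega

theorem Setup.norm_sub_le {X : Fin n → Fin d → ℝ} {ρ : ℝ} {J : ℕ} {w : Fin n → ℝ} {o : Vec d}
    (h : Setup X G (μ.ofLp - c) ε (δ ^ 2 / ε) ρ J) (hδ : 0 ≤ δ) (hw : Balanced G w)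
    (hc : ∀ u : Fin d → ℝ, u ⬝ᵥ (covMat X (1 - 5 * (δ ^ 2 / ε)) w *ᵥ u) ≤
      186000 * (δ ^ 2 / ε) * (u ⬝ᵥ u))
    (ho : o.ofLp = c + (∑ i, w i)⁻¹ • ∑ i, w i • X i) : ‖μ - o‖ ≤ 700 * δ := by
  set u := (∑ i, w i)⁻¹ • ∑ i, w i • X i - (μ.ofLp - c) with hu
  -- The bound is tested in the direction of the error u itself; finally 400000 ≤ 700².
  have h1 := h.weightedMean_close hw hc u
  rw [← hu, mul_div_cancel₀ _ h.ε_pos.ne'] at h1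
  have h2 : ‖μ - o‖ ^ 2 = u ⬝ᵥ u := by
    rw [EuclideanSpace.real_norm_sq_eq, dotProduct]
    refine sum_congr rfl fun j _ => ?_
    have : (μ - o) j = - u j := by
      simp only [PiLp.sub_apply, ho, hu, Pi.add_apply, Pi.sub_apply]
      ring
    rw [this]
    ring
  have h3 : u ⬝ᵥ u ≤ 400000 * δ ^ 2 := by
    by_contra! hlt
    have : 0 < u ⬝ᵥ u := lt_of_le_of_lt (by positivity) hlt
    nlinarith
  refine abs_le_of_sq_le_sq' (a := ‖μ - o‖) ?_ (by positivity) |>.2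
  rw [h2]
  nlinarith [sq_nonneg δ]

theorem exists_goodSet (h : IsCorruptedVersion ε S₀ S) : ∃ (σ : Equiv.Perm (Fin n))
    (G : Finset (Fin n)), (Gᶜ.card : ℝ) ≤ ε * n ∧ ∀ i ∈ G, S i = S₀ (σ i) := by
  classical
  obtain ⟨σ, hσ⟩ := h
  refine ⟨σ, univ.filter fun i => S i = S₀ (σ i), ?_, fun i hi => (mem_filter.mp hi).2⟩
  rw [← Set.ncard_coe_finset]
  convert hσ using 3
  ext i
  simp

theorem card_compl_lt (hn : 0 < n) (hε1 : ε < 1 / 1000) (hG : (Gᶜ.card : ℝ) ≤ ε * n) :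
    Gᶜ.card < G.card := by
  have hn' : (0 : ℝ) < n := by exact_mod_cast hn
  have h1 : (Gᶜ.card : ℝ) + G.card = n := by
    exact_mod_cast (card_compl_add_card G).trans (Fintype.card_fin n)
  have : (Gᶜ.card : ℝ) < G.card := by nlinarith
  exact_mod_cast this

theorem natCast_le_parameter (hd : 0 < d) (hε : 0 < ε) (hε1 : ε < 1 / 1000) (hτ : 0 < τ)
    (hτ1 : τ < 1) : (n : ℝ) ≤ 16 * (n * d) / (ε * τ) := by
  have hd' : (1 : ℝ) ≤ d := by exact_mod_cast hd
  have hn' : (0 : ℝ) ≤ n := Nat.cast_nonneg n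
  rw [le_div_iff₀ (by positivity)]
  have h1 : ε * τ ≤ 1 := mul_le_one₀ (by linarith) hτ.le hτ1.le
  nlinarith [mul_le_mul_of_nonneg_left h1 hn', mul_le_mul_of_nonneg_left hd' hn']

theorem exists_exec_program (hd : 0 < d) (hn : 0 < n) (hε : 0 < ε) (hε1 : ε < 1 / 1000)
    (hδ : ε ≤ δ) (hτ : 0 < τ) (hτ1 : τ < 1) (S : Fin n → Vec d) (ω : ℕ → Bool) :
    ∃ (t : ℕ) (s : Memory), Exec ω program (inputMemory S ε δ τ) t s ∧
      (t : ℝ) ≤ 10 ^ 14 * (n * d * logSize d n ε τ ^ 3) := by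
  obtain ⟨M, hM, hM'⟩ := exists_two_pow_le hd hn hε hε1 hτ hτ1
  have hδ0 : 0 < δ := hε.trans_le hδ
  -- Only the running time matters here, so G and μ are arbitrary.
  obtain ⟨t₁, s₁, e₁, h₁, L, hLM, -, hs, -⟩ := tri_prepare (ω := ω) (δ := δ) (S := S) hd hn
    (by positivity) hM (natCast_le_parameter hd hε hε1 hτ hτ1) ∅ 0
  obtain ⟨t₂, s₂, e₂, h₂, -⟩ := tri_estimate (ω := ω) hd hn hs
  exact ⟨_, _, .seq e₁ e₂, steps_le hLM hM' h₁ h₂⟩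

theorem ofReal_le_coins_program (hd : 0 < d) (hn : 0 < n) (hε : 0 < ε) (hε1 : ε < 1 / 1000)
    (hδ : ε ≤ δ) (hτ : 0 < τ) (hτ1 : τ < 1) (hS₀ : IsStable S₀ (2 * ε) δ μ)
    (hS : IsCorruptedVersion ε S₀ S) :
    ENNReal.ofReal (1 - τ) ≤ coins {ω : ℕ → Bool | ∃ (t : ℕ) (s : Memory),
      Exec ω program (inputMemory S ε δ τ) t s ∧ ‖μ - outputVec d s‖ ≤ 700 * δ} := by
  obtain ⟨M, hM, -⟩ := exists_two_pow_le hd hn hε hε1 hτ hτ1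
  obtain ⟨σ, G, hG, hGS⟩ := exists_goodSet hS
  have hst := hS₀.comp_perm σ
  have hδ0 : 0 < δ := hε.trans_le hδ
  -- The preparation is run with dummy coins; it tosses none, so this execution is valid for every
  -- ω, and L and the rough center are fixed before the probability is estimated.
  obtain ⟨t₁, s₁, e₁, -, L, -, hL, hs, hc⟩ := tri_prepare (ω := fun _ => false) (δ := δ) (S := S)
    hd hn (by positivity) hM (natCast_le_parameter hd hε hε1 hτ hτ1) G μ.ofLp
  replace hc := hc (fun i hi => by
    rw [hGS i hi]; exact hst.dist_sq_le hn hε hε1.le hδ i) (card_compl_lt hn hε1 hG)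
  have hset := hst.setup hd hn hε hε1 hδ hτ hτ1 hL hG hGS hc
  obtain ⟨hL0, p1, p2, p3, p4⟩ := le_two_pow_of_parameters hd hn hε hε1 hτ hτ1 hL
  have hcard := hset.card_bad_le (T := (256 * L) * (256 * L)) (τ := τ) hd
    (pow_mul_radius_le (by positivity) (radius_sq_le hn hε hδ p1 p3) rfl) (by
      have : (2 : ℝ) ^ L ≤ 2 ^ (2 * (256 * L) + 1) := pow_le_pow_right₀ one_le_two (by omega)
      have := mul_le_mul_of_nonneg_left this hτ.le
      have : (0 : ℝ) ≤ d := Nat.cast_nonneg d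
      linarith)
  refine (ofReal_le_coins hd hcard).trans (MeasureTheory.measure_mono fun ω hω => ?_)
  obtain ⟨t₂, s₂, e₂, -, h₂⟩ := tri_estimate (ω := ω) hd hn hs
  refine ⟨_, s₂, .seq (e₁.of_tosses_eq_false (by decide)) e₂, ?_⟩
  refine hset.norm_sub_le hδ0.le (hset.balanced_weightsAt _ _) ?_ (h₂ _ _ rfl rfl)
  -- The counting bound concerns finitely many rounds, the program reads from an infinite sequence;
  -- the weights depend only on the rounds already played.
  have hext : weightsAt (centered S (candidate d s₁ 0) (2 * (3 ^ L * (n * (1 + δ / ε))))) ε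
      (δ ^ 2 / ε) (2 * (3 ^ L * (n * (1 + δ / ε)))) (256 * L)
      (extend (rounds ((256 * L) * (256 * L)) d ω)) ((256 * L) * (256 * L)) = weightsAt _ ε
      (δ ^ 2 / ε) (2 * (3 ^ L * (n * (1 + δ / ε)))) (256 * L)
      (fun t j => ω (t * d + j)) ((256 * L) * (256 * L)) :=
    weightsAt_congr fun t ht => by
      simp only [extend, ht, dif_pos]
      rfl
  rw [← hext]
  exact hω

end Correctness

end RobustMean

theorem mainTheorem2 :
    ∃ C ε₀ : ℝ, 1 ≤ C ∧ 0 < ε₀ ∧ C * ε₀ ≤ 1 / 2 ∧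
    ∃ (p : RealRAM.Program) (A K : ℝ) (k : ℕ),
    ∀ (d n : ℕ), 0 < d → 0 < n →
    ∀ (ε δ τ : ℝ), 0 < ε → ε < ε₀ → ε ≤ δ → 0 < τ → τ < 1 →
    ∀ S : Fin n → RobustMean.Vec d,
      (∀ ω : ℕ → Bool, ∃ (t : ℕ) (s : RealRAM.Memory),
        RealRAM.Exec ω p (RobustMean.inputMemory S ε δ τ) t s ∧
        (t : ℝ) ≤ A * ((n : ℝ) * d *
          (1 + Real.log d + Real.log n + Real.log (1 / ε) + Real.log (1 / τ)) ^ k)) ∧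
      ∀ (S₀ : Fin n → RobustMean.Vec d) (μ : RobustMean.Vec d),
        RobustMean.IsStable S₀ (C * ε) δ μ → RobustMean.IsCorruptedVersion ε S₀ S →
        ENNReal.ofReal (1 - τ) ≤
          RealRAM.coins {ω : ℕ → Bool | ∃ (t : ℕ) (s : RealRAM.Memory),
            RealRAM.Exec ω p (RobustMean.inputMemory S ε δ τ) t s ∧
            ‖μ - RobustMean.outputVec d s‖ ≤ K * δ} := by
  -- C = 2 accounts for εn corrupted points and for at most εn of good weight lost to the filter.
  -- The exponent 3 comes from J² rounds with O(J) passes over the data each.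
  refine ⟨2, 1 / 1000, by norm_num, by norm_num, by norm_num, RobustMean.program, 10 ^ 14, 700, 3,
    fun d n hd hn ε δ τ hε hε1 hδ hτ hτ1 S => ⟨fun ω => ?_, fun S₀ μ hS₀ hS => ?_⟩⟩
  · exact RobustMean.exists_exec_program hd hn hε hε1 hδ hτ hτ1 S ω
  · exact RobustMean.ofReal_le_coins_program hd hn hε hε1 hδ hτ hτ1 hS₀ hS
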